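/- Let $G=K^{\mathbb C}$ be a connected complex reductive group with maximal compact subgroup $K$, realized as a closed connected complex subgroup of some $GL_n(\mathbb C)$ with $K=G\cap U(n)$ and Cartan decomposition $G=K\exp\mathfrak p$, where $\mathfrak p=i\mathfrak k$ is the set of Hermitian elements of the Lie algebra $\mathfrak g$ of $G$. Fix a $K$-invariant inner product $\langle\ ,\ \rangle$ on $\mathfrak p$. Let $V$ be a finite-dimensional complex Hilbert space with a holomorphic representation of $G$ that is unitary on $K$, and for a linear subspace $L\subseteq V$ write $\mathbb P(L)\subseteq\mathbb P(V)$ for the image of $L\setminus\{0\}$. Let $\mu\colon\mathbb P(V)\to\mathfrak p$ be a momentum map, that is, a $K$-equivariant map such that for every $\xi\in\mathfrak p$ the gradient of $\langle\mu,\xi\rangle$ with respect to the Fubini–Study metric is the vector field on $\mathbb P(V)$ induced by $\xi$. Let $W\subseteq V$ be an irreducible $G$-subrepresentation, let $\beta$ be an extreme point of the convex hull of $\mu(\mathbb P(W))$, and let $W_{\beta_0}\subseteq W$ be the eigenspace of $\beta$ in $W$ for its largest eigenvalue $\beta_0$ in $W$. Put $$R^{\beta_-}=\{g\in G:\ \lim_{t\to+\infty}\exp(t\beta)\,g\,\exp(-t\beta)=e\}.$$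 Then $W_{\beta_0}$ is a line, and for every nonzero $w_0\in W_{\beta_0}$ the restriction of the action map $$\Phi\colon R^{\beta_-}\times\Bigl(\mathbb P\bigl(W_{\beta_0}+(\mathfrak g\cdot w_0)^{\perp_V}\bigr)\setminus\mathbb P\bigl((W_{\beta_0})^{\perp_V}\bigr)\Bigr)\longrightarrow \mathbb P(V)\setminus\mathbb P\bigl((W_{\beta_0})^{\perp_V}\bigr),\qquad (r,x)\mapsto r\cdot x,$$ is an isomorphism: it is a biholomorphic map, and it is also an isomorphism of algebraic varieties. Here $\perp_V$ denotes the orthogonal complement in $V$. -/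

import Mathlib

noncomputable section

open Filter Topology
open scoped LinearAlgebra.Projectivization ComplexConjugate

namespace LocalStructure

/-! ### Linear complex reductive groups -/

/-- The matrix exponential, with values in the general linear group. -/
def expGL {n : ℕ} (X : Matrix (Fin n) (Fin n) ℂ) : GL (Fin n) ℂ :=
  (Matrix.isUnit_exp X).unit

/-- The Lie algebra `𝔤` of a closed subgroup `G` of `GL_n(ℂ)`: all matrices whose real
one-parameter group lies in `G`. -/
def lieAlg {n : ℕ} (G : Subgroup (GL (Fin n) ℂ)) : Set (Matrix (Fin n) (Fin n) ℂ) :=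
  {X | ∀ t : ℝ, expGL (t • X) ∈ G}

/-- The one-parameter group `t ↦ exp (t X)` in `G` of an element `X` of the Lie algebra. -/
def oneParam {n : ℕ} {G : Subgroup (GL (Fin n) ℂ)} (X : lieAlg G) (t : ℝ) : G :=
  ⟨expGL (t • (X : Matrix (Fin n) (Fin n) ℂ)), X.2 t⟩

/-- The matrix of an element of `G`. -/
def toMat {n : ℕ} {G : Subgroup (GL (Fin n) ℂ)} (g : G) : Matrix (Fin n) (Fin n) ℂ :=
  ((g : GL (Fin n) ℂ) : Matrix (Fin n) (Fin n) ℂ)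

/-- `K = G ∩ U(n)`. -/
def unitaryPart {n : ℕ} (G : Subgroup (GL (Fin n) ℂ)) : Set G :=
  {k | toMat k ∈ Matrix.unitaryGroup (Fin n) ℂ}

/-- `𝔭 = i𝔨`: the Hermitian matrices in the Lie algebra of `G`. -/
def hermPart {n : ℕ} (G : Subgroup (GL (Fin n) ℂ)) : Set (Matrix (Fin n) (Fin n) ℂ) :=
  {ξ | ξ ∈ lieAlg G ∧ ξ.IsHermitian}

/-- An element of `𝔭` as an element of the Lie algebra. -/
def hermToLie {n : ℕ} {G : Subgroup (GL (Fin n) ℂ)} (ξ : hermPart G) : lieAlg G :=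
  ⟨ξ, ξ.2.1⟩

/-- `G` is a connected complex reductive group, realized in `GL_n(ℂ)` as the complexification
`G = K^ℂ` of its compact subgroup `K = G ∩ U(n)`: it is a closed connected complex subgroup, and
the Cartan decomposition `GL_n(ℂ) = U(n) exp(Herm_n)` restricts to `G = K exp(𝔭)`. -/
structure IsConnectedReductive {n : ℕ} (G : Subgroup (GL (Fin n) ℂ)) : Prop where
  closed : IsClosed (G : Set (GL (Fin n) ℂ))
  connected : IsConnected (G : Set (GL (Fin n) ℂ))
  complex : ∀ X ∈ lieAlg G, Complex.I • X ∈ lieAlg G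
  cartan : ∀ g : G, ∃ k ∈ unitaryPart G, ∃ ξ : hermPart G, g = k * oneParam (hermToLie ξ) 1

/-- `B` restricts to a `K`-invariant inner product on `𝔭`. -/
structure IsInvariantInner {n : ℕ} (G : Subgroup (GL (Fin n) ℂ))
    (B : LinearMap.BilinForm ℝ (Matrix (Fin n) (Fin n) ℂ)) : Prop where
  symm : ∀ ξ ∈ hermPart G, ∀ η ∈ hermPart G, B ξ η = B η ξ
  pos : ∀ ξ ∈ hermPart G, ξ ≠ 0 → 0 < B ξ ξ
  invariant : ∀ k ∈ unitaryPart G, ∀ ξ ∈ hermPart G, ∀ η ∈ hermPart G,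
    B (toMat k * ξ * toMat k⁻¹) (toMat k * η * toMat k⁻¹) = B ξ η

/-- `R^{β-} = {g ∈ G : exp(tβ) g exp(-tβ) → e as t → +∞}`. -/
def unipotentRadical {n : ℕ} (G : Subgroup (GL (Fin n) ℂ)) (β : hermPart G) : Set G :=
  {g | Tendsto (fun t : ℝ => oneParam (hermToLie β) t * g * oneParam (hermToLie β) (-t))
    atTop (𝓝 1)}

/-! ### Holomorphic and regular maps

A map between sets `X`, `Y` is described in local or homogeneous coordinates: `rX x c` says that
`c` is a coordinate vector of the point `x`. -/

/-- On the subset `S` of `X`, the map `f` is near each coordinate vector given in coordinates by a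
holomorphic map of the ambient coordinate spaces. -/
def IsHolomorphicOn {X Y C D : Type*}
    [AddCommGroup C] [Module ℂ C] [TopologicalSpace C]
    [AddCommGroup D] [Module ℂ D] [TopologicalSpace D]
    (rX : X → C → Prop) (rY : Y → D → Prop) (S : Set X) (f : X → Y) : Prop :=
  ∀ x ∈ S, ∀ c, rX x c → ∃ F : C → D, ∀ᶠ c' in 𝓝 c,
    DifferentiableAt ℂ F c' ∧ ∀ x' ∈ S, rX x' c' → rY (f x') (F c')

/-- Polynomial functions on a complex vector space. -/
def IsPolynomialFun {C : Type*} [AddCommGroup C] [Module ℂ C] (p : C → ℂ) : Prop :=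
  p ∈ Algebra.adjoin ℂ (Set.range fun l : Module.Dual ℂ C => (l : C → ℂ))

/-- On the subset `S` of `X`, the map `f` is Zariski-locally given in coordinates by a quotient
`P / q` with `P` a polynomial map and `q` a polynomial function. -/
def IsRegularOn {X Y C D : Type*}
    [AddCommGroup C] [Module ℂ C] [AddCommGroup D] [Module ℂ D]
    (rX : X → C → Prop) (rY : Y → D → Prop) (S : Set X) (f : X → Y) : Prop :=
  ∀ x ∈ S, ∀ c, rX x c → ∃ (P : C → D) (q : C → ℂ),
    (∀ l : Module.Dual ℂ D, IsPolynomialFun (fun c' => l (P c'))) ∧ IsPolynomialFun q ∧ q c ≠ 0 ∧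
    ∀ c', q c' ≠ 0 → ∀ x' ∈ S, rX x' c' → rY (f x') ((q c')⁻¹ • P c')

/-- `f` is a biholomorphic map of `S` onto `T`. -/
def IsBiholomorphic {X Y C D : Type*}
    [AddCommGroup C] [Module ℂ C] [TopologicalSpace C]
    [AddCommGroup D] [Module ℂ D] [TopologicalSpace D]
    (rX : X → C → Prop) (rY : Y → D → Prop) (S : Set X) (T : Set Y) (f : X → Y) : Prop :=
  Set.BijOn f S T ∧ IsHolomorphicOn rX rY S f ∧
    ∃ g : Y → X, Set.MapsTo g T S ∧ Set.InvOn g f S T ∧ IsHolomorphicOn rY rX T g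

/-- `f` is an isomorphism of algebraic varieties of `S` onto `T`. -/
def IsBiregular {X Y C D : Type*}
    [AddCommGroup C] [Module ℂ C] [AddCommGroup D] [Module ℂ D]
    (rX : X → C → Prop) (rY : Y → D → Prop) (S : Set X) (T : Set Y) (f : X → Y) : Prop :=
  Set.BijOn f S T ∧ IsRegularOn rX rY S f ∧
    ∃ g : Y → X, Set.MapsTo g T S ∧ Set.InvOn g f S T ∧ IsRegularOn rY rX T g

/-- Coordinates of an element of a linear group: its matrix. -/
def groupCoords {n : ℕ} {G : Subgroup (GL (Fin n) ℂ)} (g : G)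
    (A : Matrix (Fin n) (Fin n) ℂ) : Prop := toMat g = A

/-- Homogeneous coordinates of a point of `ℙ(V)`: the nonzero vectors representing it. -/
def projCoords {V : Type*} [AddCommGroup V] [Module ℂ V] (x : ℙ ℂ V) (v : V) : Prop :=
  ∃ hv : v ≠ 0, x = Projectivization.mk ℂ v hv

/-- Coordinates on `G × ℙ(V)`. -/
def groupProjCoords {n : ℕ} {G : Subgroup (GL (Fin n) ℂ)} {V : Type*} [AddCommGroup V] [Module ℂ V]
    (p : G × ℙ ℂ V) (c : Matrix (Fin n) (Fin n) ℂ × V) : Prop :=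
  groupCoords p.1 c.1 ∧ projCoords p.2 c.2

/-! ### Representations, projective space and momentum maps -/

section Rep

variable {n : ℕ} {G : Subgroup (GL (Fin n) ℂ)} {V : Type*} [NormedAddCommGroup V]
  [InnerProductSpace ℂ V] [FiniteDimensional ℂ V]

/-- `ρ` is a holomorphic representation of `G`. -/
def IsHolomorphicRep (ρ : Representation ℂ G V) : Prop :=
  IsHolomorphicOn (C := Matrix (Fin n) (Fin n) ℂ) (D := V →L[ℂ] V) groupCoords
    (fun (T : V →ₗ[ℂ] V) A => LinearMap.toContinuousLinearMap T = A) Set.univ ρ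

/-- The elements of `K` act by unitary operators. -/
def IsUnitaryRep (ρ : Representation ℂ G V) : Prop :=
  ∀ k ∈ unitaryPart G, ∀ v w : V, inner ℂ (ρ k v) (ρ k w) = inner ℂ v w

/-- The differential of `ρ`: the derivative of `t ↦ ρ (exp (t X))` at `t = 0`. -/
def dRep (ρ : Representation ℂ G V) (X : lieAlg G) : V →L[ℂ] V :=
  deriv (fun t : ℝ => LinearMap.toContinuousLinearMap (ρ (oneParam X t))) 0

/-- The action of `G` on `ℙ(V)`. -/
def projAct (ρ : Representation ℂ G V) (g : G) (x : ℙ ℂ V) : ℙ ℂ V :=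
  Projectivization.map (ρ g) (ρ.apply_bijective g).1 x

/-- `ℙ(W) ⊆ ℙ(V)`. -/
def projSubspace (W : Submodule ℂ V) : Set (ℙ ℂ V) :=
  {x | x.submodule ≤ W}

/-- The Fubini–Study Riemannian metric of `ℙ(V)` at `[v]`, evaluated on the tangent vectors
represented by `a` and `b`. -/
def fubiniStudy (v a b : V) : ℝ :=
  (inner ℂ a b / (‖v‖ : ℂ) ^ 2 - inner ℂ a v * inner ℂ v b / (‖v‖ : ℂ) ^ 4).re

/-- `μ : ℙ(V) → 𝔭` is a momentum map: it is `K`-equivariant, and for each `ξ ∈ 𝔭` the gradient of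
`μ^ξ = ⟨μ, ξ⟩` for the Fubini–Study metric is the vector field on `ℙ(V)` induced by `ξ`. The
gradient condition is tested on differentiable curves in `V ∖ {0}`. -/
structure IsMomentumMap (ρ : Representation ℂ G V)
    (B : LinearMap.BilinForm ℝ (Matrix (Fin n) (Fin n) ℂ)) (μ : ℙ ℂ V → hermPart G) : Prop where
  equivariant : ∀ k ∈ unitaryPart G, ∀ x : ℙ ℂ V,
    (μ (projAct ρ k x) : Matrix (Fin n) (Fin n) ℂ) = toMat k * μ x * toMat k⁻¹
  gradient : ∀ (ξ : hermPart G) (c : ℝ → V) (hc : ∀ t, c t ≠ 0) (w : V), HasDerivAt c w 0 →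
    HasDerivAt (fun t => B (μ (Projectivization.mk ℂ (c t) (hc t))) ξ)
      (fubiniStudy (c 0) (dRep ρ (hermToLie ξ) (c 0)) w) 0

/-- `𝔤 · w`. -/
def lieOrbit (ρ : Representation ℂ G V) (w : V) : Submodule ℂ V :=
  Submodule.span ℂ (Set.range fun X : lieAlg G => dRep ρ X w)

/-- `W_r`, the eigenspace of `β` in `W` with eigenvalue `r`. -/
def eigenspaceIn (ρ : Representation ℂ G V) (β : hermPart G) (W : Submodule ℂ V) (r : ℝ) :
    Submodule ℂ V :=
  W ⊓ Module.End.eigenspace (dRep ρ (hermToLie β)).toLinearMap (r : ℂ)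

/-- `r` is the largest eigenvalue of `β` in `W`. -/
def IsLargestEigenvalueIn (ρ : Representation ℂ G V) (β : hermPart G) (W : Submodule ℂ V)
    (r : ℝ) : Prop :=
  IsGreatest {s : ℝ | eigenspaceIn ρ β W s ≠ ⊥} r

/-- The action map `(g, x) ↦ g · x`. -/
def actionMap (ρ : Representation ℂ G V) (p : G × ℙ ℂ V) : ℙ ℂ V :=
  projAct ρ p.1 p.2

end Rep

end LocalStructure

end

open LocalStructure
open scoped LinearAlgebra.Projectivization

open LocalStructure
open scoped LinearAlgebra.Projectivization

/-! The matrix `β` grades `𝔤`: degree `s` means `[β, X] = -sX`, so positive degree lowers the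
eigenvalues of `β`, and `R^{β-}` consists of the `g ∈ G` with `g - 1` of positive degree. Everything
rests on a unit vector `w ∈ W` with `μ[w] = β` that behaves like an extremal weight vector
(`IsExtremal`): negative degrees kill `w`, degree zero acts on `w` by scalars, and `X ↦ Xw` is
injective in positive degree.

Finding `w`. On unit vectors `⟨μ, ξ⟩` equals `⟨ξv, v⟩ / 2` up to a constant (`moment_sub`). Where
`|μ|` is maximal on `ℙ(W)`, the vector `w` is a top eigenvector of `μ[w]` in `W`, and `μ` is
constant on the top eigenspace. Hence degree zero acts there by scalars, irreducibility makes the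
eigenspace a line, and infinitesimal equivariance gives injectivity in positive degree. It remains
to see that an extreme point `β` is a momentum value of maximal norm. If a functional `⟨·, α⟩` is
maximized over norm-maximal points only, the first and second order conditions along `K`-orbits and
irreducibility show that its maximum over all of `ℙ(W)` is no larger (`inner_le_of_critical`). So
both sets of momentum values have the same hull, and `β` lies in the smaller one
(`exists_isNormMax`).

The slice. The space `ℂw + (𝔤w)^⊥` is cut out by the equations `⟨w, Yv⟩ = 0` for `Y ∈ 𝔤` of negative
degree (`mem_slice_iff`), and `R^{β-}` fixes the functional `⟨w, ·⟩`. If `r - 1` has leading term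
`X` in degree `s`, then `X ∈ 𝔤`, and for `Y` of degree `-s` one has `⟨w, Y r v⟩ = ⟨w, Yv⟩ + ⟨Y*w,
Xw⟩ ⟨w, v⟩` (`inner_apply_apply`). In each degree the slice equation for `rv` is thus linear in the
leading term, with a nondegenerate coefficient where `⟨w, v⟩ ≠ 0`. Solving by increasing degree
gives uniqueness of `r` (`eq_one_of_slice`) and a solution polynomial in `v` (`exists_section`).
Since exponentials in positive degree are finite sums, `ρ` is polynomial on `R^{β-}`
(`exists_isPolyMap_rep`), so the action map and its inverse are regular, hence holomorphic. -/

namespace LocalStructure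

open Filter Topology NormedSpace

/-! ### Closed subgroups of the units of a Banach algebra. -/

section ClosedSubgroup

variable {𝔸 : Type*} [NormedRing 𝔸] [NormedAlgebra ℂ 𝔸] [NormedAlgebra ℚ 𝔸] [CompleteSpace 𝔸]

/-- The Lie algebra of a subgroup of the units of a Banach algebra. -/
def expLie (H : Subgroup 𝔸ˣ) : Set 𝔸 :=
  {X | ∀ t : ℝ, ∃ h ∈ H, (h : 𝔸) = exp ((t : ℂ) • X)}

theorem mem_of_tendsto_val {H : Subgroup 𝔸ˣ} (hH : IsClosed (H : Set 𝔸ˣ)) {ι : Type*}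
    {l : Filter ι} [l.NeBot] {u : ι → 𝔸} (hu : ∀ᶠ i in l, ∃ h ∈ H, (h : 𝔸) = u i) {a : 𝔸}
    (ha : IsUnit a) (hlim : Tendsto u l (𝓝 a)) : ∃ h ∈ H, (h : 𝔸) = a := by
  obtain ⟨v, rfl⟩ := ha
  refine ⟨v, ?_, rfl⟩
  classical
  choose! f hf using fun i => (id : (∃ h ∈ H, (h : 𝔸) = u i) → _)
  refine hH.mem_of_tendsto (f := f) (b := l) ?_ (hu.mono fun i hi => (hf i hi).1)
  rw [Units.isOpenEmbedding_val.isEmbedding.tendsto_nhds_iff]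
  exact hlim.congr' (hu.mono fun i hi => (hf i hi).2.symm)

theorem exists_log (𝔸 : Type*) [NormedRing 𝔸] [NormedAlgebra ℂ 𝔸] [NormedAlgebra ℚ 𝔸]
    [CompleteSpace 𝔸] : ∃ L : 𝔸 → 𝔸, L 1 = 0 ∧ (∀ᶠ x in 𝓝 (1 : 𝔸), exp (L x) = x) ∧
      HasFDerivAt L (ContinuousLinearMap.id ℂ 𝔸) 1 := by
  have h : HasStrictFDerivAt (exp : 𝔸 → 𝔸) ((ContinuousLinearEquiv.refl ℂ 𝔸 : 𝔸 ≃L[ℂ] 𝔸) : 𝔸 →L[ℂ] 𝔸) 0 :=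
    hasStrictFDerivAt_exp_zero
  have h0 : exp (0 : 𝔸) = 1 := exp_zero
  refine ⟨h.localInverse _ _ _, ?_, ?_, ?_⟩
  · have := h.localInverse_apply_image
    rwa [h0] at this
  · have := h.eventually_right_inverse
    rwa [h0] at this
  · have := h.to_localInverse.hasFDerivAt
    rw [h0] at this
    exact this

/-- The powers `u i ^ ⌊s / t i⌋` stay in `H` and converge to `exp (s X)`, because `log (u i) / t i →
X`. This gives closure of the Lie algebra under addition, the exponential chart, and later the fact
that leading terms of unipotent elements lie in `𝔤`. -/
theorem tangent_mem_expLie {H : Subgroup 𝔸ˣ} (hH : IsClosed (H : Set 𝔸ˣ)) {ι : Type*}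
    {l : Filter ι} [l.NeBot] {u : ι → 𝔸} (hu : ∀ᶠ i in l, ∃ h ∈ H, (h : 𝔸) = u i) {t : ι → ℝ}
    (ht : Tendsto t l (𝓝[>] 0)) {X : 𝔸}
    (hX : Tendsto (fun i => ((t i : ℂ))⁻¹ • (u i - 1)) l (𝓝 X)) : X ∈ expLie H := by
  obtain ⟨L, hL1, hLe, hLd⟩ := exists_log 𝔸
  have ht0 : Tendsto t l (𝓝 0) := ht.mono_right nhdsWithin_le_nhds
  have htp : ∀ᶠ i in l, 0 < t i := ht.eventually self_mem_nhdsWithin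
  have hnorm : Tendsto (fun i => ‖((t i : ℂ))⁻¹‖) l atTop := by
    have : Tendsto (fun i => (t i)⁻¹) l atTop := tendsto_inv_nhdsGT_zero.comp ht
    refine this.congr' (htp.mono fun i hi => ?_)
    simp [abs_of_pos hi]
  have hu1 : Tendsto u l (𝓝 1) := by
    have h1 : Tendsto (fun i => (t i : ℂ) • (((t i : ℂ))⁻¹ • (u i - 1))) l (𝓝 (((0 : ℝ) : ℂ) • X)) :=
      ((Complex.continuous_ofReal.tendsto _).comp ht0).smul hX
    simp only [Complex.ofReal_zero, zero_smul] at h1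
    have h2 := h1.add_const 1
    rw [zero_add] at h2
    refine h2.congr' (htp.mono fun i hi => ?_)
    have : (t i : ℂ) ≠ 0 := by exact_mod_cast hi.ne'
    simp [smul_smul, mul_inv_cancel₀ this]
  have hlog : Tendsto (fun i => ((t i : ℂ))⁻¹ • L (u i)) l (𝓝 X) := by
    have := (hasFDerivWithinAt_univ.2 hLd).lim (c := fun i => ((t i : ℂ))⁻¹)
      (d := fun i => u i - 1) (by simpa using hu1.sub_const 1)
      (Eventually.of_forall fun _ => Set.mem_univ _) hX
    simpa [hL1] using this
  have key : ∀ s : ℝ, 0 ≤ s → ∃ h ∈ H, (h : 𝔸) = exp ((s : ℂ) • X) := by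
    intro s hs
    have hm : Tendsto (fun i => ((⌊s * (t i)⁻¹⌋₊ : ℝ) * t i)) l (𝓝 s) := by
      have h1 : Tendsto (fun x : ℝ => (⌊s * x⌋₊ : ℝ) / x) atTop (𝓝 s) :=
        tendsto_nat_floor_mul_div_atTop hs
      have := h1.comp (tendsto_inv_nhdsGT_zero.comp ht)
      refine this.congr fun i => ?_
      simp [div_eq_mul_inv]
    have h2 : Tendsto (fun i => ⌊s * (t i)⁻¹⌋₊ • L (u i)) l (𝓝 ((s : ℂ) • X)) := by
      have := ((Complex.continuous_ofReal.tendsto _).comp hm).smul hlog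
      refine this.congr' (htp.mono fun i hi => ?_)
      have : (t i : ℂ) ≠ 0 := by exact_mod_cast hi.ne'
      simp only [Function.comp, Complex.ofReal_mul, smul_smul, mul_assoc, mul_inv_cancel₀ this, mul_one,
        Complex.ofReal_natCast, Nat.cast_smul_eq_nsmul]
    have h3 : Tendsto (fun i => u i ^ ⌊s * (t i)⁻¹⌋₊) l (𝓝 (exp ((s : ℂ) • X))) := by
      have := (exp_continuous (𝔸 := 𝔸)).tendsto ((s : ℂ) • X) |>.comp h2
      refine this.congr' ((hu1.eventually hLe).mono fun i hi => ?_)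
      simp only [Function.comp]
      rw [exp_nsmul, hi]
    refine mem_of_tendsto_val hH (hu.mono ?_) (isUnit_exp _) h3
    rintro i ⟨h, hh, hi⟩
    exact ⟨h ^ ⌊s * (t i)⁻¹⌋₊, pow_mem hh _, by simp [hi]⟩
  intro s
  rcases le_total 0 s with hs | hs
  · exact key s hs
  · obtain ⟨h, hh, he⟩ := key (-s) (by linarith)
    refine ⟨h⁻¹, inv_mem hh, ?_⟩
    rw [Units.inv_eq_of_mul_eq_one_right]
    rw [he, ← exp_add_of_commute]
    · simp
    · simp [Commute, SemiconjBy]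

theorem hasDerivAt_exp_ofReal_smul (X : 𝔸) (t : ℝ) :
    HasDerivAt (fun u : ℝ => exp ((u : ℂ) • X)) (exp ((t : ℂ) • X) * X) t := by
  have h : HasDerivAt (fun u : ℝ => exp ((u : ℂ) • X)) _ t :=
    (hasDerivAt_exp_smul_const (𝕂 := ℂ) X (t : ℂ)).scomp t Complex.ofRealCLM.hasDerivAt
  exact h.congr_deriv (by simp)

theorem tendsto_slope_exp {c : ℝ → 𝔸} {X : 𝔸} (hc : HasDerivAt c X 0) (h0 : c 0 = 1) :
    Tendsto (fun t : ℝ => ((t : ℂ))⁻¹ • (c t - 1)) (𝓝[>] 0) (𝓝 X) := by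
  have := hc.tendsto_slope_zero_right
  simp only [zero_add, h0] at this
  refine this.congr fun t => ?_
  rw [← Complex.ofReal_inv, Complex.coe_smul]

theorem smul_real_mem_expLie {H : Subgroup 𝔸ˣ} {X : 𝔸} (hX : X ∈ expLie H) (r : ℝ) :
    (r : ℂ) • X ∈ expLie H := by
  intro t
  obtain ⟨h, hh, he⟩ := hX (t * r)
  exact ⟨h, hh, by rw [he, smul_smul]; push_cast; rfl⟩

theorem add_mem_expLie {H : Subgroup 𝔸ˣ} (hH : IsClosed (H : Set 𝔸ˣ)) {X Y : 𝔸}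
    (hX : X ∈ expLie H) (hY : Y ∈ expLie H) : X + Y ∈ expLie H := by
  have hd : HasDerivAt (fun t : ℝ => exp ((t : ℂ) • X) * exp ((t : ℂ) • Y)) (X + Y) 0 := by
    have h : HasDerivAt (fun t : ℝ => exp ((t : ℂ) • X) * exp ((t : ℂ) • Y)) _ 0 :=
      (hasDerivAt_exp_ofReal_smul X 0).mul (hasDerivAt_exp_ofReal_smul Y 0)
    exact h.congr_deriv (by simp)
  refine tangent_mem_expLie hH (Eventually.of_forall fun t => ?_) tendsto_id
    (tendsto_slope_exp hd (by simp))
  obtain ⟨h, hh, he⟩ := hX t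
  obtain ⟨k, hk, hke⟩ := hY t
  exact ⟨h * k, mul_mem hh hk, by simp [he, hke]⟩

/-- The Lie algebra of a closed complex subgroup as a complex subspace. -/
def lieSubmodule (H : Subgroup 𝔸ˣ) (hH : IsClosed (H : Set 𝔸ˣ))
    (hI : ∀ X ∈ expLie H, Complex.I • X ∈ expLie H) : Submodule ℂ 𝔸 where
  carrier := expLie H
  add_mem' := add_mem_expLie hH
  zero_mem' := fun t => ⟨1, one_mem _, by simp⟩
  smul_mem' := by
    intro c X hX
    have : c • X = (c.re : ℂ) • X + (c.im : ℂ) • (Complex.I • X) := by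
      rw [smul_smul, ← add_smul, Complex.re_add_im]
    rw [this]
    exact add_mem_expLie hH (smul_real_mem_expLie hX _) (smul_real_mem_expLie (hI X hX) _)

theorem conj_mem_expLie {H : Subgroup 𝔸ˣ} {h : 𝔸ˣ} (hh : h ∈ H) {X : 𝔸} (hX : X ∈ expLie H) :
    (h : 𝔸) * X * (h⁻¹ : 𝔸ˣ) ∈ expLie H := by
  intro t
  obtain ⟨k, hk, he⟩ := hX t
  refine ⟨h * k * h⁻¹, mul_mem (mul_mem hh hk) (inv_mem hh), ?_⟩
  rw [← smul_mul_assoc, ← mul_smul_comm, exp_units_conj, ← he]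
  simp

theorem hasDerivAt_exp_conj (X Y : 𝔸) :
    HasDerivAt (fun t : ℝ => exp ((t : ℂ) • X) * Y * exp ((t : ℂ) • (-X))) (X * Y - Y * X) 0 := by
  have h : HasDerivAt (fun t : ℝ => exp ((t : ℂ) • X) * Y * exp ((t : ℂ) • (-X))) _ 0 :=
    ((hasDerivAt_exp_ofReal_smul X 0).mul_const Y).mul (hasDerivAt_exp_ofReal_smul (-X) 0)
  exact h.congr_deriv (by simp [sub_eq_add_neg])

theorem mem_of_hasDerivAt_mem {E : Type*} [NormedAddCommGroup E] [NormedSpace ℂ E]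
    (S : Submodule ℂ E) (hS : IsClosed (S : Set E)) {c : ℝ → E} {v : E} (hc : HasDerivAt c v 0)
    (hmem : ∀ t, c t ∈ S) : v ∈ S := by
  refine hS.mem_of_tendsto hc.tendsto_slope_zero_right (Eventually.of_forall fun t => ?_)
  rw [← Complex.coe_smul]
  exact S.smul_mem _ (S.sub_mem (hmem _) (hmem _))

theorem lie_mem_lieSubmodule [FiniteDimensional ℂ 𝔸] {H : Subgroup 𝔸ˣ}
    (hH : IsClosed (H : Set 𝔸ˣ))
    (hI : ∀ X ∈ expLie H, Complex.I • X ∈ expLie H) {X Y : 𝔸} (hX : X ∈ expLie H)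
    (hY : Y ∈ expLie H) : X * Y - Y * X ∈ expLie H := by
  refine mem_of_hasDerivAt_mem (lieSubmodule H hH hI) (Submodule.closed_of_finiteDimensional _)
    (hasDerivAt_exp_conj X Y) fun t => ?_
  obtain ⟨h, hh, he⟩ := hX t
  have h2 : ((h⁻¹ : 𝔸ˣ) : 𝔸) = exp ((t : ℂ) • (-X)) := by
    rw [Units.inv_eq_of_mul_eq_one_right]
    rw [he, ← exp_add_of_commute]
    · simp
    · simp [Commute, SemiconjBy]
  rw [← he, ← h2]
  exact conj_mem_expLie hh hY

/-- Cartan's closed subgroup theorem. For a complement `𝔪` of `𝔤`, the map `(X, Y) ↦ exp X exp Y` is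
a local chart at `1`. If elements `exp Y ∈ H` with `0 ≠ Y ∈ 𝔪` accumulated at `1`, a limit of `Y /
‖Y‖` would be a unit vector of `𝔪` tangent to `H`, hence in `𝔤 ∩ 𝔪 = 0`. -/
theorem eventually_exists_exp_eq [FiniteDimensional ℂ 𝔸] {H : Subgroup 𝔸ˣ}
    (hH : IsClosed (H : Set 𝔸ˣ)) (hI : ∀ X ∈ expLie H, Complex.I • X ∈ expLie H) :
    ∀ᶠ h in 𝓝 (1 : 𝔸ˣ), h ∈ H → ∃ X ∈ expLie H, (h : 𝔸) = exp X := by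
  set 𝔤 := lieSubmodule H hH hI with h𝔤
  obtain ⟨𝔪, hm⟩ := Submodule.exists_isCompl 𝔤
  have hexp : ∀ S : Submodule ℂ 𝔸, HasStrictFDerivAt (fun X : S => exp (X : 𝔸)) S.subtypeL 0 := by
    intro S
    have h1 : HasStrictFDerivAt (exp : 𝔸 → 𝔸) (1 : 𝔸 →L[ℂ] 𝔸) (S.subtypeL 0) := by
      rw [map_zero]; exact hasStrictFDerivAt_exp_zero
    exact h1.comp (0 : S) S.subtypeL.hasStrictFDerivAt
  let e : (𝔤 × 𝔪) ≃L[ℂ] 𝔸 := (Submodule.prodEquivOfIsCompl 𝔤 𝔪 hm).toContinuousLinearEquiv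
  have hd : HasStrictFDerivAt (fun p : 𝔤 × 𝔪 => exp (p.1 : 𝔸) * exp (p.2 : 𝔸)) (e : 𝔤 × 𝔪 →L[ℂ] 𝔸) 0 := by
    have h1 := (hexp 𝔤).comp (0 : 𝔤 × 𝔪) (ContinuousLinearMap.fst ℂ 𝔤 𝔪).hasStrictFDerivAt
    have h2 := (hexp 𝔪).comp (0 : 𝔤 × 𝔪) (ContinuousLinearMap.snd ℂ 𝔤 𝔪).hasStrictFDerivAt
    have h3 : HasStrictFDerivAt (fun p : 𝔤 × 𝔪 => exp (p.1 : 𝔸) * exp (p.2 : 𝔸)) _ 0 := h1.mul' h2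
    refine h3.congr_fderiv ?_
    ext p <;> simp [e]
  have hmap := hd.map_nhds_eq_of_equiv
  simp only [Prod.fst_zero, Prod.snd_zero, ZeroMemClass.coe_zero, exp_zero, mul_one] at hmap
  have claim : ∀ᶠ Y : 𝔪 in 𝓝 0, (∃ h ∈ H, (h : 𝔸) = exp (Y : 𝔸)) → Y = 0 := by
    by_contra hcon
    rw [not_eventually] at hcon
    simp only [Classical.not_imp] at hcon
    obtain ⟨Y, hY0, hY⟩ := exists_seq_forall_of_frequently hcon
    have hcpt : IsCompact (Metric.sphere (0 : 𝔪) 1) := isCompact_sphere 0 1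
    have hn : ∀ k, ‖Y k‖ ≠ 0 := fun k => norm_ne_zero_iff.mpr (hY k).2
    obtain ⟨Z, hZ, φ, hφ, hlim⟩ := hcpt.tendsto_subseq
      (x := fun k => ((‖Y k‖ : ℂ))⁻¹ • Y k) (fun k => by
        have := hn k
        simp only [mem_sphere_zero_iff_norm, norm_smul, norm_inv, Complex.norm_real, norm_norm]
        exact inv_mul_cancel₀ this)
    have hYφ : Tendsto (fun k => Y (φ k)) atTop (𝓝 0) := hY0.comp hφ.tendsto_atTop
    have htp : Tendsto (fun k => ‖Y (φ k)‖) atTop (𝓝[>] 0) := by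
      refine tendsto_nhdsWithin_iff.mpr ⟨by simpa using hYφ.norm, Eventually.of_forall fun k => ?_⟩
      exact norm_pos_iff.mpr (hY _).2
    have hZg : (Z : 𝔸) ∈ expLie H := by
      refine tangent_mem_expLie hH (l := atTop) (u := fun k => exp (Y (φ k) : 𝔸))
        (Eventually.of_forall fun k => (hY _).1) htp ?_
      have := (hasFDerivWithinAt_univ.2 (hexp 𝔪).hasFDerivAt).lim (l := atTop)
        (c := fun k => ((‖Y (φ k)‖ : ℂ))⁻¹) (d := fun k => Y (φ k)) hYφ
        (Eventually.of_forall fun _ => Set.mem_univ _) hlim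
      simpa using this
    have : (Z : 𝔸) = 0 := by
      have := hm.disjoint.le_bot (⟨hZg, Z.2⟩ : (Z : 𝔸) ∈ 𝔤 ⊓ 𝔪)
      simpa using this
    have hZ0 : Z = 0 := Subtype.ext this
    rw [hZ0] at hZ
    simp at hZ
  have hev : ∀ᶠ x in 𝓝 (1 : 𝔸), (∃ h ∈ H, (h : 𝔸) = x) → ∃ X ∈ expLie H, x = exp X := by
    rw [← hmap, eventually_map]
    have h2 : ∀ᶠ p : 𝔤 × 𝔪 in 𝓝 0, (∃ h ∈ H, (h : 𝔸) = exp (p.2 : 𝔸)) → p.2 = 0 :=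
      (continuous_snd.tendsto (0 : 𝔤 × 𝔪)).eventually claim
    filter_upwards [h2] with p hp
    rintro ⟨h, hh, he⟩
    refine ⟨p.1, p.1.2, ?_⟩
    have hp1 : (p.1 : 𝔸) ∈ expLie H := p.1.2
    obtain ⟨k, hk, hke⟩ := hp1 1
    simp only [Complex.ofReal_one, one_smul] at hke
    rw [hp ⟨k⁻¹ * h, mul_mem (inv_mem hk) hh, by
      rw [Units.val_mul, he, ← hke, Units.inv_mul_cancel_left]⟩]
    simp
  have := (Units.continuous_val.tendsto (1 : 𝔸ˣ)).eventually hev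
  exact this.mono fun h hh hH' => hh ⟨h, hH', rfl⟩

/-- By the exponential chart `S ∩ H` contains a neighbourhood of `1` in `H`; it is therefore open
and closed in a connected group. -/
theorem le_of_exp_mem [FiniteDimensional ℂ 𝔸] {H : Subgroup 𝔸ˣ}
    (hH : IsClosed (H : Set 𝔸ˣ)) (hconn : IsConnected (H : Set 𝔸ˣ))
    (hI : ∀ X ∈ expLie H, Complex.I • X ∈ expLie H) (S : Subgroup 𝔸ˣ)
    (hS : ∀ h ∈ H, ∀ X ∈ expLie H, (h : 𝔸) = exp X → h ∈ S) : H ≤ S := by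
  have : ConnectedSpace H := isConnected_iff_connectedSpace.mp hconn
  have hnhds : ((S.subgroupOf H : Subgroup H) : Set H) ∈ 𝓝 (1 : H) := by
    have h1 := (continuous_subtype_val (p := fun x => x ∈ H)).tendsto (1 : H)
    have := h1.eventually (eventually_exists_exp_eq hH hI)
    filter_upwards [this] with h hh
    obtain ⟨X, hX, he⟩ := hh h.2
    exact hS h h.2 X hX he
  have hopen := Subgroup.isOpen_of_mem_nhds _ hnhds
  have hclopen : IsClopen ((S.subgroupOf H : Subgroup H) : Set H) :=
    ⟨Subgroup.isClosed_of_isOpen _ hopen, hopen⟩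
  have huniv := hclopen.eq_univ ⟨1, one_mem _⟩
  intro h hh
  have : (⟨h, hh⟩ : H) ∈ ((S.subgroupOf H : Subgroup H) : Set H) := by rw [huniv]; trivial
  exact this

end ClosedSubgroup

/-! ### The differential of a holomorphic homomorphism. -/

section Differential

variable {𝔸 : Type*} [NormedRing 𝔸] [NormedAlgebra ℂ 𝔸] [NormedAlgebra ℚ 𝔸] [CompleteSpace 𝔸]
  {𝔹 : Type*} [NormedRing 𝔹] [NormedAlgebra ℂ 𝔹] [NormedAlgebra ℚ 𝔹] [CompleteSpace 𝔹]
  {H : Subgroup 𝔸ˣ}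

/-- `D` is the complex derivative at `1` of a local holomorphic extension `F`. It is thereby complex
linear and defined on all of `𝔸`, but off the Lie algebra it may depend on `F`. -/
theorem exists_hasDerivAt_of_holomorphic (R : H →* 𝔹)
    (hR : ∃ F : 𝔸 → 𝔹, ∀ᶠ a in 𝓝 (1 : 𝔸), DifferentiableAt ℂ F a ∧
      ∀ h : H, ((h : 𝔸ˣ) : 𝔸) = a → R h = F a) :
    ∃ D : 𝔸 →L[ℂ] 𝔹, ∀ (c : ℝ → H) (X : 𝔸), c 0 = 1 →
      HasDerivAt (fun t => ((c t : 𝔸ˣ) : 𝔸)) X 0 → HasDerivAt (fun t => R (c t)) (D X) 0 := by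
  obtain ⟨F, hF⟩ := hR
  refine ⟨fderiv ℂ F 1, fun c X h0 hc => ?_⟩
  have h1 : HasFDerivAt F (fderiv ℂ F 1) ((c 0 : 𝔸ˣ) : 𝔸) := by
    rw [h0]; simpa using hF.self_of_nhds.1.hasFDerivAt
  have h2 := (h1.restrictScalars ℝ).comp_hasDerivAt (0 : ℝ) hc
  refine h2.congr_of_eventuallyEq ?_
  have : Tendsto (fun t => ((c t : 𝔸ˣ) : 𝔸)) (𝓝 0) (𝓝 1) := by
    simpa [h0] using hc.continuousAt.tendsto
  exact (this.eventually hF).mono fun t ht => ht.2 _ rfl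

theorem inv_val_eq_exp_neg {u : 𝔸ˣ} {X : 𝔸} (h : (u : 𝔸) = exp X) :
    ((u⁻¹ : 𝔸ˣ) : 𝔸) = exp (-X) := by
  rw [Units.inv_eq_of_mul_eq_one_right]
  rw [h, ← exp_add_of_commute] <;> simp

variable {R : H →* 𝔹} {D : 𝔸 →L[ℂ] 𝔹}

/-- A real one-parameter group in `H` as a curve. -/
noncomputable def expCurve {X : 𝔸} (hX : X ∈ expLie H) (t : ℝ) : H :=
  ⟨(hX t).choose, (hX t).choose_spec.1⟩

theorem val_expCurve {X : 𝔸} (hX : X ∈ expLie H) (t : ℝ) :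
    ((expCurve hX t : 𝔸ˣ) : 𝔸) = exp ((t : ℂ) • X) := (hX t).choose_spec.2

theorem expCurve_zero {X : 𝔸} (hX : X ∈ expLie H) : expCurve hX 0 = 1 := by
  apply Subtype.ext; apply Units.ext; rw [val_expCurve]; simp

theorem expCurve_add {X : 𝔸} (hX : X ∈ expLie H) (s t : ℝ) :
    expCurve hX (s + t) = expCurve hX s * expCurve hX t := by
  apply Subtype.ext; apply Units.ext
  rw [Subgroup.coe_mul, Units.val_mul, val_expCurve, val_expCurve, val_expCurve,
    ← exp_add_of_commute]
  · rw [← add_smul]; push_cast; rfl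
  · exact ((Commute.refl X).smul_left _).smul_right _

theorem hasDerivAt_expCurve
    (hD : ∀ (c : ℝ → H) (X : 𝔸), c 0 = 1 →
      HasDerivAt (fun t => ((c t : 𝔸ˣ) : 𝔸)) X 0 → HasDerivAt (fun t => R (c t)) (D X) 0)
    {X : 𝔸} (hX : X ∈ expLie H) :
    HasDerivAt (fun t => R (expCurve hX t)) (D X) 0 := by
  refine hD _ _ (expCurve_zero hX) ?_
  simp only [val_expCurve]
  exact (hasDerivAt_exp_ofReal_smul X 0).congr_deriv (by simp)

/-- The curve `R (exp (tX))` solves `c' = c · D X`, so its product with `exp (-t D X)` has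
derivative zero. -/
theorem map_expCurve
    (hD : ∀ (c : ℝ → H) (X : 𝔸), c 0 = 1 →
      HasDerivAt (fun t => ((c t : 𝔸ˣ) : 𝔸)) X 0 → HasDerivAt (fun t => R (c t)) (D X) 0)
    {X : 𝔸} (hX : X ∈ expLie H) (t : ℝ) :
    R (expCurve hX t) = exp ((t : ℂ) • D X) := by
  have h1 : ∀ s, HasDerivAt (fun t => R (expCurve hX t)) (R (expCurve hX s) * D X) s := by
    intro s
    have h2 : HasDerivAt (fun t => R (expCurve hX (t - s))) (D X) s := by
      have := (hasDerivAt_expCurve hD hX)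
      rw [← sub_self s] at this
      exact this.comp_sub_const s s
    have h3 := h2.const_mul (R (expCurve hX s))
    refine h3.congr_of_eventuallyEq (Eventually.of_forall fun t => ?_)
    simp only
    rw [← map_mul, ← expCurve_add]
    simp
  have h4 : ∀ s, HasDerivAt (fun t : ℝ => R (expCurve hX t) * exp ((t : ℂ) • (-D X))) 0 s := by
    intro s
    have h5 := (h1 s).mul (hasDerivAt_exp_ofReal_smul (-D X) s)
    refine h5.congr_deriv ?_
    have : Commute (D X) (exp ((s : ℂ) • (-D X))) :=
      Commute.exp_right (((Commute.refl (D X)).neg_right).smul_right _)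
    rw [mul_assoc, this.eq]
    simp [mul_assoc]
  have h6 : R (expCurve hX t) * exp ((t : ℂ) • (-D X)) = R (expCurve hX 0) * exp (((0 : ℝ) : ℂ) • (-D X)) :=
    is_const_of_deriv_eq_zero (fun s => (h4 s).differentiableAt) (fun s => (h4 s).deriv) t 0
  rw [expCurve_zero] at h6
  simp only [map_one, Complex.ofReal_zero, zero_smul, exp_zero, mul_one] at h6
  have h7 : exp ((t : ℂ) • (-D X)) * exp ((t : ℂ) • D X) = 1 := by
    rw [← exp_add_of_commute]
    · simp
    · exact (((Commute.refl (D X)).neg_left).smul_left _).smul_right _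
  calc R (expCurve hX t) = R (expCurve hX t) * (exp ((t : ℂ) • (-D X)) * exp ((t : ℂ) • D X)) := by
        rw [h7, mul_one]
    _ = _ := by rw [← mul_assoc, h6, one_mul]

theorem map_eq_exp
    (hD : ∀ (c : ℝ → H) (X : 𝔸), c 0 = 1 →
      HasDerivAt (fun t => ((c t : 𝔸ˣ) : 𝔸)) X 0 → HasDerivAt (fun t => R (c t)) (D X) 0)
    {X : 𝔸} (hX : X ∈ expLie H) {h : H} (hh : ((h : 𝔸ˣ) : 𝔸) = exp X) :
    R h = exp (D X) := by
  have := map_expCurve hD hX 1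
  rw [show h = expCurve hX 1 by apply Subtype.ext; apply Units.ext; rw [val_expCurve, hh]; simp, this]
  simp

theorem map_conj
    (hD : ∀ (c : ℝ → H) (X : 𝔸), c 0 = 1 →
      HasDerivAt (fun t => ((c t : 𝔸ˣ) : 𝔸)) X 0 → HasDerivAt (fun t => R (c t)) (D X) 0)
    {X : 𝔸} (hX : X ∈ expLie H) (h : H) :
    R h * D X * R h⁻¹ = D (((h : 𝔸ˣ) : 𝔸) * X * ((h⁻¹ : 𝔸ˣ) : 𝔸)) := by
  have h1 := ((hasDerivAt_expCurve hD hX).const_mul (R h)).mul_const (R h⁻¹)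
  have h2 := hD (fun t => h * expCurve hX t * h⁻¹) (((h : 𝔸ˣ) : 𝔸) * X * ((h⁻¹ : 𝔸ˣ) : 𝔸))
    (by rw [expCurve_zero]; simp) ?_
  · refine h1.unique (h2.congr_of_eventuallyEq (Eventually.of_forall fun t => ?_))
    simp
  · simp only [Subgroup.coe_mul, Subgroup.coe_inv, Units.val_mul, val_expCurve]
    exact (((hasDerivAt_exp_ofReal_smul X 0).const_mul _).mul_const _).congr_deriv (by simp)

/-- Differentiate `R(h) D(Y) R(h)⁻¹ = D(h Y h⁻¹)` along `h = exp (tX)`. -/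
theorem map_commutator
    (hD : ∀ (c : ℝ → H) (X : 𝔸), c 0 = 1 →
      HasDerivAt (fun t => ((c t : 𝔸ˣ) : 𝔸)) X 0 → HasDerivAt (fun t => R (c t)) (D X) 0)
    {X Y : 𝔸} (hX : X ∈ expLie H) (hY : Y ∈ expLie H) :
    D (X * Y - Y * X) = D X * D Y - D Y * D X := by
  have h1 := (D.restrictScalars ℝ).hasFDerivAt.comp_hasDerivAt (0 : ℝ) (hasDerivAt_exp_conj X Y)
  refine h1.unique ((hasDerivAt_exp_conj (D X) (D Y)).congr_of_eventuallyEq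
    (Eventually.of_forall fun t => ?_))
  have h2 := map_conj hD hY (expCurve hX t)
  rw [val_expCurve, inv_val_eq_exp_neg (val_expCurve hX t), map_expCurve hD hX] at h2
  have h3 : (expCurve hX t)⁻¹ = expCurve hX (-t) := by
    rw [inv_eq_iff_mul_eq_one, ← expCurve_add]; simp [expCurve_zero]
  rw [h3, map_expCurve hD hX] at h2
  simp only [Function.comp, smul_neg]
  simp only [Complex.ofReal_neg, neg_smul] at h2
  exact h2.symm

end Differential

/-! ### Transfer to linear groups: the Lie algebra, adjoints, the differential of `ρ`. -/

section MatrixGroups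

variable {n : ℕ}

local notation "Mat" => Matrix (Fin n) (Fin n) ℂ

theorem val_expGL (X : Mat) : ((expGL X : GL (Fin n) ℂ) : Mat) = exp X := rfl

theorem ofReal_smul_matrix (t : ℝ) (X : Mat) : (t : ℂ) • X = t • X := by
  ext i j; simp

theorem mem_lieAlg_iff {G : Subgroup (GL (Fin n) ℂ)} {X : Mat} :
    X ∈ lieAlg G ↔ ∀ t : ℝ, ∃ h ∈ G, (h : Mat) = exp ((t : ℂ) • X) := by
  refine forall_congr' fun t => ?_
  rw [ofReal_smul_matrix]
  constructor
  · intro h; exact ⟨_, h, rfl⟩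
  · rintro ⟨h, hh, he⟩
    rwa [show expGL (t • X) = h from Units.ext he.symm]

/-- The `ℓ^∞` operator norm only serves to invoke the Banach algebra results; the statements derived
from them do not involve it. -/
theorem lieAlg_eq_expLie (G : Subgroup (GL (Fin n) ℂ)) :
    lieAlg G = @expLie Mat Matrix.linftyOpNormedRing Matrix.linftyOpNormedAlgebra G := by
  ext X
  exact mem_lieAlg_iff

end MatrixGroups

section MatrixBridge

variable {n : ℕ} {G : Subgroup (GL (Fin n) ℂ)}

local notation "Mat" => Matrix (Fin n) (Fin n) ℂ

theorem tangent_mem_lieAlg (hG : IsClosed (G : Set (GL (Fin n) ℂ))) {ι : Type*}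
    {l : Filter ι} [l.NeBot] {u : ι → Mat} (hu : ∀ᶠ i in l, ∃ h ∈ G, (h : Mat) = u i) {t : ι → ℝ}
    (ht : Tendsto t l (𝓝[>] 0)) {X : Mat}
    (hX : Tendsto (fun i => ((t i : ℂ))⁻¹ • (u i - 1)) l (𝓝 X)) : X ∈ lieAlg G := by
  let _ : NormedRing Mat := Matrix.linftyOpNormedRing
  let _ : NormedAlgebra ℂ Mat := Matrix.linftyOpNormedAlgebra
  let _ : NormedAlgebra ℚ Mat := NormedAlgebra.restrictScalars ℚ ℂ Mat
  rw [lieAlg_eq_expLie]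
  exact tangent_mem_expLie (𝔸 := Mat) (H := G) hG hu ht hX

/-- The Lie algebra of a closed complex linear group as a complex subspace. -/
noncomputable def lieSub (hG : IsConnectedReductive G) : Submodule ℂ Mat :=
  let _ : NormedRing Mat := Matrix.linftyOpNormedRing
  let _ : NormedAlgebra ℂ Mat := Matrix.linftyOpNormedAlgebra
  let _ : NormedAlgebra ℚ Mat := NormedAlgebra.restrictScalars ℚ ℂ Mat
  { carrier := lieAlg G
    add_mem' := by
      intro X Y
      rw [lieAlg_eq_expLie]
      exact add_mem_expLie (𝔸 := Mat) (H := G) hG.closed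
    zero_mem' := by
      rw [lieAlg_eq_expLie]
      exact (lieSubmodule (𝔸 := Mat) G hG.closed
        (by have := hG.complex; rw [lieAlg_eq_expLie] at this; exact this)).zero_mem
    smul_mem' := by
      intro c X
      rw [lieAlg_eq_expLie]
      exact (lieSubmodule (𝔸 := Mat) G hG.closed
        (by have := hG.complex; rw [lieAlg_eq_expLie] at this; exact this)).smul_mem c }

theorem mem_lieSub {hG : IsConnectedReductive G} {X : Mat} : X ∈ lieSub hG ↔ X ∈ lieAlg G :=
  Iff.rfl

theorem lie_mem_lieSub {hG : IsConnectedReductive G} {X Y : Mat} (hX : X ∈ lieSub hG)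
    (hY : Y ∈ lieSub hG) : X * Y - Y * X ∈ lieSub hG := by
  let _ : NormedRing Mat := Matrix.linftyOpNormedRing
  let _ : NormedAlgebra ℂ Mat := Matrix.linftyOpNormedAlgebra
  let _ : NormedAlgebra ℚ Mat := NormedAlgebra.restrictScalars ℚ ℂ Mat
  have hI := hG.complex
  rw [mem_lieSub] at *
  rw [lieAlg_eq_expLie] at *
  have : FiniteDimensional ℂ Mat := inferInstance
  exact lie_mem_lieSubmodule (𝔸 := Mat) (H := G) hG.closed hI hX hY

theorem conj_mem_lieSub {hG : IsConnectedReductive G} {g : GL (Fin n) ℂ} (hg : g ∈ G) {X : Mat}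
    (hX : X ∈ lieSub hG) : (g : Mat) * X * ((g⁻¹ : GL (Fin n) ℂ) : Mat) ∈ lieSub hG := by
  let _ : NormedRing Mat := Matrix.linftyOpNormedRing
  let _ : NormedAlgebra ℂ Mat := Matrix.linftyOpNormedAlgebra
  let _ : NormedAlgebra ℚ Mat := NormedAlgebra.restrictScalars ℚ ℂ Mat
  rw [mem_lieSub] at *
  rw [lieAlg_eq_expLie] at *
  exact conj_mem_expLie (𝔸 := Mat) (H := G) hg hX

theorem le_of_expGL_mem (hG : IsConnectedReductive G) (S : Subgroup (GL (Fin n) ℂ))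
    (hS : ∀ X ∈ lieAlg G, expGL X ∈ S) : G ≤ S := by
  let _ : NormedRing Mat := Matrix.linftyOpNormedRing
  let _ : NormedAlgebra ℂ Mat := Matrix.linftyOpNormedAlgebra
  let _ : NormedAlgebra ℚ Mat := NormedAlgebra.restrictScalars ℚ ℂ Mat
  have hI := hG.complex
  rw [lieAlg_eq_expLie] at *
  have : FiniteDimensional ℂ Mat := inferInstance
  refine le_of_exp_mem (𝔸 := Mat) (H := G) hG.closed hG.connected hI S fun h _ X hX he => ?_
  have : expGL X = h := Units.ext he.symm
  rw [← this]
  exact hS X hX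

theorem expGL_mem {X : Mat} (hX : X ∈ lieAlg G) : expGL X ∈ G := by
  simpa using hX 1

theorem expGL_neg (X : Mat) : expGL (-X) = (expGL X)⁻¹ := by
  apply Units.ext
  rw [val_expGL, Matrix.coe_units_inv, val_expGL, Matrix.exp_neg]

/-- From `g = k exp ξ` follows `g* = exp ξ · k⁻¹`. This is the only use of the Cartan decomposition;
it makes `𝔤` self-adjoint, so that taking adjoints exchanges positive and negative degrees. -/
theorem conjTranspose_val_mem (hG : IsConnectedReductive G) {g : GL (Fin n) ℂ} (hg : g ∈ G) :
    ∃ h ∈ G, (h : Mat) = (g : Mat).conjTranspose := by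
  obtain ⟨k, hk, ξ, he⟩ := hG.cartan ⟨g, hg⟩
  refine ⟨expGL ((1 : ℝ) • (ξ : Mat)) * (k : GL (Fin n) ℂ)⁻¹, mul_mem (ξ.2.1 1) (inv_mem k.2), ?_⟩
  have he' : g = (k : GL (Fin n) ℂ) * expGL ((1 : ℝ) • (ξ : Mat)) := congrArg Subtype.val he
  rw [he', Units.val_mul, Units.val_mul, Matrix.conjTranspose_mul, val_expGL,
    ← Matrix.exp_conjTranspose]
  congr 1
  · simp [ξ.2.2.eq]
  · rw [Matrix.coe_units_inv]
    have := (Matrix.mem_unitaryGroup_iff'.mp hk)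
    exact Matrix.inv_eq_left_inv this

theorem conjTranspose_mem_lieSub {hG : IsConnectedReductive G} {X : Mat} (hX : X ∈ lieSub hG) :
    X.conjTranspose ∈ lieSub hG := by
  intro t
  obtain ⟨h, hh, he⟩ := conjTranspose_val_mem hG (hX t)
  rw [val_expGL, ← Matrix.exp_conjTranspose] at he
  rw [show expGL (t • X.conjTranspose) = h from Units.ext (by rw [he, val_expGL]; simp)]
  exact hh

variable {V : Type*} [NormedAddCommGroup V]
  [InnerProductSpace ℂ V] [FiniteDimensional ℂ V]

/-- The operators of a representation as a homomorphism into continuous linear maps. -/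
noncomputable def opHom (ρ : Representation ℂ G V) : G →* (V →L[ℂ] V) where
  toFun g := LinearMap.toContinuousLinearMap (ρ g)
  map_one' := by ext; simp
  map_mul' g h := by ext; simp

@[simp] theorem opHom_apply (ρ : Representation ℂ G V) (g : G) (v : V) : opHom ρ g v = ρ g v := rfl

theorem exists_differential (hG : IsConnectedReductive G) (ρ : Representation ℂ G V)
    (hρ : IsHolomorphicRep ρ) : ∃ D : Mat →ₗ[ℂ] (V →L[ℂ] V),
      (∀ X : lieAlg G, dRep ρ X = D X) ∧
      (∀ X ∈ lieSub hG, ∀ Y ∈ lieSub hG, D (X * Y - Y * X) = D X * D Y - D Y * D X) ∧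
      (∀ g : G, ∀ X ∈ lieSub hG, opHom ρ g * D X * opHom ρ g⁻¹ = D (toMat g * X * toMat g⁻¹)) ∧
      (∀ g : G, ∀ X ∈ lieSub hG, toMat g = exp X → opHom ρ g = exp (D X)) := by
  let _ : NormedRing Mat := Matrix.linftyOpNormedRing
  let _ : NormedAlgebra ℂ Mat := Matrix.linftyOpNormedAlgebra
  let _ : NormedAlgebra ℚ Mat := NormedAlgebra.restrictScalars ℚ ℂ Mat
  let _ : NormedAlgebra ℚ (V →L[ℂ] V) := NormedAlgebra.restrictScalars ℚ ℂ (V →L[ℂ] V)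
  obtain ⟨F, hF⟩ := hρ 1 trivial 1 (by simp [groupCoords, toMat])
  have hF' : ∀ᶠ a in 𝓝 (1 : Mat), DifferentiableAt ℂ F a ∧
      ∀ h : G, ((h : GL (Fin n) ℂ) : Mat) = a → opHom ρ h = F a :=
    hF.mono fun a ha => ⟨ha.1, fun h hh => ha.2 h trivial hh⟩
  obtain ⟨D, hD⟩ := exists_hasDerivAt_of_holomorphic (𝔸 := Mat) (𝔹 := V →L[ℂ] V) (H := G)
    (opHom ρ) ⟨F, hF'⟩
  refine ⟨D, fun X => ?_, fun X hX Y hY => ?_, fun g X hX => ?_, fun g X hX he => ?_⟩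
  · obtain ⟨X, hX0⟩ := X
    have hX : X ∈ lieSub hG := hX0
    rw [mem_lieSub, lieAlg_eq_expLie] at hX
    have h1 := hasDerivAt_expCurve (𝔸 := Mat) (𝔹 := V →L[ℂ] V) hD hX
    refine HasDerivAt.deriv (h1.congr_of_eventuallyEq (Eventually.of_forall fun t => ?_))
    change opHom ρ (oneParam ⟨X, hX0⟩ t) = opHom ρ _
    congr 1
    apply Subtype.ext; apply Units.ext
    refine Eq.trans ?_ (val_expCurve (𝔸 := Mat) hX t).symm
    change exp (t • X) = _
    rw [← ofReal_smul_matrix]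
    rfl
  · rw [mem_lieSub, lieAlg_eq_expLie] at hX hY
    exact map_commutator (𝔸 := Mat) (𝔹 := V →L[ℂ] V) hD hX hY
  · rw [mem_lieSub, lieAlg_eq_expLie] at hX
    exact map_conj (𝔸 := Mat) (𝔹 := V →L[ℂ] V) hD hX g
  · rw [mem_lieSub, lieAlg_eq_expLie] at hX
    exact map_eq_exp (𝔸 := Mat) (𝔹 := V →L[ℂ] V) hD hX he

end MatrixBridge

/-! ### Representations of `𝔤` compatible with adjoints, and invariant subspaces. -/

section LieRep

variable {n : ℕ} {G : Subgroup (GL (Fin n) ℂ)}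

local notation "Mat" => Matrix (Fin n) (Fin n) ℂ

variable {V : Type*} [NormedAddCommGroup V] [InnerProductSpace ℂ V] [FiniteDimensional ℂ V]

/-- `D` is a representation by operators on `V` of a self-adjoint matrix Lie algebra `𝔤`, compatible
with adjoints. -/
structure IsStarLieRep (𝔤 : Submodule ℂ Mat) (D : Mat →ₗ[ℂ] (V →L[ℂ] V)) : Prop where
  lie_mem : ∀ X ∈ 𝔤, ∀ Y ∈ 𝔤, X * Y - Y * X ∈ 𝔤
  star_mem : ∀ X ∈ 𝔤, X.conjTranspose ∈ 𝔤
  map_lie : ∀ X ∈ 𝔤, ∀ Y ∈ 𝔤, D (X * Y - Y * X) = D X * D Y - D Y * D X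
  adjoint : ∀ X ∈ 𝔤, ∀ v w : V, inner ℂ (D X v) w = inner ℂ v (D X.conjTranspose w)

theorem IsStarLieRep.adjoint' {𝔤 : Submodule ℂ Mat} {D : Mat →ₗ[ℂ] (V →L[ℂ] V)}
    (h : IsStarLieRep 𝔤 D) {X : Mat} (hX : X ∈ 𝔤) (v w : V) :
    inner ℂ (D X.conjTranspose v) w = inner ℂ v (D X w) := by
  simpa using h.adjoint _ (h.star_mem X hX) v w

theorem IsStarLieRep.map_lie_apply {𝔤 : Submodule ℂ Mat} {D : Mat →ₗ[ℂ] (V →L[ℂ] V)}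
    (h : IsStarLieRep 𝔤 D) {X Y : Mat} (hX : X ∈ 𝔤) (hY : Y ∈ 𝔤) (v : V) :
    D X (D Y v) = D Y (D X v) + D (X * Y - Y * X) v := by
  rw [h.map_lie X hX Y hY]; simp

theorem expGL_mem_unitaryPart {X : Mat} (hX : X ∈ lieAlg G) (hs : X.conjTranspose = -X) :
    (⟨expGL X, expGL_mem hX⟩ : G) ∈ unitaryPart G := by
  change exp X ∈ Matrix.unitaryGroup (Fin n) ℂ
  rw [Matrix.mem_unitaryGroup_iff', Matrix.star_eq_conjTranspose, ← Matrix.exp_conjTranspose, hs,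
    ← Matrix.exp_add_of_commute _ _ (by simp)]
  simp

theorem toMat_expGL {X : Mat} (hX : X ∈ lieAlg G) :
    toMat (⟨expGL X, expGL_mem hX⟩ : G) = exp X := rfl

/-- Differentiating unitarity makes `D X` skew-adjoint for skew `X ∈ 𝔤`. The general case follows
from the skew elements `X - X*` and `i(X + X*)`, which lie in `𝔤` because it is complex and
self-adjoint. -/
theorem exists_isStarLieRep (hG : IsConnectedReductive G) (ρ : Representation ℂ G V)
    (hρ : IsHolomorphicRep ρ) (hK : IsUnitaryRep ρ) : ∃ D : Mat →ₗ[ℂ] (V →L[ℂ] V),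
      IsStarLieRep (lieSub hG) D ∧
      (∀ X : lieAlg G, dRep ρ X = D X) ∧
      (∀ g : G, ∀ X ∈ lieSub hG, opHom ρ g * D X * opHom ρ g⁻¹ = D (toMat g * X * toMat g⁻¹)) ∧
      (∀ g : G, ∀ X ∈ lieSub hG, toMat g = exp X → opHom ρ g = exp (D X)) := by
  obtain ⟨D, h1, h2, h3, h4⟩ := exists_differential hG ρ hρ
  refine ⟨D, ⟨fun X hX Y hY => lie_mem_lieSub hX hY, fun X hX => conjTranspose_mem_lieSub hX, h2, ?_⟩,
    h1, h3, h4⟩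
  have skew : ∀ X ∈ lieSub hG, X.conjTranspose = -X → ∀ v w : V,
      inner ℂ (D X v) w = - inner ℂ v (D X w) := by
    intro X hX hs v w
    have hd : ∀ u : V, HasDerivAt (fun t : ℝ => exp ((t : ℂ) • D X) u) (D X u) 0 := by
      intro u
      let _ : NormedAlgebra ℚ (V →L[ℂ] V) := NormedAlgebra.restrictScalars ℚ ℂ (V →L[ℂ] V)
      have := (((ContinuousLinearMap.apply ℂ V u).restrictScalars ℝ).hasFDerivAt).comp_hasDerivAt
        (0 : ℝ) (hasDerivAt_exp_ofReal_smul (D X) 0)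
      exact this.congr_deriv (by simp)
    have hc : ∀ t : ℝ, inner ℂ (exp ((t : ℂ) • D X) v) (exp ((t : ℂ) • D X) w) = inner ℂ v w := by
      intro t
      have hX' : (t : ℂ) • X ∈ lieSub hG := (lieSub hG).smul_mem _ hX
      have hk := expGL_mem_unitaryPart (G := G) hX' (by
        rw [ofReal_smul_matrix, Matrix.conjTranspose_smul, hs]; simp)
      have := hK _ hk v w
      rw [← opHom_apply, ← opHom_apply, h4 _ _ hX' (toMat_expGL hX'), map_smul] at this
      exact this
    have h5 := (hd v).inner ℂ (hd w)
    simp only [hc] at h5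
    have h6 := h5.unique (hasDerivAt_const (0 : ℝ) (inner ℂ v w))
    simp only [Complex.ofReal_zero, zero_smul, exp_zero, ContinuousLinearMap.one_apply] at h6
    linear_combination h6
  intro X hX v w
  have hX' := conjTranspose_mem_lieSub hX
  have ha := skew (X - X.conjTranspose) (Submodule.sub_mem _ hX hX') (by simp) v w
  have hb := skew (Complex.I • (X + X.conjTranspose)) (Submodule.smul_mem _ _ (Submodule.add_mem _ hX hX'))
    (by rw [Matrix.conjTranspose_smul, Matrix.conjTranspose_add, Matrix.conjTranspose_conjTranspose,
      add_comm X]; simp; abel) v w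
  simp only [map_sub, map_smul, map_add, sub_apply, add_apply,
    smul_apply, inner_sub_left, inner_sub_right, inner_smul_left, inner_smul_right,
    inner_add_left, inner_add_right, Complex.conj_I] at ha hb
  have hI : Complex.I * Complex.I = -1 := Complex.I_mul_I
  linear_combination ha / 2 + Complex.I / 2 * hb + (1/2) * (inner ℂ (D X v) w + inner ℂ (D X.conjTranspose v) w - inner ℂ v (D X w) - inner ℂ v (D X.conjTranspose w)) * hI

theorem exp_apply_mem {T : V →L[ℂ] V} {M : Submodule ℂ V} (hT : ∀ v ∈ M, T v ∈ M) {v : V}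
    (hv : v ∈ M) : exp T v ∈ M := by
  have hpow : ∀ k : ℕ, (T ^ k) v ∈ M := by
    intro k
    induction k with
    | zero => simpa using hv
    | succ k ih => rw [pow_succ']; exact hT _ ih
  have h1 := NormedSpace.exp_series_hasSum_exp' (𝕂 := ℂ) T
  have h2 := h1.mapL (ContinuousLinearMap.apply ℂ V v)
  refine (Submodule.closed_of_finiteDimensional M).mem_of_tendsto h2 (Eventually.of_forall fun s => ?_)
  refine Submodule.sum_mem _ fun k _ => ?_
  simp only [ContinuousLinearMap.apply_apply, smul_apply]
  exact M.smul_mem _ (hpow k)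

/-- The elements of `G` that preserve `M` together with their inverses form a subgroup containing
`exp 𝔤`, and `G` is connected. -/
theorem apply_mem_of_lie_stable (hG : IsConnectedReductive G) {ρ : Representation ℂ G V}
    {D : Mat →ₗ[ℂ] (V →L[ℂ] V)}
    (hexp : ∀ g : G, ∀ X ∈ lieSub hG, toMat g = exp X → opHom ρ g = exp (D X))
    {M : Submodule ℂ V} (hM : ∀ X ∈ lieSub hG, ∀ v ∈ M, D X v ∈ M) (g : G) {v : V} (hv : v ∈ M) :
    ρ g v ∈ M := by
  let S : Subgroup G :=
    { carrier := {g | (∀ v ∈ M, ρ g v ∈ M) ∧ ∀ v ∈ M, ρ g⁻¹ v ∈ M}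
      one_mem' := by simp
      mul_mem' := by
        rintro a b ⟨ha, ha'⟩ ⟨hb, hb'⟩
        refine ⟨fun v hv => ?_, fun v hv => ?_⟩
        · rw [map_mul]; exact ha _ (hb _ hv)
        · rw [mul_inv_rev, map_mul]; exact hb' _ (ha' _ hv)
      inv_mem' := by
        rintro a ⟨ha, ha'⟩
        exact ⟨ha', by simpa using ha⟩ }
  have hle : G ≤ S.map G.subtype := by
    refine le_of_expGL_mem hG _ fun X hX => ?_
    refine ⟨⟨expGL X, expGL_mem hX⟩, ⟨fun v hv => ?_, fun v hv => ?_⟩, rfl⟩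
    · rw [← opHom_apply, hexp _ X hX (toMat_expGL hX)]
      exact exp_apply_mem (hM X hX) hv
    · rw [← opHom_apply, hexp _ (-X) ((lieSub hG).neg_mem hX)]
      · refine exp_apply_mem (fun v hv => ?_) hv
        rw [map_neg]
        exact M.neg_mem (hM X hX v hv)
      · rw [← val_expGL, expGL_neg]; rfl
  obtain ⟨g', hg', he⟩ := hle g.2
  obtain rfl : g' = g := Subtype.ext he
  exact hg'.1 v hv

theorem lie_stable_of_apply_mem (hG : IsConnectedReductive G) {ρ : Representation ℂ G V}
    {D : Mat →ₗ[ℂ] (V →L[ℂ] V)}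
    (hexp : ∀ g : G, ∀ X ∈ lieSub hG, toMat g = exp X → opHom ρ g = exp (D X))
    {M : Submodule ℂ V} (hM : ∀ g : G, ∀ v ∈ M, ρ g v ∈ M) {X : Mat} (hX : X ∈ lieSub hG) {v : V}
    (hv : v ∈ M) : D X v ∈ M := by
  let _ : NormedAlgebra ℚ (V →L[ℂ] V) := NormedAlgebra.restrictScalars ℚ ℂ (V →L[ℂ] V)
  have hd := (((ContinuousLinearMap.apply ℂ V v).restrictScalars ℝ).hasFDerivAt).comp_hasDerivAt
        (0 : ℝ) (hasDerivAt_exp_ofReal_smul (D X) 0)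
  have hd' : HasDerivAt (fun t : ℝ => exp ((t : ℂ) • D X) v) (D X v) 0 := hd.congr_deriv (by simp)
  refine mem_of_hasDerivAt_mem M (Submodule.closed_of_finiteDimensional M) hd' fun t => ?_
  have hX' : (t : ℂ) • X ∈ lieSub hG := (lieSub hG).smul_mem _ hX
  rw [← map_smul, ← hexp _ _ hX' (toMat_expGL hX')]
  exact hM _ _ hv

/-- An irreducible subrepresentation is contained in every nonzero Lie algebra stable subspace that
meets it. -/
theorem le_of_lie_stable (hG : IsConnectedReductive G) {ρ : Representation ℂ G V}
    {D : Mat →ₗ[ℂ] (V →L[ℂ] V)}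
    (hexp : ∀ g : G, ∀ X ∈ lieSub hG, toMat g = exp X → opHom ρ g = exp (D X))
    {W : Subrepresentation ρ} (hW : W.toRepresentation.IsIrreducible)
    {M : Submodule ℂ V} (hM : ∀ X ∈ lieSub hG, ∀ v ∈ M, D X v ∈ M) {w : V} (hw : w ∈ W.toSubmodule)
    (hw0 : w ≠ 0) (hwM : w ∈ M) : W.toSubmodule ≤ M := by
  let S : Subrepresentation W.toRepresentation :=
    { toSubmodule := M.comap W.toSubmodule.subtype
      apply_mem_toSubmodule := fun g v hv => apply_mem_of_lie_stable hG hexp hM g hv }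
  rcases hW.eq_bot_or_eq_top S with h | h
  · exfalso
    have : (⟨w, hw⟩ : W.toSubmodule) ∈ S.toSubmodule := hwM
    rw [h] at this
    exact hw0 (congrArg Subtype.val ((Submodule.mem_bot ℂ).mp this))
  · intro v hv
    have : (⟨v, hv⟩ : W.toSubmodule) ∈ S.toSubmodule := by rw [h]; trivial
    exact this

/-- If `𝔤 w` lies in the subspace generated by `w` under a subset `𝔮` of `𝔤`, then that subspace is
`𝔤`-stable. -/
theorem le_of_stable_of_generating (hG : IsConnectedReductive G) {ρ : Representation ℂ G V}
    {D : Mat →ₗ[ℂ] (V →L[ℂ] V)} (hD : IsStarLieRep (lieSub hG) D)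
    (hexp : ∀ g : G, ∀ X ∈ lieSub hG, toMat g = exp X → opHom ρ g = exp (D X))
    {W : Subrepresentation ρ} (hW : W.toRepresentation.IsIrreducible)
    {w : V} (hw : w ∈ W.toSubmodule) (hw0 : w ≠ 0) {𝔮 : Set Mat} (h𝔮 : 𝔮 ⊆ lieSub hG)
    (hbase : ∀ M : Submodule ℂ V, w ∈ M → (∀ X ∈ 𝔮, ∀ v ∈ M, D X v ∈ M) →
      ∀ Y ∈ lieSub hG, D Y w ∈ M)
    {N : Submodule ℂ V} (hwN : w ∈ N) (hN : ∀ X ∈ 𝔮, ∀ v ∈ N, D X v ∈ N) : W.toSubmodule ≤ N := by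
  set 𝓜 : Set (Submodule ℂ V) := {M | w ∈ M ∧ ∀ X ∈ 𝔮, ∀ v ∈ M, D X v ∈ M} with h𝓜
  set M := sInf 𝓜 with hMdef
  have hwM : w ∈ M := Submodule.mem_sInf.mpr fun p hp => hp.1
  have hMq : ∀ X ∈ 𝔮, ∀ v ∈ M, D X v ∈ M := fun X hX v hv =>
    Submodule.mem_sInf.mpr fun p hp => hp.2 X hX v (Submodule.mem_sInf.mp hv p hp)
  have hMle : ∀ p ∈ 𝓜, M ≤ p := fun p hp => sInf_le hp
  -- `M` is the smallest `𝔮`-stable subspace containing `w`. The vectors `v ∈ M` with `𝔤v ⊆ M` form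
  -- a `𝔮`-stable subspace, since `YXv = XYv + [Y, X]v`, and `hbase` puts `w` into it. By minimality
  -- it is all of `M`, so `M` is `𝔤`-stable.
  let M' : Submodule ℂ V :=
    { carrier := {v | v ∈ M ∧ ∀ Y ∈ lieSub hG, D Y v ∈ M}
      zero_mem' := by simp
      add_mem' := by
        rintro a b ⟨ha, ha'⟩ ⟨hb, hb'⟩
        exact ⟨M.add_mem ha hb, fun Y hY => by rw [map_add]; exact M.add_mem (ha' Y hY) (hb' Y hY)⟩
      smul_mem' := by
        rintro c a ⟨ha, ha'⟩
        exact ⟨M.smul_mem c ha, fun Y hY => by rw [map_smul]; exact M.smul_mem c (ha' Y hY)⟩ }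
  have hM' : M ≤ M' := by
    refine hMle M' ⟨⟨hwM, hbase M hwM hMq⟩, ?_⟩
    rintro X hX v ⟨hv, hv'⟩
    refine ⟨hMq X hX v hv, fun Y hY => ?_⟩
    rw [hD.map_lie_apply hY (h𝔮 hX)]
    exact M.add_mem (hMq X hX _ (hv' Y hY)) (hv' _ (hD.lie_mem Y hY X (h𝔮 hX)))
  refine (le_of_lie_stable hG hexp hW (fun X hX v hv => (hM' hv).2 X hX) hw hw0 hwM).trans ?_
  exact hMle N ⟨hwN, hN⟩

end LieRep

/-! ### The exponential series: nilpotent elements and second order remainders. -/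

section ExpSeries

variable {𝔸 : Type*} [NormedRing 𝔸] [NormedAlgebra ℂ 𝔸] [CompleteSpace 𝔸]

theorem exp_eq_sum_range_of_pow_eq_zero {X : 𝔸} {N : ℕ} (hN : X ^ N = 0) :
    exp X = ∑ k ∈ Finset.range N, ((k.factorial : ℂ)⁻¹) • X ^ k := by
  have h1 := NormedSpace.exp_series_hasSum_exp' (𝕂 := ℂ) X
  refine h1.unique (hasSum_sum_of_ne_finset_zero fun k hk => ?_)
  rw [Finset.mem_range, not_lt] at hk
  rw [pow_eq_zero_of_le hk hN, smul_zero]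

theorem exp_sub_one_sub_mem [FiniteDimensional ℂ 𝔸] {S : Submodule ℂ 𝔸} {X : 𝔸}
    (h : ∀ k, X ^ (k + 2) ∈ S) : exp X - 1 - X ∈ S := by
  have h1 := NormedSpace.exp_series_hasSum_exp' (𝕂 := ℂ) X
  rw [← hasSum_nat_add_iff' 2] at h1
  have h2 : exp X - 1 - X = exp X - ∑ i ∈ Finset.range 2, ((i.factorial : ℂ)⁻¹) • X ^ i := by
    simp [Finset.sum_range_succ, sub_sub]
  rw [h2]
  exact (Submodule.closed_of_finiteDimensional S).mem_of_tendsto h1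
    (Eventually.of_forall fun s => Submodule.sum_mem _ fun k _ => S.smul_mem _ (h k))

end ExpSeries

/-! ### The grading of matrices by the eigenvalues of `ad β`. -/

section Grading

variable {n : ℕ}

local notation "Mat" => Matrix (Fin n) (Fin n) ℂ

theorem matrix_exp_eq_sum {X : Mat} {N : ℕ} (hN : X ^ N = 0) :
    exp X = ∑ k ∈ Finset.range N, ((k.factorial : ℂ)⁻¹) • X ^ k := by
  let _ : NormedRing Mat := Matrix.linftyOpNormedRing
  let _ : NormedAlgebra ℂ Mat := Matrix.linftyOpNormedAlgebra
  exact exp_eq_sum_range_of_pow_eq_zero (𝔸 := Mat) hN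

theorem matrix_exp_sub_one_sub_mem {S : Submodule ℂ Mat} {X : Mat}
    (h : ∀ k, X ^ (k + 2) ∈ S) : exp X - 1 - X ∈ S := by
  let _ : NormedRing Mat := Matrix.linftyOpNormedRing
  let _ : NormedAlgebra ℂ Mat := Matrix.linftyOpNormedAlgebra
  have : FiniteDimensional ℂ Mat := inferInstance
  exact exp_sub_one_sub_mem (𝔸 := Mat) h

variable {β : Matrix (Fin n) (Fin n) ℂ} (hβ : β.IsHermitian)

/-- Conjugation by the unitary matrix of eigenvectors of `β`. -/
noncomputable def eigConj : Mat ≃⋆ₐ[ℂ] Mat :=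
  Unitary.conjStarAlgAut ℂ _ hβ.eigenvectorUnitary

theorem eigConj_diagonal :
    eigConj hβ (Matrix.diagonal fun i => (hβ.eigenvalues i : ℂ)) = β :=
  hβ.spectral_theorem.symm

/-- The entries of a matrix in an orthonormal eigenbasis of `β`. -/
noncomputable def eigCoord (X : Mat) : Mat := (eigConj hβ).symm X

theorem eigCoord_mul (X Y : Mat) : eigCoord hβ (X * Y) = eigCoord hβ X * eigCoord hβ Y :=
  map_mul (eigConj hβ).symm X Y

theorem eigCoord_sub (X Y : Mat) : eigCoord hβ (X - Y) = eigCoord hβ X - eigCoord hβ Y :=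
  map_sub (eigConj hβ).symm X Y

theorem eigCoord_add (X Y : Mat) : eigCoord hβ (X + Y) = eigCoord hβ X + eigCoord hβ Y :=
  map_add (eigConj hβ).symm X Y

theorem eigCoord_smul (c : ℂ) (X : Mat) : eigCoord hβ (c • X) = c • eigCoord hβ X :=
  map_smul (eigConj hβ).symm c X

theorem eigCoord_one : eigCoord hβ 1 = 1 := map_one (eigConj hβ).symm

theorem eigCoord_eigConj (X : Mat) : eigCoord hβ (eigConj hβ X) = X :=
  (eigConj hβ).symm_apply_apply X

theorem eigConj_eigCoord (X : Mat) : eigConj hβ (eigCoord hβ X) = X :=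
  (eigConj hβ).apply_symm_apply X

theorem eigCoord_conjTranspose (X : Mat) :
    eigCoord hβ X.conjTranspose = (eigCoord hβ X).conjTranspose :=
  map_star (eigConj hβ).symm X

theorem eigCoord_self :
    eigCoord hβ β = Matrix.diagonal fun i => (hβ.eigenvalues i : ℂ) := by
  rw [← eigCoord_eigConj hβ (Matrix.diagonal _), eigConj_diagonal]

theorem eigCoord_injective : Function.Injective (eigCoord hβ) := (eigConj hβ).symm.injective

theorem eigCoord_lie (X : Mat) (i j : Fin n) :
    eigCoord hβ (β * X - X * β) i j =
      ((hβ.eigenvalues i : ℂ) - hβ.eigenvalues j) * eigCoord hβ X i j := by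
  rw [eigCoord_sub, eigCoord_mul, eigCoord_mul, eigCoord_self]
  simp [Matrix.diagonal_mul, Matrix.mul_diagonal]; ring

/-- The amount by which the matrix unit `(i, j)` lowers the eigenvalues of `β`. -/
noncomputable def eigDeg (i j : Fin n) : ℝ := hβ.eigenvalues j - hβ.eigenvalues i

/-- The matrices all of whose homogeneous components have degree in `p`. -/
noncomputable def gradedPart (p : ℝ → Prop) : Submodule ℂ Mat where
  carrier := {X | ∀ i j, ¬ p (eigDeg hβ i j) → eigCoord hβ X i j = 0}
  add_mem' := by
    intro a b ha hb i j h
    simp [eigCoord_add, ha i j h, hb i j h]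
  zero_mem' := by
    intro i j _
    have : eigCoord hβ (0 : Mat) = 0 := map_zero (eigConj hβ).symm
    simp [this]
  smul_mem' := by
    intro c a ha i j h
    simp [eigCoord_smul, ha i j h]

variable {hβ}

theorem mem_gradedPart {p : ℝ → Prop} {X : Mat} :
    X ∈ gradedPart hβ p ↔ ∀ i j, ¬ p (eigDeg hβ i j) → eigCoord hβ X i j = 0 := Iff.rfl

theorem gradedPart_mono {p q : ℝ → Prop} (h : ∀ i j, p (eigDeg hβ i j) → q (eigDeg hβ i j)) {X : Mat}
    (hX : X ∈ gradedPart hβ p) : X ∈ gradedPart hβ q :=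
  fun i j hq => hX i j fun hp => hq (h i j hp)

theorem gradedPart_mono' {p q : ℝ → Prop} (h : ∀ s, p s → q s) {X : Mat}
    (hX : X ∈ gradedPart hβ p) : X ∈ gradedPart hβ q :=
  gradedPart_mono (fun _ _ => h _) hX

theorem mul_mem_gradedPart {p q r : ℝ → Prop} (h : ∀ s t, p s → q t → r (s + t)) {X Y : Mat}
    (hX : X ∈ gradedPart hβ p) (hY : Y ∈ gradedPart hβ q) : X * Y ∈ gradedPart hβ r := by
  intro i j hr
  rw [eigCoord_mul, Matrix.mul_apply]
  refine Finset.sum_eq_zero fun k _ => ?_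
  by_cases hp : p (eigDeg hβ i k)
  · by_cases hq : q (eigDeg hβ k j)
    · exact absurd (by have := h _ _ hp hq; rwa [show eigDeg hβ i k + eigDeg hβ k j = eigDeg hβ i j by
        simp [eigDeg]] at this) hr
    · rw [hY k j hq, mul_zero]
  · rw [hX i k hp, zero_mul]

theorem one_mem_gradedPart {p : ℝ → Prop} (h : p 0) : (1 : Mat) ∈ gradedPart hβ p := by
  intro i j hp
  rw [eigCoord_one]
  refine Matrix.one_apply_ne fun hij => hp ?_
  subst hij
  simpa [eigDeg] using h

theorem conjTranspose_mem_gradedPart {p q : ℝ → Prop} (h : ∀ s, p s → q (-s)) {X : Mat}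
    (hX : X ∈ gradedPart hβ p) : X.conjTranspose ∈ gradedPart hβ q := by
  intro i j hq
  rw [eigCoord_conjTranspose, Matrix.conjTranspose_apply, hX j i, star_zero]
  intro hp
  exact hq (by simpa [eigDeg] using h _ hp)

/-- In an eigenbasis of `β` with eigenvalues `λ`, `ad β` multiplies the `(i, j)` entry by `λ i - λ j
= -eigDeg i j`. Degree `s` is thus the eigenvalue `-s`. -/
theorem mem_gradedPart_eq_iff {s : ℝ} {X : Mat} :
    X ∈ gradedPart hβ (· = s) ↔ β * X - X * β = -(s : ℂ) • X := by
  rw [← (eigCoord_injective hβ).eq_iff, mem_gradedPart]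
  rw [← Matrix.ext_iff]
  refine forall_congr' fun i => forall_congr' fun j => ?_
  rw [eigCoord_lie, eigCoord_smul, Matrix.smul_apply, smul_eq_mul]
  have h1 : ((hβ.eigenvalues i : ℂ) - hβ.eigenvalues j) = -((eigDeg hβ i j : ℝ) : ℂ) := by
    simp [eigDeg]
  rw [h1]
  by_cases hd : eigDeg hβ i j = s
  · simp [hd]
  · simp only [hd, not_false_eq_true, forall_const]
    constructor
    · intro h; simp [h]
    · intro h
      have h2 : (((eigDeg hβ i j : ℝ) : ℂ) - s) * eigCoord hβ X i j = 0 := by linear_combination -h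
      rcases mul_eq_zero.mp h2 with h3 | h3
      · exact absurd (by exact_mod_cast sub_eq_zero.mp h3) hd
      · exact h3

variable (hβ) in
/-- The homogeneous component of degree `s`. -/
noncomputable def degComp (s : ℝ) : Mat →ₗ[ℂ] Mat where
  toFun X := eigConj hβ (Matrix.of fun i j =>
    open Classical in if eigDeg hβ i j = s then eigCoord hβ X i j else 0)
  map_add' X Y := by
    rw [← map_add]; congr 1; ext i j
    simp only [eigCoord_add, Matrix.of_apply, Matrix.add_apply]
    split_ifs <;> simp
  map_smul' c X := by
    rw [RingHom.id_apply, ← map_smul]; congr 1; ext i j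
    simp only [eigCoord_smul, Matrix.of_apply, Matrix.smul_apply]
    split_ifs <;> simp

theorem eigCoord_degComp (s : ℝ) (X : Mat) (i j : Fin n) : eigCoord hβ (degComp hβ s X) i j =
    open Classical in if eigDeg hβ i j = s then eigCoord hβ X i j else 0 := by
  simp only [degComp, LinearMap.coe_mk, AddHom.coe_mk, eigCoord_eigConj, Matrix.of_apply]

theorem degComp_mem (s : ℝ) (X : Mat) : degComp hβ s X ∈ gradedPart hβ (· = s) := by
  intro i j h
  rw [eigCoord_degComp, if_neg h]

theorem sub_degComp_mem {p : ℝ → Prop} {s : ℝ} {X : Mat} (hX : X ∈ gradedPart hβ p) :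
    X - degComp hβ s X ∈ gradedPart hβ (fun t => p t ∧ t ≠ s) := by
  intro i j h
  rw [eigCoord_sub, Matrix.sub_apply, eigCoord_degComp]
  split_ifs with hs
  · simp
  · rw [hX i j fun hp => h ⟨hp, hs⟩, sub_zero]

/-- A subspace stable under `ad β` is spanned by the homogeneous elements it contains. -/
theorem le_of_homogeneous_mem {Q S : Submodule ℂ Mat} (hQ : ∀ X ∈ Q, β * X - X * β ∈ Q)
    (hS : ∀ s : ℝ, ∀ X ∈ Q, X ∈ gradedPart hβ (· = s) → X ∈ S) : Q ≤ S := by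
  let f : Module.End ℂ Mat := LinearMap.mulLeft ℂ β - LinearMap.mulRight ℂ β
  have hf : ∀ X, f X = β * X - X * β := fun X => rfl
  have hmem : ∀ (μ : ℂ) (X : Mat), X ∈ f.genEigenspace μ 1 ↔ β * X - X * β = μ • X := by
    intro μ X
    rw [← hf]; exact Module.End.mem_eigenspace_iff
  have htop : ⨆ μ, f.genEigenspace μ 1 = ⊤ := by
    rw [eq_top_iff]
    intro X _
    have hX : X = ∑ i, ∑ j, eigConj hβ (Matrix.single i j (eigCoord hβ X i j)) := by
      conv_lhs => rw [← eigConj_eigCoord hβ X, Matrix.matrix_eq_sum_single (eigCoord hβ X)]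
      simp only [map_sum]
    rw [hX]
    refine Submodule.sum_mem _ fun i _ => Submodule.sum_mem _ fun j _ => ?_
    refine Submodule.mem_iSup_of_mem (-((eigDeg hβ i j : ℝ) : ℂ)) ?_
    rw [hmem]
    refine (mem_gradedPart_eq_iff (hβ := hβ)).mp fun k l hkl => ?_
    rw [eigCoord_eigConj, Matrix.single_apply, if_neg]
    rintro ⟨rfl, rfl⟩
    exact hkl rfl
  rw [Submodule.eq_iSup_inf_genEigenspace (p := Q) 1 (fun X hX => by rw [hf]; exact hQ X hX) htop]
  refine iSup_le fun μ X hX => ?_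
  obtain ⟨hXQ, hXe⟩ := Submodule.mem_inf.mp hX
  rw [hmem] at hXe
  by_cases hX0 : X = 0
  · rw [hX0]; exact S.zero_mem
  · have : ∃ i j, eigCoord hβ X i j ≠ 0 := by
      by_contra hcon
      push Not at hcon
      apply hX0
      apply eigCoord_injective hβ
      rw [show eigCoord hβ (0 : Mat) = 0 from map_zero (eigConj hβ).symm]
      ext i j; exact hcon i j
    obtain ⟨i, j, hij⟩ := this
    have h1 := congrFun (congrFun (congrArg (eigCoord hβ) hXe) i) j
    rw [eigCoord_lie, eigCoord_smul, Matrix.smul_apply, smul_eq_mul] at h1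
    have h2 := mul_right_cancel₀ hij h1
    refine hS (eigDeg hβ i j) X hXQ (mem_gradedPart_eq_iff.mpr ?_)
    rw [hXe, ← h2]
    simp [eigDeg]

variable (hβ) in
/-- The finitely many degrees of the grading. -/
noncomputable def weights : Finset ℝ :=
  open Classical in Finset.image (fun ij : Fin n × Fin n => eigDeg hβ ij.1 ij.2) Finset.univ

theorem eigDeg_mem_weights (i j : Fin n) : eigDeg hβ i j ∈ weights hβ := by
  classical
  exact Finset.mem_image.mpr ⟨(i, j), Finset.mem_univ _, rfl⟩

theorem eq_zero_of_mem_gradedPart {p : ℝ → Prop} (h : ∀ w ∈ weights hβ, ¬ p w) {X : Mat}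
    (hX : X ∈ gradedPart hβ p) : X = 0 := by
  apply eigCoord_injective hβ
  rw [show eigCoord hβ (0 : Mat) = 0 from map_zero (eigConj hβ).symm]
  ext i j
  exact hX i j (h _ (eigDeg_mem_weights i j))

-- Used with `P a` a claim about elements supported in degrees `> a`. As there are finitely many
-- degrees, either none exceeds `a` or `a` can be replaced by the next degree `s`.
variable (hβ) in
theorem weight_induction {P : ℝ → Prop} (hempty : ∀ a, (∀ w ∈ weights hβ, w ≤ a) → P a)
    (hstep : ∀ a s, a < s → (∀ w ∈ weights hβ, a < w → s ≤ w) → P s → P a) (a : ℝ) :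
    P a := by
  classical
  induction hk : ((weights hβ).filter (a < ·)).card using Nat.strong_induction_on generalizing a with
  | _ k ih =>
    rcases ((weights hβ).filter (a < ·)).eq_empty_or_nonempty with h0 | hne
    · refine hempty a fun w hw => ?_
      by_contra hlt
      have : w ∈ (weights hβ).filter (a < ·) := Finset.mem_filter.mpr ⟨hw, not_le.mp hlt⟩
      rw [h0] at this
      simp at this
    · set s := ((weights hβ).filter (a < ·)).min' hne with hs
      have hsm := Finset.mem_filter.mp (Finset.min'_mem _ hne)
      rw [← hs] at hsm
      refine hstep a s hsm.2 (fun w hw haw => Finset.min'_le _ _ (Finset.mem_filter.mpr ⟨hw, haw⟩)) ?_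
      refine ih _ ?_ s rfl
      rw [← hk]
      refine Finset.card_lt_card ⟨fun w hw => ?_, fun hsub => ?_⟩
      · rw [Finset.mem_filter] at hw ⊢
        exact ⟨hw.1, hsm.2.trans hw.2⟩
      · have := hsub (Finset.mem_filter.mpr hsm)
        simp at this

theorem gradedPart_ge_of_gt {a s : ℝ} (h : ∀ w ∈ weights hβ, a < w → s ≤ w) {X : Mat}
    (hX : X ∈ gradedPart hβ (a < ·)) : X ∈ gradedPart hβ (s ≤ ·) :=
  gradedPart_mono (fun i j hij => h _ (eigDeg_mem_weights i j) hij) hX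

theorem pow_mem_gradedPart {s : ℝ} {X : Mat} (hX : X ∈ gradedPart hβ (s ≤ ·)) (k : ℕ) :
    X ^ k ∈ gradedPart hβ (k * s ≤ ·) := by
  induction k with
  | zero => rw [pow_zero]; exact one_mem_gradedPart (by simp)
  | succ k ih =>
    rw [pow_succ]
    refine mul_mem_gradedPart (fun a b ha hb => ?_) ih hX
    push_cast; linarith

-- `X ^ N` has degrees at least `N s`, beyond the largest one. That `N` does not depend on `X` makes
-- `exp` a single polynomial on this graded part.
variable (hβ) in
theorem exists_pow_eq_zero {s : ℝ} (hs : 0 < s) :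
    ∃ N : ℕ, ∀ X ∈ gradedPart hβ (s ≤ ·), X ^ N = 0 := by
  obtain ⟨M, hM⟩ := (weights hβ).bddAbove
  obtain ⟨N, hN⟩ := exists_nat_gt (M / s)
  refine ⟨N, fun X hX => eq_zero_of_mem_gradedPart (hβ := hβ) (fun w hw => ?_) (pow_mem_gradedPart hX N)⟩
  rw [not_le]
  exact (hM hw).trans_lt (by rwa [div_lt_iff₀ hs] at hN)

theorem exp_sub_one_sub_mem_gradedPart {s : ℝ} (hs : 0 < s) {X : Mat}
    (hX : X ∈ gradedPart hβ (s ≤ ·)) : exp X - 1 - X ∈ gradedPart hβ (2 * s ≤ ·) := by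
  refine matrix_exp_sub_one_sub_mem fun k => gradedPart_mono' (fun t ht => ?_) (pow_mem_gradedPart hX _)
  push_cast at ht
  nlinarith [(Nat.cast_nonneg k : (0:ℝ) ≤ k)]

theorem exp_neg_mul_sub_one_mem {s : ℝ} (hs : 0 < s) {r : Mat} (hr : r - 1 ∈ gradedPart hβ (s ≤ ·)) :
    exp (-degComp hβ s (r - 1)) * r - 1 ∈ gradedPart hβ (s < ·) := by
  set X := degComp hβ s (r - 1) with hXdef
  have hX : X ∈ gradedPart hβ (s ≤ ·) := gradedPart_mono' (fun t ht => ht.ge) (degComp_mem s _)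
  have hr0 : r ∈ gradedPart hβ (0 ≤ ·) := by
    have := Submodule.add_mem _ (gradedPart_mono' (q := (0 ≤ ·)) (fun t ht => hs.le.trans ht) hr)
      (one_mem_gradedPart (hβ := hβ) (p := (0 ≤ ·)) le_rfl)
    simpa using this
  -- The decomposition is `exp(-X) r - 1 = (exp(-X) - 1 + X) r + (r - 1 - X) - X (r - 1)`; each
  -- summand has only degrees `> s`.
  have h1 := mul_mem_gradedPart (r := (s < ·)) (fun a b ha hb => by linarith)
    (exp_sub_one_sub_mem_gradedPart hs (Submodule.neg_mem _ hX)) hr0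
  have h2 : r - 1 - X ∈ gradedPart hβ (s < ·) :=
    gradedPart_mono' (fun t ht => lt_of_le_of_ne ht.1 (Ne.symm ht.2)) (sub_degComp_mem (s := s) hr)
  have h3 := mul_mem_gradedPart (r := (s < ·)) (fun a b ha hb => by linarith) hX hr
  have := Submodule.sub_mem _ (Submodule.add_mem _ h1 h2) h3
  convert this using 1
  noncomm_ring

end Grading

/-! ### The group `R^{β-}`: leading terms and factorization into exponentials. -/

section UnipotentRadical

variable {n : ℕ} {G : Subgroup (GL (Fin n) ℂ)}

local notation "Mat" => Matrix (Fin n) (Fin n) ℂ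

theorem tendsto_iff_eigCoord {β : Mat} (hβ : β.IsHermitian) {ι : Type*} {l : Filter ι} {u : ι → Mat}
    {A : Mat} : Tendsto u l (𝓝 A) ↔
      ∀ i j, Tendsto (fun k => eigCoord hβ (u k) i j) l (𝓝 (eigCoord hβ A i j)) := by
  have hc1 : Continuous (eigConj hβ) :=
    LinearMap.continuous_of_finiteDimensional ((eigConj hβ).toAlgEquiv.toLinearMap)
  have hc2 : Continuous (eigConj hβ).symm :=
    LinearMap.continuous_of_finiteDimensional ((eigConj hβ).symm.toAlgEquiv.toLinearMap)
  have h1 : Tendsto u l (𝓝 A) ↔ Tendsto (fun k => eigCoord hβ (u k)) l (𝓝 (eigCoord hβ A)) := by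
    constructor
    · intro h; exact (hc2.tendsto A).comp h
    · intro h
      have := (hc1.tendsto _).comp h
      rw [eigConj_eigCoord] at this
      exact this.congr fun k => eigConj_eigCoord hβ _
  rw [h1]
  exact tendsto_pi_nhds.trans (forall_congr' fun i => tendsto_pi_nhds)

theorem eigCoord_exp {β : Mat} (hβ : β.IsHermitian) (X : Mat) :
    eigCoord hβ (exp X) = exp (eigCoord hβ X) := by
  have hc2 : Continuous (eigConj hβ).symm :=
    LinearMap.continuous_of_finiteDimensional ((eigConj hβ).symm.toAlgEquiv.toLinearMap)
  let _ : NormedRing Mat := Matrix.linftyOpNormedRing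
  let _ : NormedAlgebra ℂ Mat := Matrix.linftyOpNormedAlgebra
  let _ : NormedAlgebra ℚ Mat := NormedAlgebra.restrictScalars ℚ ℂ Mat
  exact NormedSpace.map_exp (𝔸 := Mat) (𝔹 := Mat) (eigConj hβ).symm.toAlgEquiv.toRingEquiv hc2 X

theorem eigCoord_exp_smul_self {β : Mat} (hβ : β.IsHermitian) (t : ℝ) :
    eigCoord hβ (exp (t • β)) =
      Matrix.diagonal fun i => Complex.exp (t * hβ.eigenvalues i) := by
  rw [eigCoord_exp, ← ofReal_smul_matrix, eigCoord_smul, eigCoord_self, ← Matrix.diagonal_smul,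
    Matrix.exp_diagonal]
  congr 1
  funext i
  rw [Pi.coe_exp, Complex.exp_eq_exp_ℂ]
  simp

theorem eigCoord_conj_exp {β : Mat} (hβ : β.IsHermitian) (t : ℝ) (X : Mat) (i j : Fin n) :
    eigCoord hβ (exp (t • β) * X * exp ((-t) • β)) i j =
      (Real.exp (-t * eigDeg hβ i j) : ℂ) * eigCoord hβ X i j := by
  rw [eigCoord_mul, eigCoord_mul, eigCoord_exp_smul_self, eigCoord_exp_smul_self,
    Matrix.mul_diagonal, Matrix.diagonal_mul]
  rw [mul_right_comm, ← Complex.exp_add, eigDeg]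
  push_cast
  congr 2
  ring

theorem isHermitian_coe (β : hermPart G) : (β : Mat).IsHermitian := β.2.2

/-- `exp (tβ) g exp (-tβ)`. -/
noncomputable def betaConj (β : hermPart G) (g : G) (t : ℝ) : G :=
  oneParam (hermToLie β) t * g * oneParam (hermToLie β) (-t)

theorem toMat_betaConj (β : hermPart G) (g : G) (t : ℝ) :
    toMat (betaConj β g t) = exp (t • (β : Mat)) * toMat g * exp ((-t) • (β : Mat)) := rfl

theorem tendsto_iff_toMat {ι : Type*} {l : Filter ι} {u : ι → G} {g : G} :
    Tendsto u l (𝓝 g) ↔ Tendsto (fun k => toMat (u k)) l (𝓝 (toMat g)) := by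
  rw [tendsto_subtype_rng]
  let _ : NormedRing Mat := Matrix.linftyOpNormedRing
  let _ : NormedAlgebra ℂ Mat := Matrix.linftyOpNormedAlgebra
  exact (Units.isOpenEmbedding_val (R := Mat)).isEmbedding.tendsto_nhds_iff

/-- Conjugation by `exp (tβ)` scales an entry of degree `d` by `e^{-td}`. As `t → ∞` this diverges
for `d < 0` unless the entry vanishes, is constant for `d = 0`, and tends to zero for `d > 0`. -/
theorem mem_unipotentRadical_iff {β : hermPart G} {g : G} :
    g ∈ unipotentRadical G β ↔ toMat g - 1 ∈ gradedPart (isHermitian_coe β) (0 < ·) := by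
  have h1 : g ∈ unipotentRadical G β ↔ Tendsto (betaConj β g) atTop (𝓝 1) := Iff.rfl
  rw [h1, tendsto_iff_toMat, tendsto_iff_eigCoord (isHermitian_coe β), mem_gradedPart]
  refine forall_congr' fun i => forall_congr' fun j => ?_
  rw [eigCoord_sub, eigCoord_one, Matrix.sub_apply]
  simp only [toMat_betaConj, eigCoord_conj_exp]
  rw [show toMat (1 : G) = 1 from rfl, eigCoord_one]
  set d := eigDeg (isHermitian_coe β) i j with hd
  set a := eigCoord (isHermitian_coe β) (toMat g) i j
  have hne : d ≠ 0 → (1 : Mat) i j = 0 := by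
    intro h
    refine Matrix.one_apply_ne fun hij => h ?_
    subst hij; simp [hd, eigDeg]
  rcases lt_trichotomy d 0 with h | h | h
  · have hna : ¬ (0 < d) := not_lt.mpr h.le
    rw [hne h.ne, sub_zero]
    simp only [hna, not_false_eq_true, forall_const]
    constructor
    · intro ht
      by_contra ha
      have h2 : Tendsto (fun t : ℝ => Real.exp (-t * d)) atTop atTop := by
        refine Real.tendsto_exp_atTop.comp ?_
        have := tendsto_id.atTop_mul_const (neg_pos.mpr h) (l := atTop (α := ℝ))
        simpa using this
      have h3 := ht.norm.div_const ‖a‖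
      simp only [norm_mul, norm_zero, zero_div] at h3
      have h4 : Tendsto (fun t : ℝ => Real.exp (-t * d)) atTop (𝓝 0) := by
        refine h3.congr fun t => ?_
        rw [mul_div_assoc, div_self (norm_ne_zero_iff.mpr ha), mul_one, Complex.norm_real,
          Real.norm_of_nonneg (Real.exp_pos _).le]
      exact not_tendsto_nhds_of_tendsto_atTop h2 _ h4
    · intro ha; rw [ha]; simp
  · simp only [h, mul_zero, Real.exp_zero, Complex.ofReal_one, one_mul, lt_self_iff_false,
      not_false_eq_true, forall_const, sub_eq_zero]
    exact tendsto_const_nhds_iff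
  · simp only [h, not_true_eq_false, false_imp_iff, iff_true]
    rw [hne h.ne']
    have h2 : Tendsto (fun t : ℝ => Real.exp (-t * d)) atTop (𝓝 0) := by
      refine Real.tendsto_exp_atBot.comp ?_
      have := tendsto_neg_atTop_atBot.atBot_mul_const h (α := ℝ) (l := atTop)
      simpa using this
    have h3 := ((Complex.continuous_ofReal.tendsto 0).comp h2).mul_const a
    simpa using h3

/-- As `t → ∞`, `e^{st} (exp(tβ) g exp(-tβ) - 1)` converges to the leading component, which is
therefore tangent to `G` at `1`. -/
theorem degComp_mem_lieSub (hG : IsConnectedReductive G) (β : hermPart G) {s : ℝ} (hs : 0 < s) {g : G}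
    (hg : toMat g - 1 ∈ gradedPart (isHermitian_coe β) (s ≤ ·)) :
    degComp (isHermitian_coe β) s (toMat g - 1) ∈ lieSub hG := by
  have ht : Tendsto (fun t : ℝ => Real.exp (-s * t)) atTop (𝓝[>] 0) := by
    refine tendsto_nhdsWithin_iff.mpr ⟨?_, Eventually.of_forall fun t => Real.exp_pos _⟩
    refine Real.tendsto_exp_atBot.comp ?_
    exact tendsto_id.const_mul_atTop_of_neg (neg_lt_zero.mpr hs)
  refine tangent_mem_lieAlg hG.closed (l := atTop) (u := fun t => toMat (betaConj β g t))
    (Eventually.of_forall fun t => ⟨_, (betaConj β g t).2, rfl⟩) ht ?_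
  rw [tendsto_iff_eigCoord (isHermitian_coe β)]
  intro i j
  have hb : exp ((0 : ℝ) • (β : Mat)) = 1 := by rw [zero_smul]; exact exp_zero
  have hone : ∀ t : ℝ, toMat (betaConj β g t) - 1 =
      exp (t • (β : Mat)) * (toMat g - 1) * exp ((-t) • (β : Mat)) := by
    intro t
    have h1 : exp (t • (β : Mat)) * exp ((-t) • (β : Mat)) = 1 := by
      rw [neg_smul, ← Matrix.exp_add_of_commute _ _ (by simp)]; simp
    rw [toMat_betaConj, mul_sub, sub_mul, mul_one, h1]
  simp only [hone, eigCoord_smul, Matrix.smul_apply, eigCoord_conj_exp, eigCoord_degComp, smul_eq_mul]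
  set d := eigDeg (isHermitian_coe β) i j
  set a := eigCoord (isHermitian_coe β) (toMat g - 1) i j with ha
  have hexp : ∀ t : ℝ, ((Real.exp (-s * t) : ℝ) : ℂ)⁻¹ * ((Real.exp (-t * d) : ℝ) * a)
      = (Real.exp (-((d - s) * t)) : ℝ) * a := by
    intro t
    rw [← mul_assoc, ← Complex.ofReal_inv, ← Complex.ofReal_mul, ← Real.exp_neg, ← Real.exp_add]
    congr 3; ring
  simp only [hexp]
  split_ifs with hds
  · simp [hds]
  · by_cases hle : s ≤ d
    · have hlt : 0 < d - s := sub_pos.mpr (lt_of_le_of_ne hle (Ne.symm hds))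
      have h2 : Tendsto (fun t : ℝ => Real.exp (-((d - s) * t))) atTop (𝓝 0) :=
        Real.tendsto_exp_neg_atTop_nhds_zero.comp (tendsto_id.const_mul_atTop hlt)
      have h3 := ((Complex.continuous_ofReal.tendsto 0).comp h2).mul_const a
      simpa using h3
    · have : a = 0 := hg i j hle
      simp [this]

theorem toMat_mul (g h : G) : toMat (g * h) = toMat g * toMat h := rfl

theorem toMat_one : toMat (1 : G) = 1 := rfl

theorem toMat_injective : Function.Injective (toMat : G → Mat) := fun _ _ h =>
  Subtype.ext (Units.ext h)

/-- The exponential of an element of the Lie algebra of `G` as an element of `G`. -/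
noncomputable def expG {X : Mat} (hX : X ∈ lieAlg G) : G := ⟨expGL X, expGL_mem hX⟩

theorem toMat_expG {X : Mat} (hX : X ∈ lieAlg G) : toMat (expG hX) = exp X := rfl

theorem expG_mul_expG_neg (hG : IsConnectedReductive G) {X : Mat} (hX : X ∈ lieSub hG) :
    expG (mem_lieSub.mp hX) * expG (mem_lieSub.mp ((lieSub hG).neg_mem hX)) = 1 := by
  apply toMat_injective
  rw [toMat_mul, toMat_expG, toMat_expG, ← Matrix.exp_add_of_commute _ _ (by simp)]
  simp [toMat_one]

/-- Splitting off the lowest homogeneous component of a unipotent element. -/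
theorem exists_eq_exp_mul (hG : IsConnectedReductive G) (β : hermPart G) {s : ℝ} (hs : 0 < s) {g : G}
    (hg : toMat g - 1 ∈ gradedPart (isHermitian_coe β) (s ≤ ·)) :
    ∃ (hX : degComp (isHermitian_coe β) s (toMat g - 1) ∈ lieSub hG) (h : G), g = expG (mem_lieSub.mp hX) * h ∧
      toMat h = exp (-degComp (isHermitian_coe β) s (toMat g - 1)) * toMat g ∧
      toMat h - 1 ∈ gradedPart (isHermitian_coe β) (s < ·) := by
  have hX := degComp_mem_lieSub hG β hs hg
  refine ⟨hX, expG (mem_lieSub.mp ((lieSub hG).neg_mem hX)) * g, ?_, rfl, ?_⟩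
  · rw [← mul_assoc, expG_mul_expG_neg hG hX, one_mul]
  · rw [toMat_mul, toMat_expG]
    exact exp_neg_mul_sub_one_mem hs hg

/-- Peeling off leading terms by increasing degree writes each element as a finite product of
exponentials of homogeneous elements of `𝔤` of positive degree. -/
theorem unipotentRadical_induction (hG : IsConnectedReductive G) (β : hermPart G) {p : G → Prop}
    (h1 : p 1) (hmul : ∀ (X : Mat) (hX : X ∈ lieSub hG) (s : ℝ), 0 < s →
      X ∈ gradedPart (isHermitian_coe β) (· = s) → ∀ r, p r → p (expG (mem_lieSub.mp hX) * r))
    {g : G} (hg : g ∈ unipotentRadical G β) : p g := by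
  have key : ∀ a : ℝ, 0 ≤ a → ∀ g : G, toMat g - 1 ∈ gradedPart (isHermitian_coe β) (a < ·) → p g := by
    refine weight_induction (isHermitian_coe β) (fun a ha _ g hg => ?_) (fun a s has hw ih ha g hg => ?_)
    · have := eq_zero_of_mem_gradedPart (fun w hw => not_lt.mpr (ha w hw)) hg
      have : g = 1 := toMat_injective (sub_eq_zero.mp this)
      rwa [this]
    · have hs := ha.trans_lt has
      obtain ⟨hX, h, he, -, hh⟩ := exists_eq_exp_mul hG β hs (gradedPart_ge_of_gt hw hg)
      rw [he]
      exact hmul _ hX s hs (degComp_mem s _) h (ih hs.le h hh)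
  exact key 0 le_rfl g (mem_unipotentRadical_iff.mp hg)

theorem mul_sub_one_mem_gradedPart {β : Mat} {hβ : β.IsHermitian} {a : ℝ} (ha : 0 ≤ a) {x y : Mat}
    (hx : x - 1 ∈ gradedPart hβ (a < ·)) (hy : y - 1 ∈ gradedPart hβ (a < ·)) :
    x * y - 1 ∈ gradedPart hβ (a < ·) := by
  have h1 := mul_mem_gradedPart (r := (a < ·)) (fun s t hs ht => by linarith) hx hy
  have := Submodule.add_mem _ (Submodule.add_mem _ h1 hx) hy
  convert this using 1
  noncomm_ring

theorem exp_sub_one_mem_gradedPart {β : Mat} {hβ : β.IsHermitian} {s : ℝ} (hs : 0 < s) {X : Mat}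
    (hX : X ∈ gradedPart hβ (s ≤ ·)) : exp X - 1 ∈ gradedPart hβ (s ≤ ·) := by
  have h1 := gradedPart_mono' (q := (s ≤ ·)) (fun t ht => by linarith)
    (exp_sub_one_sub_mem_gradedPart hs hX)
  have := Submodule.add_mem _ h1 hX
  simpa using this

theorem expG_mem_unipotentRadical {β : hermPart G} {s : ℝ} (hs : 0 < s) {X : Mat} (hX : X ∈ lieAlg G)
    (hXs : X ∈ gradedPart (isHermitian_coe β) (· = s)) : expG hX ∈ unipotentRadical G β := by
  rw [mem_unipotentRadical_iff, toMat_expG]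
  exact gradedPart_mono' (fun t ht => hs.trans_le ht)
    (exp_sub_one_mem_gradedPart hs (gradedPart_mono' (fun t ht => ht.ge) hXs))

theorem mul_mem_unipotentRadical {β : hermPart G} {g h : G} (hg : g ∈ unipotentRadical G β)
    (hh : h ∈ unipotentRadical G β) : g * h ∈ unipotentRadical G β := by
  rw [mem_unipotentRadical_iff] at *
  exact mul_sub_one_mem_gradedPart le_rfl hg hh

theorem one_mem_unipotentRadical {β : hermPart G} : (1 : G) ∈ unipotentRadical G β := by
  rw [mem_unipotentRadical_iff, toMat_one, sub_self]; exact Submodule.zero_mem _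

theorem inv_mem_unipotentRadical (hG : IsConnectedReductive G) {β : hermPart G} {g : G}
    (hg : g ∈ unipotentRadical G β) : g⁻¹ ∈ unipotentRadical G β := by
  refine unipotentRadical_induction hG β (p := fun g => g⁻¹ ∈ unipotentRadical G β) ?_ ?_ hg
  · simpa using one_mem_unipotentRadical
  · intro X hX s hs hXs r hr
    rw [mul_inv_rev, inv_eq_of_mul_eq_one_right (expG_mul_expG_neg hG hX)]
    exact mul_mem_unipotentRadical hr
      (expG_mem_unipotentRadical hs _ (Submodule.neg_mem _ hXs))

end UnipotentRadical

/-! ### Separation from the convex hull of a compact set. -/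

theorem sum_eq_sum_embedding {ι κ F : Type*} [Fintype ι] [Fintype κ] [AddCommMonoid F] (e : ι ↪ κ)
    (f : κ → F) (hf : ∀ j, (¬ ∃ i, e i = j) → f j = 0) : ∑ j, f j = ∑ i, f (e i) := by
  rw [← Finset.sum_map Finset.univ e f]
  refine (Finset.sum_subset (Finset.subset_univ _) fun j _ hj => hf j ?_).symm
  simpa using hj

section Convexity

variable {E : Type*} [NormedAddCommGroup E] [NormedSpace ℝ E] [FiniteDimensional ℝ E]

/-- By Carathéodory the hull is the continuous image of a simplex times `d + 1` copies of `S`. -/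
theorem isCompact_convexHull_of_isCompact {S : Set E} (hS : IsCompact S) :
    IsCompact (convexHull ℝ S) := by
  rcases S.eq_empty_or_nonempty with rfl | ⟨s₀, hs₀⟩
  · simp
  set d := Module.finrank ℝ E
  have hK : IsCompact (stdSimplex ℝ (Fin (d + 1)) ×ˢ Set.pi Set.univ (fun _ : Fin (d + 1) => S)) :=
    (isCompact_stdSimplex ℝ _).prod (isCompact_univ_pi fun _ => hS)
  have hg : Continuous fun p : (Fin (d + 1) → ℝ) × (Fin (d + 1) → E) => ∑ i, p.1 i • p.2 i := by
    fun_prop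
  convert hK.image hg
  ext x
  constructor
  · intro hx
    obtain ⟨ι, _, z, w, hz, haff, hw0, hw1, hx⟩ := eq_pos_convex_span_of_mem_convexHull hx
    have hcard : Fintype.card ι ≤ d + 1 :=
      haff.card_le_finrank_succ.trans (Nat.succ_le_succ (Submodule.finrank_le _))
    obtain ⟨e⟩ : Nonempty (ι ↪ Fin (d + 1)) :=
      Function.Embedding.nonempty_of_card_le (by simpa using hcard)
    -- At most `d + 1` points are needed; the unused slots get weight `0` and the arbitrary point
    -- `s₀`.
    refine ⟨(Function.extend e w 0, Function.extend e z fun _ => s₀), ⟨⟨fun j => ?_, ?_⟩, ?_⟩, ?_⟩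
    · by_cases hj : ∃ i, e i = j
      · obtain ⟨i, rfl⟩ := hj
        simp only [e.injective.extend_apply]; exact (hw0 i).le
      · simp [Function.extend_apply' _ _ _ hj]
    · rw [sum_eq_sum_embedding e]
      · simpa [e.injective.extend_apply] using hw1
      · intro j hj; simp [Function.extend_apply' _ _ _ hj]
    · intro j _
      by_cases hj : ∃ i, e i = j
      · obtain ⟨i, rfl⟩ := hj
        simp only [e.injective.extend_apply]; exact hz ⟨i, rfl⟩
      · simp only [Function.extend_apply' _ _ _ hj]; exact hs₀
    · simp only
      rw [sum_eq_sum_embedding e]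
      · simpa [e.injective.extend_apply] using hx
      · intro j hj; simp [Function.extend_apply' _ _ _ hj]
  · rintro ⟨⟨w, z⟩, ⟨⟨hw0, hw1⟩, hz⟩, rfl⟩
    exact (convex_convexHull ℝ S).sum_mem (fun i _ => hw0 i) hw1
      fun i _ => subset_convexHull ℝ S (hz i trivial)

theorem exists_separating_of_notMem_convexHull {S : Set E} (hS : IsCompact S) {x : E}
    (hx : x ∉ convexHull ℝ S) : ∃ f : E →ₗ[ℝ] ℝ, ∀ y ∈ S, f y < f x := by
  obtain ⟨f, u, h1, h2⟩ := geometric_hahn_banach_closed_point (convex_convexHull ℝ S)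
    (isCompact_convexHull_of_isCompact hS).isClosed hx
  exact ⟨f, fun y hy => (h1 y (subset_convexHull ℝ S hy)).trans h2⟩

end Convexity

theorem matrix_exists_separating {n : ℕ} {S : Set (Matrix (Fin n) (Fin n) ℂ)} (hS : IsCompact S)
    {x : Matrix (Fin n) (Fin n) ℂ} (hx : x ∉ convexHull ℝ S) :
    ∃ f : Matrix (Fin n) (Fin n) ℂ →ₗ[ℝ] ℝ, ∀ y ∈ S, f y < f x := by
  let _ : NormedAddCommGroup (Matrix (Fin n) (Fin n) ℂ) := Matrix.normedAddCommGroup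
  let _ : NormedSpace ℝ (Matrix (Fin n) (Fin n) ℂ) := Matrix.normedSpace
  have : FiniteDimensional ℝ (Matrix (Fin n) (Fin n) ℂ) := inferInstance
  exact exists_separating_of_notMem_convexHull (E := Matrix (Fin n) (Fin n) ℂ) hS hx

theorem hasDerivAt_matrix_conj {n : ℕ} (f : Matrix (Fin n) (Fin n) ℂ →ₗ[ℝ] ℝ)
    (X Y : Matrix (Fin n) (Fin n) ℂ) :
    HasDerivAt (fun t : ℝ => f (exp (t • X) * Y * exp (t • (-X)))) (f (X * Y - Y * X)) 0 := by
  let _ : NormedRing (Matrix (Fin n) (Fin n) ℂ) := Matrix.linftyOpNormedRing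
  let _ : NormedAlgebra ℂ (Matrix (Fin n) (Fin n) ℂ) := Matrix.linftyOpNormedAlgebra
  let _ : NormedAlgebra ℚ (Matrix (Fin n) (Fin n) ℂ) := NormedAlgebra.restrictScalars ℚ ℂ _
  have h1 := hasDerivAt_exp_conj X Y
  have h2 := f.toContinuousLinearMap.hasFDerivAt.comp_hasDerivAt (0 : ℝ) h1
  simp only [← ofReal_smul_matrix]
  exact h2

/-! ### Maxima of quadratic forms. -/

section Quadratic

variable {V : Type*} [NormedAddCommGroup V] [InnerProductSpace ℂ V]

theorem re_inner_comm (x y : V) : (inner ℂ x y).re = (inner ℂ y x).re := inner_re_symm (𝕜 := ℂ) x y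

/-- A vector maximizing the Rayleigh quotient of a symmetric operator is an eigenvector. -/
theorem eigenvector_of_rayleigh_max {T : V →L[ℂ] V}
    (hT : ∀ v w, inner ℂ (T v) w = inner ℂ v (T w)) {W : Submodule ℂ V} (hW : ∀ v ∈ W, T v ∈ W)
    {a : ℝ} (hmax : ∀ v ∈ W, (inner ℂ (T v) v).re ≤ a * ‖v‖ ^ 2) {w : V} (hw : w ∈ W)
    (hwa : (inner ℂ (T w) w).re = a * ‖w‖ ^ 2) : T w = (a : ℂ) • w := by
  set u := T w - (a : ℂ) • w with hu
  have huW : u ∈ W := W.sub_mem (hW w hw) (W.smul_mem _ hw)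
  -- Maximality is tested on `w + t u`; the coefficient of `t` in the resulting inequality is
  -- `2‖u‖²`.
  have key : ∀ t : ℝ, 2 * t * ‖u‖ ^ 2 + t ^ 2 * ((inner ℂ (T u) u).re - a * ‖u‖ ^ 2) ≤ 0 := by
    intro t
    have h1 := hmax (w + (t : ℂ) • u) (W.add_mem hw (W.smul_mem _ huW))
    have h2 : ∀ v : V, (‖v‖ : ℝ) ^ 2 = (inner ℂ v v).re := fun v => by
      rw [inner_self_eq_norm_sq_to_K]; norm_cast
    have h3 : (inner ℂ (T u) w).re = (inner ℂ (T w) u).re := by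
      rw [hT u w, re_inner_comm]
    have h4 : (inner ℂ u w).re = (inner ℂ w u).re := by
      rw [re_inner_comm]
    have h5 : (inner ℂ (T w) u).re - a * (inner ℂ w u).re = ‖u‖ ^ 2 := by
      have : inner ℂ u u = inner ℂ (T w) u - (a : ℂ) * inner ℂ w u := by
        conv_lhs => rw [hu, inner_sub_left, inner_smul_left, ← hu]
        simp
      rw [h2, this]; simp
    rw [h2] at h1 hwa
    simp only [map_add, map_smul, inner_add_left, inner_add_right, inner_smul_left, inner_smul_right,
      Complex.add_re, Complex.re_ofReal_mul, Complex.conj_ofReal] at h1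
    rw [h2] at h5 ⊢
    rw [h3, h4] at h1
    linear_combination h1 - hwa - 2 * t * h5
  have h0 : ‖u‖ ^ 2 = 0 := by
    set p := ‖u‖ ^ 2 with hp
    set q := (inner ℂ (T u) u).re - a * ‖u‖ ^ 2 with hq
    have hp0 : 0 ≤ p := by positivity
    by_contra hne
    have hpos : 0 < p := lt_of_le_of_ne hp0 (Ne.symm hne)
    -- For this `t > 0` one has `t|q| ≤ p`, so `2p + tq ≥ p > 0`, against `key`.
    have := key (p / (|q| + p))
    have hden : 0 < |q| + p := by positivity
    have h6 : p / (|q| + p) * (2 * p + p / (|q| + p) * q) ≤ 0 := by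
      calc _ = 2 * (p / (|q| + p)) * p + (p / (|q| + p)) ^ 2 * q := by ring
        _ ≤ 0 := this
    have h7 : 0 < p / (|q| + p) := by positivity
    have h8 : 2 * p + p / (|q| + p) * q ≤ 0 := by
      by_contra hc
      push Not at hc
      nlinarith [mul_pos h7 hc]
    have h9 : p / (|q| + p) * (-q) ≤ p := by
      have : p / (|q| + p) * (-q) ≤ p / (|q| + p) * (|q| + p) :=
        mul_le_mul_of_nonneg_left (by linarith [neg_abs_le q]) h7.le
      rwa [div_mul_cancel₀ _ hden.ne'] at this
    linarith
  have : u = 0 := by simpa using h0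
  exact sub_eq_zero.mp this

theorem hasDerivAt_exp_apply [CompleteSpace V] (A : V →L[ℂ] V) (u : V) (t : ℝ) :
    HasDerivAt (fun t : ℝ => exp ((t : ℂ) • A) u) (A (exp ((t : ℂ) • A) u)) t := by
  let _ : NormedAlgebra ℚ (V →L[ℂ] V) := NormedAlgebra.restrictScalars ℚ ℂ (V →L[ℂ] V)
  have h := (((ContinuousLinearMap.apply ℂ V u).restrictScalars ℝ).hasFDerivAt).comp_hasDerivAt
        t (hasDerivAt_exp_ofReal_smul A t)
  refine HasDerivAt.congr_deriv h ?_
  have : Commute A (exp ((t : ℂ) • A)) := Commute.exp_right ((Commute.refl A).smul_right _)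
  rw [← this.eq]
  simp

/-- First and second order conditions for a maximum of a quadratic form along a one-parameter
group. -/
theorem conditions_of_max [CompleteSpace V] {T A : V →L[ℂ] V}
    (hT : ∀ v w, inner ℂ (T v) w = inner ℂ v (T w)) {u : V}
    (hmax : ∀ t : ℝ, (inner ℂ (T (exp ((t : ℂ) • A) u)) (exp ((t : ℂ) • A) u)).re ≤
      (inner ℂ (T u) u).re) :
    (inner ℂ (T u) (A u)).re = 0 ∧
      (inner ℂ (T (A u)) (A u)).re + (inner ℂ (T u) (A (A u))).re ≤ 0 := by
  set c : ℝ → V := fun t => exp ((t : ℂ) • A) u with hc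
  have hc0 : c 0 = u := by simp [hc]
  have hcd : ∀ t, HasDerivAt c (A (c t)) t := hasDerivAt_exp_apply A u
  have hLd : ∀ (L : V →L[ℂ] V) (t : ℝ), HasDerivAt (fun t => L (c t)) (L (A (c t))) t := fun L t =>
    (L.restrictScalars ℝ).hasFDerivAt.comp_hasDerivAt t (hcd t)
  set φ : ℝ → ℝ := fun t => (inner ℂ (T (c t)) (c t)).re with hφ
  have hφd : ∀ t, HasDerivAt φ (2 * (inner ℂ (T (c t)) (A (c t))).re) t := by
    intro t
    have h1 := ((hLd T t).inner ℂ (hcd t))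
    have h2 := Complex.reCLM.hasFDerivAt.comp_hasDerivAt t h1
    refine HasDerivAt.congr_deriv h2 ?_
    simp only [Complex.reCLM_apply, Complex.add_re]
    have h3 : (inner ℂ (T (A (c t))) (c t)).re = (inner ℂ (T (c t)) (A (c t))).re := by
      rw [hT, re_inner_comm]
    rw [h3]; ring
  have hφdd : HasDerivAt (deriv φ)
      (2 * ((inner ℂ (T (A u)) (A u)).re + (inner ℂ (T u) (A (A u))).re)) 0 := by
    have : deriv φ = fun t => 2 * (inner ℂ (T (c t)) (A (c t))).re := funext fun t => (hφd t).deriv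
    rw [this]
    have h1 := (hLd T 0).inner ℂ (hLd A 0)
    have h2 := (Complex.reCLM.hasFDerivAt.comp_hasDerivAt (0 : ℝ) h1).const_mul 2
    refine HasDerivAt.congr_deriv h2 ?_
    simp only [Complex.reCLM_apply, Complex.add_re, hc0]
    ring
  have hmax' : IsLocalMax φ 0 := Eventually.of_forall fun t => by
    have := hmax t
    simp only [hφ, hc0]; exact this
  have hfirst : deriv φ 0 = 0 := hmax'.deriv_eq_zero
  refine ⟨by rw [(hφd 0).deriv, hc0] at hfirst; linarith, ?_⟩
  by_contra hpos
  push Not at hpos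
  -- With a positive second derivative, `0` would also be a local minimum; `φ` would then be locally
  -- constant and its second derivative zero.
  have hmin : IsLocalMin φ 0 := by
    refine isLocalMin_of_deriv_deriv_pos ?_ hfirst (hφd 0).continuousAt
    rw [hφdd.deriv]; linarith
  have hconst : φ =ᶠ[𝓝 0] fun _ => φ 0 := by
    filter_upwards [hmax', hmin] with t h1 h2 using le_antisymm h1 h2
  have h3 := hconst.deriv.deriv_eq
  rw [hφdd.deriv] at h3
  simp at h3
  linarith

end Quadratic

/-! ### The momentum map in terms of expectation values. -/

section Momentum

variable {n : ℕ} {G : Subgroup (GL (Fin n) ℂ)}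
  {V : Type*} [NormedAddCommGroup V] [InnerProductSpace ℂ V] [FiniteDimensional ℂ V]

local notation "Mat" => Matrix (Fin n) (Fin n) ℂ

/-- A unitary holomorphic representation `ρ` with differential `D`, an invariant inner product `B`
and a momentum map `μ`. -/
structure IsMomentumSetting (hG : IsConnectedReductive G) (ρ : Representation ℂ G V)
    (D : Matrix (Fin n) (Fin n) ℂ →ₗ[ℂ] (V →L[ℂ] V))
    (B : LinearMap.BilinForm ℝ (Matrix (Fin n) (Fin n) ℂ)) (μ : ℙ ℂ V → hermPart G) : Prop where
  rep : IsStarLieRep (lieSub hG) D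
  dRep_eq : ∀ X : lieAlg G, dRep ρ X = D X
  exp_eq : ∀ g : G, ∀ X ∈ lieSub hG, toMat g = exp X → opHom ρ g = exp (D X)
  conj_eq : ∀ g : G, ∀ X ∈ lieSub hG, opHom ρ g * D X * opHom ρ g⁻¹ = D (toMat g * X * toMat g⁻¹)
  unitary : IsUnitaryRep ρ
  invInner : IsInvariantInner G B
  moment : IsMomentumMap ρ B μ

open Classical in
/-- The momentum map as a function on the vector space. -/
noncomputable def momentVec (μ : ℙ ℂ V → hermPart G) (v : V) : Matrix (Fin n) (Fin n) ℂ :=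
  if h : v ≠ 0 then μ (Projectivization.mk ℂ v h) else 0

theorem momentVec_of_ne {μ : ℙ ℂ V → hermPart G} {v : V} (h : v ≠ 0) :
    momentVec μ v = μ (Projectivization.mk ℂ v h) := dif_pos h

theorem momentVec_mem {μ : ℙ ℂ V → hermPart G} {v : V} (h : v ≠ 0) : momentVec μ v ∈ hermPart G := by
  rw [momentVec_of_ne h]; exact (μ _).2

theorem momentVec_smul {μ : ℙ ℂ V → hermPart G} {c : ℂ} (hc : c ≠ 0) {v : V} (hv : v ≠ 0) :
    momentVec μ (c • v) = momentVec μ v := by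
  rw [momentVec_of_ne hv, momentVec_of_ne (smul_ne_zero hc hv)]
  congr 2
  exact (Projectivization.mk_eq_mk_iff' ℂ _ _ _ _).mpr ⟨c, rfl⟩

theorem ne_zero_of_norm_eq_one {v : V} (h : ‖v‖ = 1) : v ≠ 0 := by
  rintro rfl; simp at h

/-- The Hermitian part as a real subspace. -/
def hermSub (hG : IsConnectedReductive G) : Submodule ℝ (Matrix (Fin n) (Fin n) ℂ) where
  carrier := hermPart G
  add_mem' := fun ha hb => ⟨(lieSub hG).add_mem ha.1 hb.1, ha.2.add hb.2⟩
  zero_mem' := ⟨(lieSub hG).zero_mem, Matrix.isHermitian_zero⟩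
  smul_mem' := fun c X hX => by
    refine ⟨?_, ?_⟩
    · rw [← ofReal_smul_matrix]; exact (lieSub hG).smul_mem _ hX.1
    · change (c • X).conjTranspose = _
      rw [Matrix.conjTranspose_smul, hX.2.eq]; simp

namespace IsMomentumSetting

variable {hG : IsConnectedReductive G} {ρ : Representation ℂ G V}
    {D : Matrix (Fin n) (Fin n) ℂ →ₗ[ℂ] (V →L[ℂ] V)}
    {B : LinearMap.BilinForm ℝ (Matrix (Fin n) (Fin n) ℂ)} {μ : ℙ ℂ V → hermPart G}

theorem symm_of_hermitian (S : IsMomentumSetting hG ρ D B μ)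
    {ξ : Mat} (hξ : ξ ∈ hermSub hG) (v w : V) :
    inner ℂ (D ξ v) w = inner ℂ v (D ξ w) := by
  rw [S.rep.adjoint ξ hξ.1, hξ.2.eq]

theorem hasDerivAt_moment (S : IsMomentumSetting hG ρ D B μ)
    {ξ : Mat} (hξ : ξ ∈ hermSub hG) {c : ℝ → V} (hc : ∀ t, c t ≠ 0) {w : V}
    {s : ℝ} (hw : HasDerivAt c w s) :
    HasDerivAt (fun t => B (momentVec μ (c t)) ξ) (fubiniStudy (c s) (D ξ (c s)) w) s := by
  have h1 : HasDerivAt (fun t => c (t + s)) w 0 := by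
    apply HasDerivAt.comp_add_const; simpa using hw
  have h2 := S.moment.gradient ⟨ξ, hξ⟩ (fun t => c (t + s)) (fun t => hc _) w h1
  have h3 : HasDerivAt (fun t => B (momentVec μ (c (t + s))) ξ)
      (fubiniStudy (c s) (D ξ (c s)) w) 0 := by
    simp only [momentVec_of_ne (hc _)]
    rw [S.dRep_eq, zero_add] at h2
    exact h2
  have h4 := HasDerivAt.comp_sub_const s s (by simpa using h3)
  simpa using h4

/-- The vector field of `ξ` is also the Fubini–Study gradient of `⟨ξv, v⟩ / (2‖v‖²)`, so the
difference to `⟨μ, ξ⟩` is constant along curves. Independent vectors are joined by a segment, which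
avoids `0`; dependent ones give the same point of `ℙ(V)`. -/
theorem moment_sub_aux (S : IsMomentumSetting hG ρ D B μ)
    {ξ : Mat} (hξ : ξ ∈ hermSub hG) {v w : V} (hv : v ≠ 0) (hw : w ≠ 0) :
    B (momentVec μ v) ξ - (inner ℂ (D ξ v) v).re / (2 * ‖v‖ ^ 2) =
      B (momentVec μ w) ξ - (inner ℂ (D ξ w) w).re / (2 * ‖w‖ ^ 2) := by
  by_cases hdep : ∃ c : ℂ, w = c • v
  · obtain ⟨c, rfl⟩ := hdep
    have hc : c ≠ 0 := by rintro rfl; simp at hw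
    rw [momentVec_smul hc hv]
    have h1 : inner ℂ (D ξ (c • v)) (c • v) = ((‖c‖ ^ 2 : ℝ) : ℂ) * inner ℂ (D ξ v) v := by
      rw [map_smul, inner_smul_left, inner_smul_right, ← mul_assoc, Complex.conj_mul']
      push_cast; rfl
    rw [h1, Complex.re_ofReal_mul, norm_smul]
    have h2 : ‖c‖ ≠ 0 := norm_ne_zero_iff.mpr hc
    have h3 : ‖v‖ ≠ 0 := norm_ne_zero_iff.mpr hv
    field_simp
  · set c : ℝ → V := fun t => v + (t : ℂ) • (w - v) with hc
    have hcne : ∀ t, c t ≠ 0 := by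
      intro t h0
      apply hdep
      have h1 : (t : ℂ) • w = ((t : ℂ) - 1) • v := by
        have : c t = (t : ℂ) • w - ((t : ℂ) - 1) • v := by simp only [hc]; module
        rw [this] at h0; exact sub_eq_zero.mp h0
      have ht : (t : ℂ) ≠ 0 := by
        intro ht
        rw [ht] at h1
        simp at h1
        exact hv h1
      refine ⟨(t : ℂ)⁻¹ * ((t : ℂ) - 1), ?_⟩
      rw [mul_smul, ← h1, smul_smul, inv_mul_cancel₀ ht, one_smul]
    have hcd : ∀ s, HasDerivAt c (w - v) s := by
      intro s
      have h1 : HasDerivAt (fun t : ℝ => (t : ℂ)) 1 s := Complex.ofRealCLM.hasDerivAt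
      exact ((h1.smul_const (w - v)).const_add v).congr_deriv (one_smul ℂ _)
    set F : ℝ → ℝ := fun t => B (momentVec μ (c t)) ξ -
      (inner ℂ (D ξ (c t)) (c t)).re / (2 * ‖c t‖ ^ 2) with hF
    have hFd : ∀ s, HasDerivAt F 0 s := by
      intro s
      have h1 := S.hasDerivAt_moment hξ hcne (hcd s)
      have h2 : HasDerivAt (fun t => D ξ (c t)) (D ξ (w - v)) s :=
        ((D ξ).restrictScalars ℝ).hasFDerivAt.comp_hasDerivAt s (hcd s)
      have h3 := Complex.reCLM.hasFDerivAt.comp_hasDerivAt s (h2.inner ℂ (hcd s))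
      have h4 : HasDerivAt (fun t => 2 * (inner ℂ (c t) (c t)).re)
          (2 * (2 * (inner ℂ (c s) (w - v)).re)) s := by
        have := (Complex.reCLM.hasFDerivAt.comp_hasDerivAt s ((hcd s).inner ℂ (hcd s))).const_mul 2
        refine HasDerivAt.congr_deriv this ?_
        simp only [Complex.reCLM_apply, Complex.add_re]
        rw [re_inner_comm (w - v) (c s)]; ring
      have hnorm : ∀ t, ‖c t‖ ^ 2 = (inner ℂ (c t) (c t)).re := fun t => by
        rw [inner_self_eq_norm_sq_to_K]; norm_cast
      have hne : (inner ℂ (c s) (c s)).re ≠ 0 := by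
        rw [← hnorm]; exact pow_ne_zero 2 (norm_ne_zero_iff.mpr (hcne s))
      have h5 := h1.sub (h3.div h4 (by positivity))
      have hF' : F = fun t => B (momentVec μ (c t)) ξ -
          (inner ℂ (D ξ (c t)) (c t)).re / (2 * (inner ℂ (c t) (c t)).re) := by
        funext t; simp only [hF, hnorm]
      rw [hF']
      refine HasDerivAt.congr_deriv h5 ?_
      have him : (inner ℂ (D ξ (c s)) (c s)).im = 0 := by
        have h6 : (starRingEnd ℂ) (inner ℂ (D ξ (c s)) (c s)) = inner ℂ (D ξ (c s)) (c s) := by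
          rw [inner_conj_symm, S.symm_of_hermitian hξ]
        exact Complex.conj_eq_iff_im.mp h6
      have h7 : (inner ℂ (D ξ (w - v)) (c s)).re = (inner ℂ (D ξ (c s)) (w - v)).re := by
        rw [S.symm_of_hermitian hξ, re_inner_comm]
      simp only [Function.comp, Complex.reCLM_apply, Complex.add_re, h7]
      rw [fubiniStudy]
      have h8 : (‖c s‖ : ℂ) ^ 2 = (((inner ℂ (c s) (c s)).re : ℝ) : ℂ) := by rw [← hnorm]; push_cast; rfl
      have h9 : (‖c s‖ : ℂ) ^ 4 = ((((inner ℂ (c s) (c s)).re) ^ 2 : ℝ) : ℂ) := by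
        rw [← hnorm]; push_cast; ring
      rw [h8, h9, Complex.sub_re, Complex.div_ofReal_re, Complex.div_ofReal_re, Complex.mul_re, him]
      field_simp
      ring
    have h0 := is_const_of_deriv_eq_zero (fun s => (hFd s).differentiableAt) (fun s => (hFd s).deriv) 0 1
    simpa [hF, hc] using h0

theorem moment_sub (S : IsMomentumSetting hG ρ D B μ)
    {ξ : Mat} (hξ : ξ ∈ hermSub hG) {v w : V} (hv : ‖v‖ = 1) (hw : ‖w‖ = 1) :
    B (momentVec μ v) ξ - B (momentVec μ w) ξ =
      ((inner ℂ (D ξ v) v).re - (inner ℂ (D ξ w) w).re) / 2 := by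
  have := S.moment_sub_aux hξ (ne_zero_of_norm_eq_one hv) (ne_zero_of_norm_eq_one hw)
  rw [hv, hw] at this
  linarith

theorem restrict_nondegenerate (S : IsMomentumSetting hG ρ D B μ)
    : (B.restrict (hermSub hG)).Nondegenerate := by
  constructor
  · intro x hx
    by_contra hne
    have := S.invInner.pos x x.2 (by simpa using hne)
    have h2 := hx x
    change B x x = 0 at h2
    linarith
  · intro x hx
    by_contra hne
    have := S.invInner.pos x x.2 (by simpa using hne)
    have h2 := hx x
    change B x x = 0 at h2
    linarith

/-- By `moment_sub`, the coordinates of `μ` in a basis dual under `B` are quadratic functions plus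
constants. -/
theorem continuousOn_momentVec (S : IsMomentumSetting hG ρ D B μ)
    : ContinuousOn (momentVec μ) (Metric.sphere (0 : V) 1) := by
  rcases (Metric.sphere (0 : V) 1).eq_empty_or_nonempty with h | ⟨w₀, hw₀⟩
  · rw [h]; exact continuousOn_empty _
  have hw₀' : ‖w₀‖ = 1 := by simpa using hw₀
  classical
  let b := Module.finBasis ℝ (hermSub hG)
  let b' := (B.restrict (hermSub hG)).dualBasis S.restrict_nondegenerate b
  have heq : ∀ w ∈ Metric.sphere (0 : V) 1, momentVec μ w =
      ∑ i, (B (momentVec μ w₀) (b i) + ((inner ℂ (D (b i : Mat) w) w).re -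
        (inner ℂ (D (b i : Mat) w₀) w₀).re) / 2) • (b' i : Mat) := by
    intro w hw
    have hw' : ‖w‖ = 1 := by simpa using hw
    have h1 := b'.sum_repr ⟨momentVec μ w, momentVec_mem (ne_zero_of_norm_eq_one hw')⟩
    have h2 := congrArg Subtype.val h1
    simp only [Submodule.coe_sum, Submodule.coe_smul] at h2
    rw [← h2]
    refine Finset.sum_congr rfl fun i _ => ?_
    congr 1
    have h3 : b'.repr ⟨momentVec μ w, momentVec_mem (ne_zero_of_norm_eq_one hw')⟩ i =
      B (momentVec μ w) (b i) := LinearMap.BilinForm.dualBasis_repr_apply _ _ _ _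
    have h4 := S.moment_sub (b i).2 hw' hw₀'
    rw [h3]
    linarith
  refine ContinuousOn.congr (Continuous.continuousOn ?_) heq
  refine continuous_finsetSum _ fun i _ => ?_
  have : Continuous fun w => (inner ℂ (D (b i : Mat) w) w).re :=
    Complex.continuous_re.comp ((D (b i : Mat)).continuous.inner continuous_id)
  have h : Continuous fun w => B (momentVec μ w₀) (b i) + ((inner ℂ (D (b i : Mat) w) w).re -
      (inner ℂ (D (b i : Mat) w₀) w₀).re) / 2 := by fun_prop
  exact h.smul continuous_const

theorem apply_skew_mem_unit (S : IsMomentumSetting hG ρ D B μ)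
    {η : Mat} (hη : η ∈ lieSub hG) (hs : η.conjTranspose = -η) (t : ℝ) :
    ∃ k : G, k ∈ unitaryPart G ∧ toMat k = exp (t • η) ∧ toMat k⁻¹ = exp (t • (-η)) ∧
      ∀ v, ρ k v = exp ((t : ℂ) • D η) v := by
  have hη' : t • η ∈ lieSub hG := by
    rw [← ofReal_smul_matrix]; exact (lieSub hG).smul_mem _ hη
  refine ⟨expG (mem_lieSub.mp hη'), expGL_mem_unitaryPart (mem_lieSub.mp hη') ?_,
    toMat_expG (mem_lieSub.mp hη'), ?_, fun v => ?_⟩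
  · rw [Matrix.conjTranspose_smul, hs]; simp
  · rw [inv_eq_of_mul_eq_one_right (expG_mul_expG_neg hG hη'), toMat_expG, smul_neg]
  · rw [← opHom_apply, S.exp_eq _ _ hη' rfl, ← ofReal_smul_matrix, map_smul]

theorem norm_apply (S : IsMomentumSetting hG ρ D B μ)
    {k : G} (hk : k ∈ unitaryPart G) (v : V) : ‖ρ k v‖ = ‖v‖ := by
  have h := S.unitary k hk v v
  rw [inner_self_eq_norm_sq_to_K, inner_self_eq_norm_sq_to_K] at h
  have h2 : ‖ρ k v‖ ^ 2 = ‖v‖ ^ 2 := by exact_mod_cast h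
  exact (sq_eq_sq₀ (norm_nonneg _) (norm_nonneg _)).mp h2

theorem momentVec_apply (S : IsMomentumSetting hG ρ D B μ)
    {k : G} (hk : k ∈ unitaryPart G) {v : V} (hv : v ≠ 0) :
    momentVec μ (ρ k v) = toMat k * momentVec μ v * toMat k⁻¹ := by
  have hne : ρ k v ≠ 0 := by
    rw [← norm_ne_zero_iff, S.norm_apply hk]; exact norm_ne_zero_iff.mpr hv
  rw [momentVec_of_ne hv, momentVec_of_ne hne]
  have h := S.moment.equivariant k hk (Projectivization.mk ℂ v hv)
  rwa [projAct, Projectivization.map_mk] at h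

theorem inner_momentVec_apply (S : IsMomentumSetting hG ρ D B μ)
    {k : G} (hk : k ∈ unitaryPart G) {v : V} (hv : v ≠ 0) :
    B (momentVec μ (ρ k v)) (momentVec μ (ρ k v)) = B (momentVec μ v) (momentVec μ v) := by
  rw [S.momentVec_apply hk hv]
  exact S.invInner.invariant k hk _ (momentVec_mem hv) _ (momentVec_mem hv)

/-- Infinitesimal equivariance of the momentum map. -/
theorem inner_lie_momentVec (S : IsMomentumSetting hG ρ D B μ)
    {η ξ : Mat} (hη : η ∈ lieSub hG) (hs : η.conjTranspose = -η)
    (hξ : ξ ∈ hermSub hG) {v : V} (hv : ‖v‖ = 1) :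
    B (η * momentVec μ v - momentVec μ v * η) ξ = (inner ℂ (D ξ v) (D η v)).re := by
  -- The derivative of `⟨μ(exp(tη)v), ξ⟩` at `0` is computed twice: by equivariance `μ(v)` is
  -- conjugated by `exp(tη)`, and by `moment_sub` the function is half the expectation of `ξ` plus a
  -- constant.
  have h1 := hasDerivAt_matrix_conj (B.flip ξ) η (momentVec μ v)
  have h2 := (((D ξ).restrictScalars ℝ).hasFDerivAt.comp_hasDerivAt (0 : ℝ)
    (hasDerivAt_exp_apply (D η) v 0)).inner ℂ (hasDerivAt_exp_apply (D η) v 0)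
  have h3 := ((Complex.reCLM.hasFDerivAt.comp_hasDerivAt (0 : ℝ) h2).div_const 2).add_const
    (B (momentVec μ v) ξ - (inner ℂ (D ξ v) v).re / 2)
  have h4 := h1.unique (HasDerivAt.congr_of_eventuallyEq h3 (Eventually.of_forall fun t => ?_))
  · change B _ ξ = _ at h4
    rw [h4]
    simp only [Function.comp, Complex.reCLM_apply, Complex.ofReal_zero, zero_smul, exp_zero,
      one_apply_eq_self, ContinuousLinearMap.coe_restrictScalars', Complex.add_re]
    rw [S.symm_of_hermitian hξ (D η v) v, re_inner_comm (D η v)]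
    ring
  · obtain ⟨k, hk, hk1, hk2, hk3⟩ := S.apply_skew_mem_unit hη hs t
    have h5 := S.moment_sub hξ (v := ρ k v) (w := v) (by rw [S.norm_apply hk, hv]) hv
    rw [S.momentVec_apply hk (ne_zero_of_norm_eq_one hv), hk1, hk2, hk3] at h5
    simp only [Function.comp, Complex.reCLM_apply, ContinuousLinearMap.coe_restrictScalars']
    change B _ ξ = _
    linarith

end IsMomentumSetting

end Momentum

/-! ### Vectors at which the momentum map has maximal norm. -/

section Extremal

variable {n : ℕ} {G : Subgroup (GL (Fin n) ℂ)}
  {V : Type*} [NormedAddCommGroup V] [InnerProductSpace ℂ V] [FiniteDimensional ℂ V]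

local notation "Mat" => Matrix (Fin n) (Fin n) ℂ

theorem inner_apply_eq_zero_of_diagonal {U : Submodule ℂ V} {T : V →L[ℂ] V}
    (h : ∀ u ∈ U, inner ℂ u (T u) = 0) {u v : V} (hu : u ∈ U) (hv : v ∈ U) :
    inner ℂ u (T v) = 0 := by
  have h1 := h (u + v) (U.add_mem hu hv)
  have h2 := h (u + Complex.I • v) (U.add_mem hu (U.smul_mem _ hv))
  simp only [map_add, map_smul, inner_add_left, inner_add_right, inner_smul_left, inner_smul_right,
    h u hu, h v hv, Complex.conj_I] at h1 h2
  have h3 : Complex.I * inner ℂ u (T v) * 2 = 0 := by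
    linear_combination h2 + Complex.I * h1
  simpa using h3

theorem rayleigh_le_of_unit {T : V →L[ℂ] V} {W : Submodule ℂ V} {a : ℝ}
    (h : ∀ v ∈ W, ‖v‖ = 1 → (inner ℂ (T v) v).re ≤ a) {v : V} (hv : v ∈ W) :
    (inner ℂ (T v) v).re ≤ a * ‖v‖ ^ 2 := by
  rcases eq_or_ne v 0 with rfl | hv0
  · simp
  have hn : ‖v‖ ≠ 0 := norm_ne_zero_iff.mpr hv0
  have h1 := h (((‖v‖⁻¹ : ℝ) : ℂ) • v) (W.smul_mem _ hv) (by
    rw [norm_smul, Complex.norm_real, norm_inv, norm_norm, inv_mul_cancel₀ hn])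
  rw [map_smul, inner_smul_left, inner_smul_right, Complex.conj_ofReal, Complex.re_ofReal_mul,
    Complex.re_ofReal_mul] at h1
  have h2 : 0 < ‖v‖ ^ 2 := by positivity
  calc (inner ℂ (T v) v).re = (‖v‖⁻¹ * (‖v‖⁻¹ * (inner ℂ (T v) v).re)) * ‖v‖ ^ 2 := by
        field_simp
    _ ≤ a * ‖v‖ ^ 2 := by gcongr

namespace IsMomentumSetting

variable {hG : IsConnectedReductive G} {ρ : Representation ℂ G V}
    {D : Matrix (Fin n) (Fin n) ℂ →ₗ[ℂ] (V →L[ℂ] V)}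
    {B : LinearMap.BilinForm ℝ (Matrix (Fin n) (Fin n) ℂ)} {μ : ℙ ℂ V → hermPart G}

theorem apply_mem (S : IsMomentumSetting hG ρ D B μ) (W : Subrepresentation ρ) {X : Mat}
    (hX : X ∈ lieSub hG) {v : V} (hv : v ∈ W.toSubmodule) : D X v ∈ W.toSubmodule :=
  lie_stable_of_apply_mem hG S.exp_eq (fun g _ hv => W.apply_mem_toSubmodule g hv) hX hv

theorem apply_homogeneous (S : IsMomentumSetting hG ρ D B μ) {α : Mat} (hα : α ∈ hermSub hG)
    {X : Mat} (hX : X ∈ lieSub hG) {s : ℝ} (hs : X ∈ gradedPart hα.2 (· = s)) {v : V} {a : ℝ}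
    (hv : D α v = (a : ℂ) • v) : D α (D X v) = ((a - s : ℝ) : ℂ) • D X v := by
  rw [S.rep.map_lie_apply hα.1 hX, mem_gradedPart_eq_iff.mp hs, hv]
  simp only [map_smul, map_neg, FunLike.coe_smul, Pi.smul_apply]
  push_cast
  module

/-- Negative degree raises the eigenvalue of `α`, beyond the largest one in `W`. -/
theorem apply_eq_zero_of_top (S : IsMomentumSetting hG ρ D B μ) {W : Subrepresentation ρ}
    {α : Mat} (hα : α ∈ hermSub hG) {a : ℝ}
    (htop : ∀ v ∈ W.toSubmodule, (inner ℂ (D α v) v).re ≤ a * ‖v‖ ^ 2) {e : V}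
    (he : e ∈ W.toSubmodule) (hea : D α e = (a : ℂ) • e) {X : Mat} (hX : X ∈ lieSub hG) {s : ℝ}
    (hs0 : s < 0) (hs : X ∈ gradedPart hα.2 (· = s)) : D X e = 0 := by
  have h1 := htop _ (S.apply_mem W hX he)
  rw [S.apply_homogeneous hα hX hs hea, inner_smul_left, Complex.conj_ofReal,
    Complex.re_ofReal_mul, inner_self_eq_norm_sq_to_K] at h1
  have h2 : (((‖D X e‖ : ℝ) : ℂ) ^ 2).re = ‖D X e‖ ^ 2 := by norm_cast
  change _ * (((‖D X e‖ : ℝ) : ℂ) ^ 2).re ≤ _ at h1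
  rw [h2] at h1
  by_contra hne
  have h3 : 0 < ‖D X e‖ ^ 2 := by
    have := norm_pos_iff.mpr hne
    positivity
  nlinarith

/-- If `𝔤` acts on the top eigenspace of `β` in an irreducible representation by expectation values
which are constant, then this eigenspace is a line. -/
theorem eq_smul_of_top (S : IsMomentumSetting hG ρ D B μ) {W : Subrepresentation ρ}
    (hW : W.toRepresentation.IsIrreducible)
    {β : Mat} (hβ : β ∈ hermSub hG) {a : ℝ}
    (htop : ∀ v ∈ W.toSubmodule, (inner ℂ (D β v) v).re ≤ a * ‖v‖ ^ 2) {w : V}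
    (hw : w ∈ W.toSubmodule) (hwa : D β w = (a : ℂ) • w) (hw1 : ‖w‖ = 1)
    (hdeg0 : ∀ X ∈ lieSub hG, X ∈ gradedPart hβ.2 (· = 0) → ∃ c : ℂ, ∀ u ∈ W.toSubmodule,
      D β u = (a : ℂ) • u → D X u = c • u)
    {u : V} (hu : u ∈ W.toSubmodule) (hua : D β u = (a : ℂ) • u) :
    u = (inner ℂ w u : ℂ) • w := by
  -- `N` is the orthogonal complement of the top eigenvectors orthogonal to `w`. It is stable under
  -- degrees `≥ 0`, since the adjoint of such an element acts on the top eigenspace by a scalar or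
  -- by zero. These degrees generate `W` from `w`, as negative ones kill `w`; so `W ⊆ N`.
  let N : Submodule ℂ V :=
    { carrier := {v | ∀ u ∈ W.toSubmodule, D β u = (a : ℂ) • u → inner ℂ u w = 0 → inner ℂ u v = 0}
      zero_mem' := by simp
      add_mem' := fun {x y} hx hy u h1 h2 h3 => by
        rw [inner_add_right, hx u h1 h2 h3, hy u h1 h2 h3, add_zero]
      smul_mem' := fun c x hx u h1 h2 h3 => by
        rw [inner_smul_right, hx u h1 h2 h3, mul_zero] }
  have key : W.toSubmodule ≤ N := by
    refine le_of_stable_of_generating hG S.rep S.exp_eq hW hw (ne_zero_of_norm_eq_one hw1)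
      (𝔮 := {X | X ∈ lieSub hG ∧ ∃ s : ℝ, 0 ≤ s ∧ X ∈ gradedPart hβ.2 (· = s)})
      (fun X hX => hX.1) (fun M hwM hM Y hY => ?_) (fun u _ _ h => h) ?_
    · let P : Submodule ℂ Mat := M.comap ((ContinuousLinearMap.apply ℂ V w).toLinearMap ∘ₗ D)
      have : lieSub hG ≤ P := by
        refine le_of_homogeneous_mem (hβ := hβ.2) (fun X hX => S.rep.lie_mem β hβ.1 X hX)
          (fun s X hX hs => ?_)
        rcases le_or_gt 0 s with h0 | h0
        · exact hM X ⟨hX, s, h0, hs⟩ w hwM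
        · change D X w ∈ M
          rw [S.apply_eq_zero_of_top hβ htop hw hwa hX h0 hs]; exact M.zero_mem
      exact this hY
    · rintro X ⟨hX, s, hs0, hs⟩ v hv u hu hua huw
      rw [← S.rep.adjoint' hX]
      have hXs : X.conjTranspose ∈ gradedPart hβ.2 (· = -s) :=
        conjTranspose_mem_gradedPart (fun t ht => by rw [ht]) hs
      rcases hs0.eq_or_lt with rfl | h0
      · rw [neg_zero] at hXs
        obtain ⟨c, hc⟩ := hdeg0 _ (S.rep.star_mem X hX) hXs
        rw [hc u hu hua, inner_smul_left, hv u hu hua huw, mul_zero]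
      · rw [S.apply_eq_zero_of_top hβ htop hu hua (S.rep.star_mem X hX) (neg_lt_zero.mpr h0) hXs,
          inner_zero_left]
  set u' := u - (inner ℂ w u : ℂ) • w with hu'
  have h1 : u' ∈ W.toSubmodule := W.toSubmodule.sub_mem hu (W.toSubmodule.smul_mem _ hw)
  have h2 : D β u' = (a : ℂ) • u' := by
    rw [hu', map_sub, map_smul, hua, hwa]; module
  have hww : inner ℂ w w = (1 : ℂ) := by rw [inner_self_eq_norm_sq_to_K, hw1]; simp
  have h3 : inner ℂ u' w = (0 : ℂ) := by
    rw [hu', inner_sub_left, inner_smul_left, hww, inner_conj_symm, mul_one, sub_self]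
  have h4 := key h1 u' h1 h2 h3
  exact sub_eq_zero.mp (inner_self_eq_zero.mp h4)

/-- `w` is a unit vector of `W` at which the momentum map has maximal norm on `ℙ(W)`. -/
structure IsNormMax (_ : IsMomentumSetting hG ρ D B μ) (W : Subrepresentation ρ) (w : V) :
    Prop where
  mem : w ∈ W.toSubmodule
  norm : ‖w‖ = 1
  le : ∀ v ∈ W.toSubmodule, ‖v‖ = 1 → B (momentVec μ v) (momentVec μ v) ≤
    B (momentVec μ w) (momentVec μ w)

namespace IsNormMax

variable {S : IsMomentumSetting hG ρ D B μ} {W : Subrepresentation ρ} {w : V}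

theorem herm (h : IsNormMax S W w) : momentVec μ w ∈ hermSub hG :=
  momentVec_mem (ne_zero_of_norm_eq_one h.norm)

theorem inner_sub_self {ξ η : Mat} (S : IsMomentumSetting hG ρ D B μ) (hξ : ξ ∈ hermSub hG)
    (hη : η ∈ hermSub hG) : B (ξ - η) (ξ - η) = B ξ ξ - 2 * B ξ η + B η η := by
  simp only [map_sub, LinearMap.sub_apply]
  rw [S.invInner.symm η hη ξ hξ]; ring

theorem inner_self_nonneg {ξ : Mat} (S : IsMomentumSetting hG ρ D B μ) (hξ : ξ ∈ hermSub hG) :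
    0 ≤ B ξ ξ := by
  rcases eq_or_ne ξ 0 with rfl | h
  · simp
  · exact (S.invInner.pos ξ hξ h).le

/-- With `β = μ(w)` and `|μ(v)| ≤ |β|`, expanding `|μ(v) - β|² ≥ 0` gives `⟨μ(v), β⟩ ≤ |β|²`, which
`moment_sub` turns into a bound on the expectation of `β`. -/
theorem rayleigh_le (h : IsNormMax S W w) {v : V} (hv : v ∈ W.toSubmodule) :
    (inner ℂ (D (momentVec μ w) v) v).re ≤
      (inner ℂ (D (momentVec μ w) w) w).re * ‖v‖ ^ 2 := by
  refine rayleigh_le_of_unit (fun v hv hv1 => ?_) hv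
  have hvm : momentVec μ v ∈ hermSub hG := momentVec_mem (ne_zero_of_norm_eq_one hv1)
  have h1 := inner_self_nonneg S ((hermSub hG).sub_mem hvm h.herm)
  rw [inner_sub_self S hvm h.herm] at h1
  have h2 := h.le v hv hv1
  have h3 := S.moment_sub h.herm hv1 h.norm
  linarith

theorem apply_self (h : IsNormMax S W w) : D (momentVec μ w) w =
    ((inner ℂ (D (momentVec μ w) w) w).re : ℂ) • w :=
  eigenvector_of_rayleigh_max (S.symm_of_hermitian h.herm) (fun _ hv => S.apply_mem W h.herm.1 hv)
    (fun _ hv => h.rayleigh_le hv) h.mem (by rw [h.norm]; ring)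

/-- This is the case of equality in `rayleigh_le`: it forces `|μ(u) - μ(w)|² ≤ 0`. -/
theorem momentVec_eq (h : IsNormMax S W w) {u : V} (hu : u ∈ W.toSubmodule) (hu1 : ‖u‖ = 1)
    (hua : D (momentVec μ w) u = ((inner ℂ (D (momentVec μ w) w) w).re : ℂ) • u) :
    momentVec μ u = momentVec μ w := by
  have hum : momentVec μ u ∈ hermSub hG := momentVec_mem (ne_zero_of_norm_eq_one hu1)
  have h3 := S.moment_sub h.herm hu1 h.norm
  have h4 : (inner ℂ (D (momentVec μ w) u) u).re = (inner ℂ (D (momentVec μ w) w) w).re := by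
    rw [hua, inner_smul_left, Complex.conj_ofReal, Complex.re_ofReal_mul,
      inner_self_eq_norm_sq_to_K, hu1]
    simp
  rw [h4, sub_self, zero_div] at h3
  have h1 := inner_sub_self S hum h.herm
  have h2 := h.le u hu hu1
  by_contra hne
  have := S.invInner.pos _ ((hermSub hG).sub_mem hum h.herm) (sub_ne_zero.mpr hne)
  linarith

/-- Since `μ` is constant on unit top eigenvectors, so is the expectation of every Hermitian element
of `𝔤`, by `moment_sub`; and `X` is a complex combination of `X + X*` and `i(X - X*)`. -/
theorem inner_apply_top (h : IsNormMax S W w) {X : Mat} (hX : X ∈ lieSub hG) {u : V}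
    (hu : u ∈ W.toSubmodule)
    (hua : D (momentVec μ w) u = ((inner ℂ (D (momentVec μ w) w) w).re : ℂ) • u) :
    inner ℂ u (D X u) = inner ℂ w (D X w) * inner ℂ u u := by
  have hherm : ∀ ξ ∈ hermSub hG, ∀ v : V, ‖v‖ = 1 → v ∈ W.toSubmodule →
      D (momentVec μ w) v = ((inner ℂ (D (momentVec μ w) w) w).re : ℂ) • v →
      inner ℂ v (D ξ v) = inner ℂ w (D ξ w) := by
    intro ξ hξ v hv1 hv hva
    have h1 := S.moment_sub hξ hv1 h.norm
    rw [h.momentVec_eq hv hv1 hva, sub_self] at h1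
    have him : ∀ z : V, (inner ℂ z (D ξ z)).im = 0 := fun z => by
      have h6 : (starRingEnd ℂ) (inner ℂ z (D ξ z)) = inner ℂ z (D ξ z) := by
        rw [inner_conj_symm, S.symm_of_hermitian hξ]
      exact Complex.conj_eq_iff_im.mp h6
    apply Complex.ext
    · rw [re_inner_comm, re_inner_comm w]; linarith
    · rw [him, him]
  have hunit : ∀ v : V, ‖v‖ = 1 → v ∈ W.toSubmodule →
      D (momentVec μ w) v = ((inner ℂ (D (momentVec μ w) w) w).re : ℂ) • v →
      inner ℂ v (D X v) = inner ℂ w (D X w) := by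
    intro v hv1 hv hva
    have hXs := S.rep.star_mem X hX
    have h1 : X + X.conjTranspose ∈ hermSub hG :=
      ⟨(lieSub hG).add_mem hX hXs, by
        change (X + X.conjTranspose).conjTranspose = _
        rw [Matrix.conjTranspose_add, Matrix.conjTranspose_conjTranspose, add_comm]⟩
    have h2 : Complex.I • (X - X.conjTranspose) ∈ hermSub hG :=
      ⟨(lieSub hG).smul_mem _ ((lieSub hG).sub_mem hX hXs), by
        change (Complex.I • (X - X.conjTranspose)).conjTranspose = _
        rw [Matrix.conjTranspose_smul, Matrix.conjTranspose_sub, Matrix.conjTranspose_conjTranspose]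
        simp only [Complex.star_def, Complex.conj_I, neg_smul, ← smul_neg, neg_sub]⟩
    have h3 := hherm _ h1 v hv1 hv hva
    have h4 := hherm _ h2 v hv1 hv hva
    simp only [map_add, map_smul, map_sub, FunLike.coe_add, FunLike.coe_sub, FunLike.coe_smul,
      Pi.add_apply, Pi.sub_apply, Pi.smul_apply,
      inner_add_right, inner_sub_right, inner_smul_right] at h3 h4
    have h5 := mul_left_cancel₀ Complex.I_ne_zero h4
    linear_combination (h3 + h5) / 2
  rcases eq_or_ne u 0 with rfl | hu0
  · simp
  have hn : ‖u‖ ≠ 0 := norm_ne_zero_iff.mpr hu0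
  have h1 := hunit (((‖u‖⁻¹ : ℝ) : ℂ) • u) (by
    rw [norm_smul, Complex.norm_real, norm_inv, norm_norm, inv_mul_cancel₀ hn])
    (W.toSubmodule.smul_mem _ hu) (by rw [map_smul, hua, smul_comm])
  rw [map_smul, inner_smul_left, inner_smul_right, Complex.conj_ofReal] at h1
  have hn' : (‖u‖ : ℂ) ≠ 0 := by exact_mod_cast hn
  rw [inner_self_eq_norm_sq_to_K, ← h1]
  push_cast
  field_simp
  rfl

/-- `X` preserves the top eigenspace, where its expectation is constant; by polarization an operator
with vanishing expectations on a complex space it preserves is zero there. -/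
theorem degree_zero (h : IsNormMax S W w) {X : Mat} (hX : X ∈ lieSub hG)
    (hX0 : X ∈ gradedPart h.herm.2 (· = 0)) {u : V} (hu : u ∈ W.toSubmodule)
    (hua : D (momentVec μ w) u = ((inner ℂ (D (momentVec μ w) w) w).re : ℂ) • u) :
    D X u = (inner ℂ w (D X w) : ℂ) • u := by
  set c : ℂ := inner ℂ w (D X w) with hc
  set a := (inner ℂ (D (momentVec μ w) w) w).re
  let U : Submodule ℂ V := W.toSubmodule ⊓ Module.End.eigenspace (D (momentVec μ w)).toLinearMap (a : ℂ)
  have hU : ∀ v, v ∈ U ↔ v ∈ W.toSubmodule ∧ D (momentVec μ w) v = (a : ℂ) • v := fun v => by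
    rw [Submodule.mem_inf, Module.End.mem_eigenspace_iff]; rfl
  have h1 : D X u ∈ U := by
    rw [hU]
    refine ⟨S.apply_mem W hX hu, ?_⟩
    have := S.apply_homogeneous h.herm hX hX0 hua
    rwa [sub_zero] at this
  have huU : u ∈ U := (hU u).mpr ⟨hu, hua⟩
  have h2 : ∀ v ∈ U, inner ℂ v ((D X - c • (1 : V →L[ℂ] V)) v) = 0 := by
    intro v hv
    have := h.inner_apply_top hX ((hU v).mp hv).1 ((hU v).mp hv).2
    simp only [FunLike.coe_sub, FunLike.coe_smul, Pi.sub_apply, Pi.smul_apply, one_apply_eq_self,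
      inner_sub_right, inner_smul_right]
    rw [this, sub_self]
  have h3 := inner_apply_eq_zero_of_diagonal h2 (U.sub_mem h1 (U.smul_mem c huU)) huU
  exact sub_eq_zero.mp (inner_self_eq_zero.mp h3)

theorem eq_smul (h : IsNormMax S W w) (hW : W.toRepresentation.IsIrreducible) {u : V}
    (hu : u ∈ W.toSubmodule)
    (hua : D (momentVec μ w) u = ((inner ℂ (D (momentVec μ w) w) w).re : ℂ) • u) :
    u = (inner ℂ w u : ℂ) • w :=
  S.eq_smul_of_top hW h.herm (fun _ hv => h.rayleigh_le hv) h.mem h.apply_self h.norm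
    (fun _ hX hX0 => ⟨_, fun _ hu hua => h.degree_zero hX hX0 hu hua⟩) hu hua

theorem degree_neg (h : IsNormMax S W w) {X : Mat} (hX : X ∈ lieSub hG) {s : ℝ} (hs0 : s < 0)
    (hs : X ∈ gradedPart h.herm.2 (· = s)) : D X w = 0 :=
  S.apply_eq_zero_of_top h.herm (fun _ hv => h.rayleigh_le hv) h.mem h.apply_self hX hs0 hs

/-- An element of positive degree which kills an extremal vector vanishes. -/
theorem degree_pos (h : IsNormMax S W w) {X : Mat} (hX : X ∈ lieSub hG) {s : ℝ} (hs0 : 0 < s)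
    (hs : X ∈ gradedPart h.herm.2 (· = s)) (hXw : D X w = 0) : X = 0 := by
  have hXH := S.rep.star_mem X hX
  have hXHs : X.conjTranspose ∈ gradedPart h.herm.2 (· = -s) :=
    conjTranspose_mem_gradedPart (fun t ht => by rw [ht]) hs
  have hXHw := h.degree_neg hXH (neg_lt_zero.mpr hs0) hXHs
  set α := X + X.conjTranspose with hα
  set η := X - X.conjTranspose with hη
  have hαh : α ∈ hermSub hG := ⟨(lieSub hG).add_mem hX hXH, by
    change α.conjTranspose = _
    rw [hα, Matrix.conjTranspose_add, Matrix.conjTranspose_conjTranspose, add_comm]⟩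
  have hηs : η.conjTranspose = -η := by
    rw [hη, Matrix.conjTranspose_sub, Matrix.conjTranspose_conjTranspose, neg_sub]
  have hηm : η ∈ lieSub hG := (lieSub hG).sub_mem hX hXH
  -- As `[η, μ(w)] = sα`, infinitesimal equivariance reads `s|α|² = Re⟨αw, ηw⟩`, and `αw = 0`. Hence
  -- `α = 0`, so `X = -X*` has both degree `s` and degree `-s` and vanishes.
  have h1 := S.inner_lie_momentVec hηm hηs hαh h.norm
  rw [mem_gradedPart_eq_iff] at hs hXHs
  have h2 : η * momentVec μ w - momentVec μ w * η = s • α := by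
    rw [← ofReal_smul_matrix]
    calc η * momentVec μ w - momentVec μ w * η = -(momentVec μ w * X - X * momentVec μ w) +
        (momentVec μ w * X.conjTranspose - X.conjTranspose * momentVec μ w) := by
          rw [hη]; noncomm_ring
      _ = _ := by rw [hs, hXHs, hα]; push_cast; module
  have h3 : D α w = 0 := by rw [hα, map_add]; simp [hXw, hXHw]
  rw [h2, h3, inner_zero_left, map_smul, LinearMap.smul_apply, smul_eq_mul, Complex.zero_re] at h1
  have h4 : α = 0 := by
    by_contra hne
    have := S.invInner.pos α hαh hne
    have := mul_pos hs0 this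
    linarith
  have h5 : X.conjTranspose = -X := by rw [hα] at h4; exact (neg_eq_of_add_eq_zero_right h4).symm
  rw [h5] at hXHs
  have h6 : ((2 * s : ℝ) : ℂ) • X = 0 := by
    have : momentVec μ w * -X - -X * momentVec μ w = -(momentVec μ w * X - X * momentVec μ w) := by
      noncomm_ring
    rw [this, hs] at hXHs
    push_cast at hXHs ⊢
    have h7 : ((s : ℂ)) • X = -((s : ℂ)) • X := by
      simpa using hXHs
    calc ((2 : ℂ) * s) • X = (s : ℂ) • X + (s : ℂ) • X := by module
      _ = 0 := by nth_rewrite 1 [h7]; module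
  have h7 : ((2 * s : ℝ) : ℂ) ≠ 0 := by
    have : (2 * s : ℝ) ≠ 0 := by positivity
    exact_mod_cast this
  exact (smul_eq_zero.mp h6).resolve_left h7

end IsNormMax

end IsMomentumSetting

end Extremal

/-! ### Extreme points of the hull of `μ(ℙ(W))` are momentum values of maximal norm. -/

section Extremal

variable {n : ℕ} {G : Subgroup (GL (Fin n) ℂ)}
  {V : Type*} [NormedAddCommGroup V] [InnerProductSpace ℂ V] [FiniteDimensional ℂ V]

local notation "Mat" => Matrix (Fin n) (Fin n) ℂ

namespace IsMomentumSetting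

variable {hG : IsConnectedReductive G} {ρ : Representation ℂ G V}
    {D : Matrix (Fin n) (Fin n) ℂ →ₗ[ℂ] (V →L[ℂ] V)}
    {B : LinearMap.BilinForm ℝ (Matrix (Fin n) (Fin n) ℂ)} {μ : ℙ ℂ V → hermPart G}

/-- The elements of the Lie algebra which preserve the line spanned by `w`. -/
noncomputable def lineStabilizer (hG : IsConnectedReductive G)
    (D : Matrix (Fin n) (Fin n) ℂ →ₗ[ℂ] (V →L[ℂ] V)) (w : V) :
    Submodule ℂ (Matrix (Fin n) (Fin n) ℂ) :=
  lieSub hG ⊓ (Submodule.span ℂ {w}).comap ((ContinuousLinearMap.apply ℂ V w).toLinearMap ∘ₗ D)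

theorem mem_lineStabilizer {w : V} {X : Mat} :
    X ∈ lineStabilizer hG D w ↔ X ∈ lieSub hG ∧ ∃ c : ℂ, D X w = c • w := by
  rw [lineStabilizer, Submodule.mem_inf]
  refine and_congr Iff.rfl ?_
  change D X w ∈ Submodule.span ℂ {w} ↔ _
  rw [Submodule.mem_span_singleton]
  exact exists_congr fun c => eq_comm

theorem exists_rayleigh_max (T : V →L[ℂ] V) {W : Submodule ℂ V} {w : V} (hw : w ∈ W)
    (hw1 : ‖w‖ = 1) : ∃ v ∈ W, ‖v‖ = 1 ∧ ∀ u ∈ W, ‖u‖ = 1 →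
      (inner ℂ (T u) u).re ≤ (inner ℂ (T v) v).re := by
  have : ProperSpace V := FiniteDimensional.proper_rclike ℂ V
  have hc : IsCompact (Metric.sphere (0 : V) 1 ∩ W) :=
    (isCompact_sphere 0 1).inter_right W.closed_of_finiteDimensional
  obtain ⟨v, ⟨hv1, hvW⟩, hv⟩ := hc.exists_isMaxOn ⟨w, by simpa using hw1, hw⟩
    (f := fun v => (inner ℂ (T v) v).re)
    (Complex.continuous_re.comp (T.continuous.inner continuous_id)).continuousOn
  exact ⟨v, hvW, by simpa using hv1, fun u hu hu1 => hv ⟨by simpa using hu1, hu⟩⟩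

namespace IsNormMax

variable {S : IsMomentumSetting hG ρ D B μ} {W : Subrepresentation ρ} {w : V}

theorem apply_unitary (h : IsNormMax S W w) {k : G} (hk : k ∈ unitaryPart G) :
    IsNormMax S W (ρ k w) where
  mem := W.apply_mem_toSubmodule k h.mem
  norm := by rw [S.norm_apply hk, h.norm]
  le := fun v hv hv1 => by
    rw [S.inner_momentVec_apply hk (ne_zero_of_norm_eq_one h.norm)]
    exact h.le v hv hv1

/-- In the grading by `μ(w)`, degrees `≤ 0` preserve the line `ℂw`, and positive degrees are
adjoints of negative ones. The conclusion no longer refers to this grading, so it can be combined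
with the grading by another `α`. -/
theorem exists_decomp (h : IsNormMax S W w) {X : Mat} (hX : X ∈ lieSub hG) :
    ∃ Y ∈ lineStabilizer hG D w, ∃ Z ∈ lineStabilizer hG D w, X = Y + Z.conjTranspose := by
  let Q := lineStabilizer hG D w
  let P : Submodule ℂ Mat :=
    { carrier := {X | ∃ Y ∈ Q, ∃ Z ∈ Q, X = Y + Z.conjTranspose}
      zero_mem' := ⟨0, Q.zero_mem, 0, Q.zero_mem, by simp⟩
      add_mem' := by
        rintro _ _ ⟨Y, hY, Z, hZ, rfl⟩ ⟨Y', hY', Z', hZ', rfl⟩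
        exact ⟨Y + Y', Q.add_mem hY hY', Z + Z', Q.add_mem hZ hZ', by
          rw [Matrix.conjTranspose_add]; abel⟩
      smul_mem' := by
        rintro c _ ⟨Y, hY, Z, hZ, rfl⟩
        exact ⟨c • Y, Q.smul_mem c hY, star c • Z, Q.smul_mem _ hZ, by
          rw [Matrix.conjTranspose_smul, star_star, smul_add]⟩ }
  have : lieSub hG ≤ P := by
    refine le_of_homogeneous_mem (hβ := h.herm.2) (fun X hX => S.rep.lie_mem _ h.herm.1 X hX)
      (fun s X hX hs => ?_)
    have hXs : X.conjTranspose ∈ gradedPart h.herm.2 (· = -s) :=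
      conjTranspose_mem_gradedPart (fun t ht => by rw [ht]) hs
    rcases lt_trichotomy s 0 with h0 | rfl | h0
    · exact ⟨X, mem_lineStabilizer.mpr ⟨hX, 0, by rw [zero_smul, h.degree_neg hX h0 hs]⟩, 0,
        Q.zero_mem, by simp⟩
    · exact ⟨X, mem_lineStabilizer.mpr ⟨hX, _, h.degree_zero hX hs h.mem h.apply_self⟩, 0,
        Q.zero_mem, by simp⟩
    · refine ⟨0, Q.zero_mem, X.conjTranspose, mem_lineStabilizer.mpr ⟨S.rep.star_mem X hX, 0, ?_⟩,
        by simp⟩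
      rw [zero_smul, h.degree_neg (S.rep.star_mem X hX) (neg_lt_zero.mpr h0) hXs]
  exact this hX

section Critical

variable {α : Matrix (Fin n) (Fin n) ℂ}

/-- `K` preserves the set of norm-maximal vectors, so `⟨μ, α⟩` is maximal at `w` along `exp(tη)w`.
-/
theorem critical (h : IsNormMax S W w) (hα : α ∈ hermSub hG)
    (hmax : ∀ v, IsNormMax S W v → B (momentVec μ v) α ≤ B (momentVec μ w) α) {η : Mat}
    (hη : η ∈ lieSub hG) (hs : η.conjTranspose = -η) :
    (inner ℂ (D α w) (D η w)).re = 0 ∧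
      (inner ℂ (D α (D η w)) (D η w)).re + (inner ℂ (D α w) (D η (D η w))).re ≤ 0 := by
  refine conditions_of_max (S.symm_of_hermitian hα) fun t => ?_
  obtain ⟨k, hk, -, -, hk3⟩ := S.apply_skew_mem_unit hη hs t
  have hk' := h.apply_unitary hk
  have h1 := hmax _ hk'
  have h2 := S.moment_sub hα hk'.norm h.norm
  rw [hk3] at h1 h2
  linarith

/-- Write `α = Y + Z*` with `Y`, `Z` preserving `ℂw`, and move along `η = Z* - Z`. Then `ηw = u +
cw`, where `u` is the component of `αw` orthogonal to `w` and `c` is imaginary because `η` is skew.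
The first order condition becomes `‖u‖² = 0`. -/
theorem apply_critical (h : IsNormMax S W w) (hα : α ∈ hermSub hG)
    (hmax : ∀ v, IsNormMax S W v → B (momentVec μ v) α ≤ B (momentVec μ w) α) :
    D α w = ((inner ℂ (D α w) w).re : ℂ) • w := by
  obtain ⟨Y, hY, Z, hZ, hYZ⟩ := h.exists_decomp hα.1
  obtain ⟨-, y, hy⟩ := mem_lineStabilizer.mp hY
  obtain ⟨hZm, z, hz⟩ := mem_lineStabilizer.mp hZ
  set a : ℝ := (inner ℂ (D α w) w).re with ha
  have hww : inner ℂ w w = (1 : ℂ) := by rw [inner_self_eq_norm_sq_to_K, h.norm]; simp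
  have haw : inner ℂ w (D α w) = (a : ℂ) := by
    apply Complex.ext
    · rw [re_inner_comm]; rfl
    · have h6 : (starRingEnd ℂ) (inner ℂ w (D α w)) = inner ℂ w (D α w) := by
        rw [inner_conj_symm, S.symm_of_hermitian hα]
      exact Complex.conj_eq_iff_im.mp h6
  set u := D α w - (a : ℂ) • w with hu
  have hwu : inner ℂ w u = (0 : ℂ) := by
    rw [hu, inner_sub_right, inner_smul_right, hww, haw]; ring
  have huw : inner ℂ u w = (0 : ℂ) := by rw [← inner_conj_symm, hwu, map_zero]
  have hηs : (Z.conjTranspose - Z).conjTranspose = -(Z.conjTranspose - Z) := by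
    rw [Matrix.conjTranspose_sub, Matrix.conjTranspose_conjTranspose, neg_sub]
  have hηm : Z.conjTranspose - Z ∈ lieSub hG := (lieSub hG).sub_mem (S.rep.star_mem Z hZm) hZm
  have h1 := (h.critical hα hmax hηm hηs).1
  set c : ℂ := a - (y + z) with hc
  have hηw : D (Z.conjTranspose - Z) w = u + c • w := by
    have : Z.conjTranspose - Z = α - Y - Z := by rw [hYZ]; abel
    rw [this, map_sub, map_sub]
    simp only [FunLike.coe_sub, Pi.sub_apply]
    rw [hy, hz, hu, hc]; module
  have hαw : D α w = u + (a : ℂ) • w := by rw [hu]; abel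
  have hcre : c.re = 0 := by
    have h2 := S.rep.adjoint _ hηm w w
    rw [hηs, map_neg, FunLike.coe_neg, Pi.neg_apply, inner_neg_right, hηw, inner_add_left,
      inner_add_right, inner_smul_left, inner_smul_right, huw, hwu, hww, mul_one, mul_one, zero_add,
      zero_add] at h2
    have h3 := congrArg Complex.re h2
    simp only [Complex.conj_re, Complex.neg_re] at h3
    linarith
  rw [hηw, hαw, inner_add_left, inner_add_right, inner_add_right, inner_smul_left, inner_smul_left,
    inner_smul_right, inner_smul_right, huw, hwu, hww, inner_self_eq_norm_sq_to_K,
    Complex.conj_ofReal] at h1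
  have h4 : ‖u‖ ^ 2 = 0 := by
    have h5 : (((‖u‖ : ℝ) : ℂ) ^ 2).re = ‖u‖ ^ 2 := by norm_cast
    have h6 : ((a : ℂ) * (c * 1)).re = 0 := by rw [Complex.re_ofReal_mul, mul_one, hcre, mul_zero]
    have h7 : (((‖u‖ : ℝ) : ℂ) ^ 2 + c * 0 + ((a : ℂ) * 0 + (a : ℂ) * (c * 1))).re = 0 := h1
    rw [mul_zero, mul_zero, add_zero, zero_add, Complex.add_re, h5, h6, add_zero] at h7
    exact h7
  exact sub_eq_zero.mp (norm_eq_zero.mp (pow_eq_zero_iff two_ne_zero |>.mp h4))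

/-- Comparing eigenvalues of `α` gives `Zw = 0`, and `v = Z*w` has eigenvalue `a + t`. The second
order condition along `Z* - Z` then reduces to `t‖v‖² ≤ 0`. -/
theorem apply_conjTranspose_eq_zero (h : IsNormMax S W w) (hα : α ∈ hermSub hG)
    (hmax : ∀ v, IsNormMax S W v → B (momentVec μ v) α ≤ B (momentVec μ w) α) {Z : Mat}
    (hZ : Z ∈ lineStabilizer hG D w) {t : ℝ} (ht : 0 < t)
    (hZt : Z ∈ gradedPart hα.2 (· = t)) : D Z.conjTranspose w = 0 := by
  obtain ⟨hZm, z, hz⟩ := mem_lineStabilizer.mp hZ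
  set a : ℝ := (inner ℂ (D α w) w).re
  have hαw : D α w = (a : ℂ) • w := h.apply_critical hα hmax
  have hw0 := ne_zero_of_norm_eq_one h.norm
  have hZw : D Z w = 0 := by
    have h1 := S.apply_homogeneous hα hZm hZt hαw
    rw [hz, map_smul, hαw, smul_smul, smul_smul] at h1
    have h2 := smul_left_injective ℂ hw0 h1
    push_cast at h2
    have h3 : (t : ℂ) * z = 0 := by linear_combination h2
    have ht' : (t : ℂ) ≠ 0 := by exact_mod_cast ht.ne'
    rw [hz, (mul_eq_zero.mp h3).resolve_left ht', zero_smul]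
  have hZHm := S.rep.star_mem Z hZm
  have hZHt : Z.conjTranspose ∈ gradedPart hα.2 (· = -t) :=
    conjTranspose_mem_gradedPart (fun t ht => by rw [ht]) hZt
  have hηs : (Z.conjTranspose - Z).conjTranspose = -(Z.conjTranspose - Z) := by
    rw [Matrix.conjTranspose_sub, Matrix.conjTranspose_conjTranspose, neg_sub]
  have h1 := (h.critical hα hmax ((lieSub hG).sub_mem hZHm hZm) hηs).2
  set v := D Z.conjTranspose w with hv
  have hηw : D (Z.conjTranspose - Z) w = v := by
    rw [map_sub, FunLike.coe_sub, Pi.sub_apply, hZw, sub_zero]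
  have hαv : D α v = ((a + t : ℝ) : ℂ) • v := by
    have := S.apply_homogeneous hα hZHm hZHt hαw
    rwa [sub_neg_eq_add] at this
  have h2 : inner ℂ w (D (Z.conjTranspose - Z) v) = -((‖v‖ ^ 2 : ℝ) : ℂ) := by
    rw [map_sub, FunLike.coe_sub, Pi.sub_apply, inner_sub_right, ← S.rep.adjoint Z hZm,
      ← S.rep.adjoint' hZm, hZw, inner_zero_left, ← hv, inner_self_eq_norm_sq_to_K]
    push_cast
    simp
  rw [hηw, hαw, hαv, inner_smul_left, inner_smul_left, h2, Complex.conj_ofReal, Complex.conj_ofReal,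
    Complex.re_ofReal_mul, Complex.re_ofReal_mul, Complex.neg_re, Complex.ofReal_re,
    inner_self_eq_norm_sq_to_K] at h1
  have h5 : (((‖v‖ : ℝ) : ℂ) ^ 2).re = ‖v‖ ^ 2 := by norm_cast
  change (a + t) * (((‖v‖ : ℝ) : ℂ) ^ 2).re + _ ≤ 0 at h1
  rw [h5] at h1
  by_contra hne
  have : 0 < ‖v‖ ^ 2 := by
    have := norm_pos_iff.mpr hne
    positivity
  nlinarith

/-- The moment polytope of an irreducible representation is spanned by the momentum values of
maximal norm. -/
theorem inner_le_of_critical (h : IsNormMax S W w) (hW : W.toRepresentation.IsIrreducible)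
    (hα : α ∈ hermSub hG)
    (hmax : ∀ v, IsNormMax S W v → B (momentVec μ v) α ≤ B (momentVec μ w) α) {v : V}
    (hv : v ∈ W.toSubmodule) (hv1 : ‖v‖ = 1) : B (momentVec μ v) α ≤ B (momentVec μ w) α := by
  set a : ℝ := (inner ℂ (D α w) w).re with ha
  have hαw : D α w = (a : ℂ) • w := h.apply_critical hα hmax
  obtain ⟨e, heW, he1, hemax⟩ := exists_rayleigh_max (D α) h.mem h.norm
  set b : ℝ := (inner ℂ (D α e) e).re with hb
  have htop : ∀ v ∈ W.toSubmodule, (inner ℂ (D α v) v).re ≤ b * ‖v‖ ^ 2 :=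
    fun v hv => rayleigh_le_of_unit hemax hv
  have heb : D α e = (b : ℂ) • e :=
    eigenvector_of_rayleigh_max (S.symm_of_hermitian hα) (fun _ hv => S.apply_mem W hα.1 hv) htop heW
      (by rw [he1]; ring)
  -- If the largest eigenvalue `b` were not `a`, then `w ∈ Eᗮ` for its eigenspace `E`. Non-negative
  -- `α`-degrees preserve `Eᗮ`, their adjoints preserving or killing `E`, and they generate `W` from
  -- `w`. So `W ⊆ Eᗮ`, which is absurd.
  have hab : b = a := by
    by_contra hne
    let E : Submodule ℂ V := W.toSubmodule ⊓ Module.End.eigenspace (D α).toLinearMap (b : ℂ)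
    have hE : ∀ v, v ∈ E ↔ v ∈ W.toSubmodule ∧ D α v = (b : ℂ) • v := fun v => by
      rw [Submodule.mem_inf, Module.End.mem_eigenspace_iff]; rfl
    have key : W.toSubmodule ≤ Eᗮ := by
      refine le_of_stable_of_generating hG S.rep S.exp_eq hW h.mem (ne_zero_of_norm_eq_one h.norm)
        (𝔮 := {X | X ∈ lieSub hG ∧ ∃ s : ℝ, 0 ≤ s ∧ X ∈ gradedPart hα.2 (· = s)})
        (fun X hX => hX.1) (fun M hwM hM X hX => ?_) ?_ ?_
      · obtain ⟨Y, hY, Z, hZ, rfl⟩ := h.exists_decomp hX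
        rw [map_add, FunLike.coe_add, Pi.add_apply]
        obtain ⟨hYm, y, hy⟩ := mem_lineStabilizer.mp hY
        refine M.add_mem (by rw [hy]; exact M.smul_mem _ hwM) ?_
        let P : Submodule ℂ Mat :=
          { carrier := {Z | D Z.conjTranspose w ∈ M}
            zero_mem' := by simp
            add_mem' := fun {x y} hx hy => by
              change D (x + y).conjTranspose w ∈ M
              rw [Matrix.conjTranspose_add, map_add]; exact M.add_mem hx hy
            smul_mem' := fun c x hx => by
              change D (c • x).conjTranspose w ∈ M
              rw [Matrix.conjTranspose_smul, map_smul]; exact M.smul_mem _ hx }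
        -- Since `αw = aw`, `ad α` preserves the stabilizer of the line, so only homogeneous `Z`
        -- matter: for `t ≤ 0` the adjoint `Z*` lies in `𝔮`, and for `t > 0` it kills `w`.
        have hP : lineStabilizer hG D w ≤ P := by
          refine le_of_homogeneous_mem (hβ := hα.2) (fun X hX => ?_) (fun t Z hZ ht => ?_)
          · obtain ⟨hXm, x, hx⟩ := mem_lineStabilizer.mp hX
            refine mem_lineStabilizer.mpr ⟨S.rep.lie_mem _ hα.1 _ hXm, 0, ?_⟩
            have h1 := S.rep.map_lie_apply hα.1 hXm w
            rw [hx, map_smul, hαw, map_smul, hx, smul_comm, left_eq_add] at h1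
            rw [h1, zero_smul]
          · change D Z.conjTranspose w ∈ M
            rcases le_or_gt t 0 with h0 | h0
            · exact hM _ ⟨S.rep.star_mem Z (mem_lineStabilizer.mp hZ).1, -t, neg_nonneg.mpr h0,
                conjTranspose_mem_gradedPart (fun t ht => by rw [ht]) ht⟩ w hwM
            · rw [h.apply_conjTranspose_eq_zero hα hmax hZ h0 ht]; exact M.zero_mem
        exact hP hZ
      · refine (Submodule.mem_orthogonal _ _).mpr fun e' he' => ?_
        have h1 := S.symm_of_hermitian hα e' w
        rw [hαw, ((hE e').mp he').2, inner_smul_left, inner_smul_right, Complex.conj_ofReal] at h1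
        have h2 : ((b : ℂ) - a) * inner ℂ e' w = 0 := by rw [sub_mul, h1, sub_self]
        refine (mul_eq_zero.mp h2).resolve_left (sub_ne_zero.mpr ?_)
        exact_mod_cast hne
      · rintro X ⟨hX, s, hs0, hs⟩ v hv
        refine (Submodule.mem_orthogonal _ _).mpr fun e' he' => ?_
        obtain ⟨he'W, he'b⟩ := (hE e').mp he'
        have hXs : X.conjTranspose ∈ gradedPart hα.2 (· = -s) :=
          conjTranspose_mem_gradedPart (fun t ht => by rw [ht]) hs
        rw [← S.rep.adjoint' hX]
        rcases hs0.eq_or_lt with rfl | h0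
        · rw [neg_zero] at hXs
          refine (Submodule.mem_orthogonal _ _).mp hv _ ((hE _).mpr
            ⟨S.apply_mem W (S.rep.star_mem X hX) he'W, ?_⟩)
          have := S.apply_homogeneous hα (S.rep.star_mem X hX) hXs he'b
          rwa [sub_zero] at this
        · rw [S.apply_eq_zero_of_top hα htop he'W he'b (S.rep.star_mem X hX) (neg_lt_zero.mpr h0)
            hXs, inner_zero_left]
    have h1 := (Submodule.mem_orthogonal _ _).mp (key heW) e ((hE e).mpr ⟨heW, heb⟩)
    exact ne_zero_of_norm_eq_one he1 (inner_self_eq_zero.mp h1)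
  have h1 := hemax v hv hv1
  have h2 := S.moment_sub hα hv1 h.norm
  linarith

end Critical

end IsNormMax

/-- Extreme points of the moment polytope of an irreducible representation are momentum values of
maximal norm. -/
theorem exists_isNormMax (S : IsMomentumSetting hG ρ D B μ) {W : Subrepresentation ρ}
    (hW : W.toRepresentation.IsIrreducible) {β : Mat}
    (hβ : β ∈ (convexHull ℝ ((fun x => (μ x : Mat)) '' projSubspace W.toSubmodule)).extremePoints ℝ) :
    ∃ w, IsNormMax S W w ∧ momentVec μ w = β := by
  have : ProperSpace V := FiniteDimensional.proper_rclike ℂ V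
  set T : Set V := {w | IsNormMax S W w}
  set Sph : Set V := Metric.sphere (0 : V) 1 ∩ W.toSubmodule with hSph
  have hSphc : IsCompact Sph :=
    (isCompact_sphere 0 1).inter_right W.toSubmodule.closed_of_finiteDimensional
  have hcont : ContinuousOn (momentVec μ) Sph := S.continuousOn_momentVec.mono Set.inter_subset_left
  have hBc : ∀ f : Mat →ₗ[ℝ] ℝ, Continuous f := fun f => by
    exact f.continuous_of_finiteDimensional
  have hNcont : ContinuousOn (fun w => B (momentVec μ w) (momentVec μ w)) Sph := by
    let b := Module.finBasis ℝ Mat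
    have h1 : ∀ x y : Mat, B x y = ∑ i, b.repr x i * B (b i) y := fun x y => by
      conv_lhs => rw [← b.sum_repr x, map_sum, LinearMap.sum_apply]
      exact Finset.sum_congr rfl fun i _ => by rw [map_smul, LinearMap.smul_apply, smul_eq_mul]
    have h2 : (fun w => B (momentVec μ w) (momentVec μ w)) =
        fun w => ∑ i, b.coord i (momentVec μ w) * B (b i) (momentVec μ w) := by
      funext w; exact h1 _ _
    rw [h2]
    refine continuousOn_finsetSum _ fun i _ => ContinuousOn.mul ?_ ?_
    · exact (hBc (b.coord i)).comp_continuousOn hcont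
    · exact (hBc (B (b i))).comp_continuousOn hcont
  have hunit : ∀ x ∈ projSubspace W.toSubmodule, ∃ v ∈ Sph, (μ x : Mat) = momentVec μ v := by
    intro x hx
    have hv0 := x.rep_nonzero
    have hxm : x.rep ∈ W.toSubmodule := by
      refine hx ?_
      rw [Projectivization.submodule_eq]; exact Submodule.mem_span_singleton_self _
    have hn : ‖x.rep‖ ≠ 0 := norm_ne_zero_iff.mpr hv0
    have hc : (((‖x.rep‖⁻¹ : ℝ)) : ℂ) ≠ 0 := by exact_mod_cast inv_ne_zero hn
    refine ⟨(((‖x.rep‖⁻¹ : ℝ)) : ℂ) • x.rep, ⟨?_, W.toSubmodule.smul_mem _ hxm⟩, ?_⟩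
    · rw [mem_sphere_zero_iff_norm, norm_smul, Complex.norm_real, norm_inv, norm_norm,
        inv_mul_cancel₀ hn]
    · rw [momentVec_smul hc hv0, momentVec_of_ne hv0, Projectivization.mk_rep]
  have hmemP : ∀ v (hv : v ≠ 0), v ∈ W.toSubmodule →
      Projectivization.mk ℂ v hv ∈ projSubspace W.toSubmodule := by
    intro v hv hvW
    change (Projectivization.mk ℂ v hv).submodule ≤ _
    rw [Projectivization.submodule_mk, Submodule.span_singleton_le_iff_mem]; exact hvW
  have hβc := extremePoints_subset hβ
  have hne : Sph.Nonempty := by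
    obtain ⟨y, hy⟩ := (convexHull_nonempty_iff (𝕜 := ℝ)).mp ⟨β, hβc⟩
    obtain ⟨x, hx, -⟩ := hy
    obtain ⟨v, hv, -⟩ := hunit x hx
    exact ⟨v, hv⟩
  have hT : T.Nonempty := by
    obtain ⟨w, hw, hwmax⟩ := hSphc.exists_isMaxOn hne hNcont
    exact ⟨w, hw.2, by simpa using hw.1, fun v hv hv1 => hwmax ⟨by simpa using hv1, hv⟩⟩
  have hTS : T ⊆ Sph := fun w hw => ⟨by simpa using hw.norm, hw.mem⟩
  have hTc : IsCompact T := by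
    obtain ⟨w, hw⟩ := hT
    have h1 : T = Sph ∩ (fun w => B (momentVec μ w) (momentVec μ w)) ⁻¹'
        Set.Ici (B (momentVec μ w) (momentVec μ w)) := by
      ext v
      constructor
      · intro hv; exact ⟨hTS hv, hv.le w hw.mem hw.norm⟩
      · rintro ⟨hv, hv2⟩
        exact ⟨hv.2, by simpa using hv.1, fun u hu hu1 => (hw.le u hu hu1).trans hv2⟩
    rw [h1]
    exact hSphc.of_isClosed_subset (hNcont.preimage_isClosed_of_isClosed hSphc.isClosed isClosed_Ici)
      Set.inter_subset_left
  have hTim : IsCompact (momentVec μ '' T) := hTc.image_of_continuousOn (hcont.mono hTS)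
  have hsub : momentVec μ '' T ⊆ (fun x => (μ x : Mat)) '' projSubspace W.toSubmodule := by
    rintro _ ⟨w, hw, rfl⟩
    have hw0 := ne_zero_of_norm_eq_one hw.norm
    exact ⟨_, hmemP w hw0 hw.mem, (momentVec_of_ne hw0).symm⟩
  have hβherm : β ∈ hermSub hG := by
    refine (convexHull_min ?_ (hermSub hG).convex) hβc
    rintro _ ⟨x, -, rfl⟩
    exact (μ x).2
  -- A functional separating `β` from the norm-maximal values is `⟨·, α⟩` on `𝔭`. Its maximum over
  -- those values bounds it on all of `μ(ℙ(W))`, hence at `β`.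
  have hβT : β ∈ convexHull ℝ (momentVec μ '' T) := by
    by_contra hnot
    obtain ⟨f, hf⟩ := matrix_exists_separating hTim hnot
    have hnd := S.restrict_nondegenerate
    let α := (LinearMap.BilinForm.toDual (B.restrict (hermSub hG)) hnd).symm (f ∘ₗ (hermSub hG).subtype)
    have hα : ∀ ξ ∈ hermSub hG, B ξ α = f ξ := by
      intro ξ hξ
      rw [S.invInner.symm ξ hξ α α.2]
      exact LinearMap.BilinForm.apply_toDual_symm_apply (hB := hnd) (f ∘ₗ (hermSub hG).subtype) ⟨ξ, hξ⟩
    obtain ⟨w, hw, hwmax⟩ := hTc.exists_isMaxOn hT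
      (f := fun w => B (momentVec μ w) α)
      ((hBc (B.flip α)).comp_continuousOn (hcont.mono hTS))
    have hwmax' : ∀ v, IsNormMax S W v → B (momentVec μ v) α ≤ B (momentVec μ w) α :=
      fun v hv => hwmax hv
    have h1 : (fun x => (μ x : Mat)) '' projSubspace W.toSubmodule ⊆
        {ξ | f ξ ≤ B (momentVec μ w) α} := by
      rintro _ ⟨x, hx, rfl⟩
      obtain ⟨v, hv, hxv⟩ := hunit x hx
      change f (μ x) ≤ _
      rw [hxv]
      have hv1 : ‖v‖ = 1 := by simpa using hv.1
      rw [← hα _ (momentVec_mem (ne_zero_of_norm_eq_one hv1))]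
      exact IsNormMax.inner_le_of_critical hw hW α.2 hwmax' hv.2 hv1
    have h2 : f β ≤ B (momentVec μ w) α :=
      (convexHull_min h1 (convex_halfSpace_le f.isLinear _)) hβc
    have h3 := hf _ ⟨w, hw, rfl⟩
    rw [← hα _ hw.herm] at h3
    linarith
  have hβe : β ∈ (convexHull ℝ (momentVec μ '' T)).extremePoints ℝ :=
    inter_extremePoints_subset_extremePoints_of_subset (convexHull_mono hsub) ⟨hβT, hβ⟩
  obtain ⟨w, hw, hwβ⟩ := extremePoints_convexHull_subset hβe
  exact ⟨w, hw, hwβ⟩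

end IsMomentumSetting

end Extremal

/-! ### Polynomial maps and homogenization. -/

section Polynomial

variable {C E F H : Type*} [AddCommGroup C] [Module ℂ C] [AddCommGroup E] [Module ℂ E]
  [AddCommGroup F] [Module ℂ F] [AddCommGroup H] [Module ℂ H]

theorem IsPolynomialFun.const (c : ℂ) : IsPolynomialFun (fun _ : C => c) :=
  (Algebra.adjoin ℂ _).algebraMap_mem c

theorem IsPolynomialFun.linear (l : C →ₗ[ℂ] ℂ) : IsPolynomialFun (fun x => l x) :=
  Algebra.subset_adjoin ⟨l, rfl⟩

theorem IsPolynomialFun.add {p q : C → ℂ} (hp : IsPolynomialFun p) (hq : IsPolynomialFun q) :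
    IsPolynomialFun (fun x => p x + q x) := (Algebra.adjoin ℂ _).add_mem hp hq

theorem IsPolynomialFun.mul {p q : C → ℂ} (hp : IsPolynomialFun p) (hq : IsPolynomialFun q) :
    IsPolynomialFun (fun x => p x * q x) := (Algebra.adjoin ℂ _).mul_mem hp hq

theorem IsPolynomialFun.pow {p : C → ℂ} (hp : IsPolynomialFun p) (k : ℕ) :
    IsPolynomialFun (fun x => p x ^ k) := (Algebra.adjoin ℂ _).pow_mem hp k

theorem IsPolynomialFun.sum {ι : Type*} {s : Finset ι} {p : ι → C → ℂ}
    (hp : ∀ i ∈ s, IsPolynomialFun (p i)) : IsPolynomialFun (fun x => ∑ i ∈ s, p i x) := by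
  have := (Algebra.adjoin ℂ (Set.range fun l : Module.Dual ℂ C => (l : C → ℂ))).sum_mem hp
  have h : (fun x => ∑ i ∈ s, p i x) = ∑ i ∈ s, p i := by
    funext x; rw [Finset.sum_apply]
  rw [h]; exact this

theorem IsPolynomialFun.induction {P : (C → ℂ) → Prop} (hc : ∀ c : ℂ, P fun _ => c)
    (hl : ∀ l : C →ₗ[ℂ] ℂ, P fun x => l x) (ha : ∀ p q, P p → P q → P fun x => p x + q x)
    (hm : ∀ p q, P p → P q → P fun x => p x * q x) {p : C → ℂ} (hp : IsPolynomialFun p) : P p := by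
  refine Algebra.adjoin_induction (p := fun x _ => P x) ?_ (fun c => hc c)
    (fun p q _ _ => ha p q) (fun p q _ _ => hm p q) hp
  rintro _ ⟨l, rfl⟩
  exact hl l

/-- Polynomial maps between complex vector spaces. -/
def IsPolyMap (P : C → E) : Prop := ∀ l : Module.Dual ℂ E, IsPolynomialFun fun x => l (P x)

theorem IsPolynomialFun.comp {p : E → ℂ} (hp : IsPolynomialFun p) {P : C → E} (hP : IsPolyMap P) :
    IsPolynomialFun fun x => p (P x) :=
  hp.induction (P := fun p => IsPolynomialFun fun x => p (P x)) (fun c => .const c) (fun l => hP l)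
    (fun _ _ h1 h2 => h1.add h2) (fun _ _ h1 h2 => h1.mul h2)

namespace IsPolyMap

theorem const (e : E) : IsPolyMap (fun _ : C => e) := fun l => .const (l e)

theorem linear (L : C →ₗ[ℂ] E) : IsPolyMap (fun x => L x) := fun l => .linear (l ∘ₗ L)

theorem id : IsPolyMap (fun x : C => x) := linear LinearMap.id

theorem add {P Q : C → E} (hP : IsPolyMap P) (hQ : IsPolyMap Q) : IsPolyMap fun x => P x + Q x :=
  fun l => by simpa only [map_add] using (hP l).add (hQ l)

theorem sum {ι : Type*} {s : Finset ι} {P : ι → C → E} (hP : ∀ i ∈ s, IsPolyMap (P i)) :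
    IsPolyMap fun x => ∑ i ∈ s, P i x :=
  fun l => by simpa only [map_sum] using IsPolynomialFun.sum fun i hi => hP i hi l

theorem smul {p : C → ℂ} {P : C → E} (hp : IsPolynomialFun p) (hP : IsPolyMap P) :
    IsPolyMap fun x => p x • P x :=
  fun l => by simpa only [map_smul, smul_eq_mul] using hp.mul (hP l)

theorem comp {Q : E → F} {P : C → E} (hQ : IsPolyMap Q) (hP : IsPolyMap P) :
    IsPolyMap fun x => Q (P x) := fun l => (hQ l).comp hP

theorem linear_comp (L : E →ₗ[ℂ] F) {P : C → E} (hP : IsPolyMap P) : IsPolyMap fun x => L (P x) :=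
  (linear L).comp hP

theorem prodMk {P : C → E} {Q : C → F} (hP : IsPolyMap P) (hQ : IsPolyMap Q) :
    IsPolyMap fun x => (P x, Q x) := by
  have := ((linear (LinearMap.inl ℂ E F)).comp hP).add ((linear (LinearMap.inr ℂ E F)).comp hQ)
  simpa using this

theorem bilinear [FiniteDimensional ℂ E] (b : E →ₗ[ℂ] F →ₗ[ℂ] H) {P : C → E} {Q : C → F}
    (hP : IsPolyMap P) (hQ : IsPolyMap Q) : IsPolyMap fun x => b (P x) (Q x) := by
  let v := Module.finBasis ℂ E
  have h : (fun x => b (P x) (Q x)) = fun x => ∑ i, v.coord i (P x) • b (v i) (Q x) := by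
    funext x
    conv_lhs => rw [← v.sum_repr (P x), map_sum, LinearMap.sum_apply]
    exact Finset.sum_congr rfl fun i _ => by rw [map_smul, LinearMap.smul_apply]; rfl
  rw [h]
  exact sum fun i _ => smul (hP (v.coord i)) (linear_comp _ hQ)

theorem mul {A : Type*} [Ring A] [Algebra ℂ A] [FiniteDimensional ℂ A] {P Q : C → A}
    (hP : IsPolyMap P) (hQ : IsPolyMap Q) : IsPolyMap fun x => P x * Q x :=
  bilinear (LinearMap.mul ℂ A) hP hQ

theorem pow {A : Type*} [Ring A] [Algebra ℂ A] [FiniteDimensional ℂ A] {P : C → A}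
    (hP : IsPolyMap P) (k : ℕ) : IsPolyMap fun x => P x ^ k := by
  induction k with
  | zero => simpa using const 1
  | succ k ih => simpa only [pow_succ] using ih.mul hP

theorem truncExp {A : Type*} [Ring A] [Algebra ℂ A] [FiniteDimensional ℂ A] {P : C → A}
    (hP : IsPolyMap P) (N : ℕ) :
    IsPolyMap fun x => ∑ k ∈ Finset.range N, ((k.factorial : ℂ)⁻¹) • P x ^ k :=
  sum fun k _ => smul (.const _) (hP.pow k)

end IsPolyMap

/-- Every sufficiently large exponent is allowed, so that all coordinates of a polynomial map can
share one denominator. -/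
theorem IsPolynomialFun.exists_homogenization {p : C → ℂ} (hp : IsPolynomialFun p)
    (φ : C →ₗ[ℂ] ℂ) : ∃ M₀ : ℕ, ∀ M, M₀ ≤ M → ∃ q : C → ℂ, IsPolynomialFun q ∧
      ∀ x, φ x ≠ 0 → p ((φ x)⁻¹ • x) = (φ x ^ M)⁻¹ * q x := by
  suffices h : ∃ M₀ : ℕ, ∃ q : C → ℂ, IsPolynomialFun q ∧
      ∀ x, φ x ≠ 0 → p ((φ x)⁻¹ • x) = (φ x ^ M₀)⁻¹ * q x by
    obtain ⟨M₀, q, hq, hpq⟩ := h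
    refine ⟨M₀, fun M hM => ⟨fun x => φ x ^ (M - M₀) * q x, ((IsPolynomialFun.linear φ).pow _).mul hq,
      fun x hx => ?_⟩⟩
    rw [hpq x hx]
    obtain ⟨k, rfl⟩ := Nat.exists_eq_add_of_le hM
    rw [Nat.add_sub_cancel_left, pow_add]
    field_simp
  refine hp.induction (P := fun p => ∃ M₀ : ℕ, ∃ q : C → ℂ, IsPolynomialFun q ∧
      ∀ x, φ x ≠ 0 → p ((φ x)⁻¹ • x) = (φ x ^ M₀)⁻¹ * q x) ?_ ?_ ?_ ?_
  · exact fun c => ⟨0, _, .const c, by simp⟩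
  · exact fun l => ⟨1, _, .linear l, by simp⟩
  · rintro p q ⟨M, p', hp', h1⟩ ⟨M', q', hq', h2⟩
    refine ⟨M + M', fun x => φ x ^ M' * p' x + φ x ^ M * q' x,
      (((IsPolynomialFun.linear φ).pow _).mul hp').add (((IsPolynomialFun.linear φ).pow _).mul hq'),
      fun x hx => ?_⟩
    beta_reduce
    rw [h1 x hx, h2 x hx, pow_add]
    field_simp
  · rintro p q ⟨M, p', hp', h1⟩ ⟨M', q', hq', h2⟩
    refine ⟨M + M', _, hp'.mul hq', fun x hx => ?_⟩
    beta_reduce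
    rw [h1 x hx, h2 x hx, pow_add]
    field_simp

theorem IsPolyMap.exists_homogenization [FiniteDimensional ℂ E] {P : C → E} (hP : IsPolyMap P)
    (φ : C →ₗ[ℂ] ℂ) : ∃ (M : ℕ) (Q : C → E), IsPolyMap Q ∧
      ∀ x, φ x ≠ 0 → P ((φ x)⁻¹ • x) = (φ x ^ M)⁻¹ • Q x := by
  let v := Module.finBasis ℂ E
  choose M₀ hM₀ using fun i => (hP (v.coord i)).exists_homogenization φ
  choose q hq hpq using fun i => hM₀ i (Finset.univ.sup M₀) (Finset.le_sup (Finset.mem_univ i))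
  refine ⟨Finset.univ.sup M₀, fun x => ∑ i, q i x • v i,
    .sum fun i _ => .smul (hq i) (.const _), fun x hx => ?_⟩
  rw [← v.sum_repr (P ((φ x)⁻¹ • x)), Finset.smul_sum]
  refine Finset.sum_congr rfl fun i _ => ?_
  rw [smul_smul, ← hpq i x hx]
  rfl

end Polynomial

/-! ### Regular maps are holomorphic. -/

section Holomorphic

variable {C E : Type*} [NormedAddCommGroup C] [NormedSpace ℂ C] [FiniteDimensional ℂ C]
  [NormedAddCommGroup E] [NormedSpace ℂ E] [FiniteDimensional ℂ E]

theorem IsPolynomialFun.differentiable {p : C → ℂ} (hp : IsPolynomialFun p) :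
    Differentiable ℂ p :=
  hp.induction (P := fun p => Differentiable ℂ p) (fun c => differentiable_const c)
    (fun l => (LinearMap.toContinuousLinearMap l).differentiable)
    (fun _ _ h1 h2 => h1.add h2) (fun _ _ h1 h2 => h1.mul h2)

theorem IsPolyMap.differentiable {P : C → E} (hP : IsPolyMap P) : Differentiable ℂ P := by
  let v := Module.finBasis ℂ E
  have h : P = fun x => ∑ i, v.coord i (P x) • v i := by
    funext x; exact (v.sum_repr (P x)).symm
  rw [h]
  exact Differentiable.fun_sum fun i _ => (hP (v.coord i)).differentiable.smul_const _

theorem IsRegularOn.isHolomorphicOn {X Y : Type*} {rX : X → C → Prop} {rY : Y → E → Prop} {S : Set X}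
    {f : X → Y} (h : IsRegularOn rX rY S f) : IsHolomorphicOn rX rY S f := by
  intro x hx c hc
  obtain ⟨P, q, hP, hq, hqc, hPq⟩ := h x hx c hc
  refine ⟨fun c' => (q c')⁻¹ • P c', ?_⟩
  filter_upwards [hq.differentiable.continuous.continuousAt.eventually_ne hqc] with c' hc'
  exact ⟨(hq.differentiable.differentiableAt.inv hc').smul (IsPolyMap.differentiable hP).differentiableAt,
    hPq c' hc'⟩

end Holomorphic

theorem IsRegularOn.isHolomorphicOn_matrix_left {n : ℕ} {V E X Y : Type*} [NormedAddCommGroup V]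
    [NormedSpace ℂ V] [FiniteDimensional ℂ V] [NormedAddCommGroup E] [NormedSpace ℂ E]
    [FiniteDimensional ℂ E] {rX : X → Matrix (Fin n) (Fin n) ℂ × V → Prop} {rY : Y → E → Prop}
    {S : Set X} {f : X → Y} (h : IsRegularOn rX rY S f) : IsHolomorphicOn rX rY S f := by
  let _ : NormedAddCommGroup (Matrix (Fin n) (Fin n) ℂ) := Matrix.normedAddCommGroup
  let _ : NormedSpace ℂ (Matrix (Fin n) (Fin n) ℂ) := Matrix.normedSpace
  have : FiniteDimensional ℂ (Matrix (Fin n) (Fin n) ℂ) := inferInstance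
  exact IsRegularOn.isHolomorphicOn (C := Matrix (Fin n) (Fin n) ℂ × V) (E := E) h

theorem IsRegularOn.isHolomorphicOn_matrix_right {n : ℕ} {V E X Y : Type*} [NormedAddCommGroup V]
    [NormedSpace ℂ V] [FiniteDimensional ℂ V] [NormedAddCommGroup E] [NormedSpace ℂ E]
    [FiniteDimensional ℂ E] {rX : X → E → Prop} {rY : Y → Matrix (Fin n) (Fin n) ℂ × V → Prop}
    {S : Set X} {f : X → Y} (h : IsRegularOn rX rY S f) : IsHolomorphicOn rX rY S f := by
  let _ : NormedAddCommGroup (Matrix (Fin n) (Fin n) ℂ) := Matrix.normedAddCommGroup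
  let _ : NormedSpace ℂ (Matrix (Fin n) (Fin n) ℂ) := Matrix.normedSpace
  have : FiniteDimensional ℂ (Matrix (Fin n) (Fin n) ℂ) := inferInstance
  exact IsRegularOn.isHolomorphicOn (C := E) (E := Matrix (Fin n) (Fin n) ℂ × V) h

/-! ### Uniform nilpotency. -/

section Nilpotent

variable {𝔸 : Type*} [NormedRing 𝔸] [NormedAlgebra ℂ 𝔸]

theorem lie_pow_of_lie {A T : 𝔸} {s : ℝ} (h : A * T - T * A = -(s : ℂ) • T) (k : ℕ) :
    A * T ^ k - T ^ k * A = -((k * s : ℝ) : ℂ) • T ^ k := by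
  induction k with
  | zero => simp
  | succ k ih =>
    have : A * T ^ (k + 1) - T ^ (k + 1) * A =
        (A * T ^ k - T ^ k * A) * T + T ^ k * (A * T - T * A) := by rw [pow_succ]; noncomm_ring
    rw [this, ih, h, smul_mul_assoc, mul_smul_comm, ← pow_succ]
    push_cast
    module

/-- Eigenvectors of `ad A` with eigenvalue `-s` are uniformly nilpotent. -/
theorem exists_pow_eq_zero_of_lie (A : 𝔸) {s : ℝ} (hs : 0 < s) :
    ∃ N : ℕ, ∀ T : 𝔸, A * T - T * A = -(s : ℂ) • T → T ^ (N + 1) = 0 := by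
  -- `ad A` has norm at most `2‖A‖`, whereas a nonzero `T ^ (N + 1)` would be an eigenvector with
  -- eigenvalue `-(N + 1)s`.
  obtain ⟨N, hN⟩ := exists_nat_gt (2 * ‖A‖ / s)
  rw [div_lt_iff₀ hs] at hN
  refine ⟨N, fun T hT => ?_⟩
  have h1 := congrArg norm (lie_pow_of_lie hT (N + 1))
  have h2 : ‖A * T ^ (N + 1) - T ^ (N + 1) * A‖ ≤ 2 * ‖A‖ * ‖T ^ (N + 1)‖ := by
    calc _ ≤ ‖A * T ^ (N + 1)‖ + ‖T ^ (N + 1) * A‖ := norm_sub_le _ _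
      _ ≤ ‖A‖ * ‖T ^ (N + 1)‖ + ‖T ^ (N + 1)‖ * ‖A‖ := add_le_add (norm_mul_le _ _) (norm_mul_le _ _)
      _ = _ := by ring
  rw [norm_smul, norm_neg, Complex.norm_real, Real.norm_of_nonneg (by positivity)] at h1
  rw [h1] at h2
  by_contra hne
  have h3 := norm_pos_iff.mpr hne
  have h4 := le_of_mul_le_mul_right h2 h3
  push_cast at h4
  nlinarith

end Nilpotent

/-! ### Moving vectors into the slice by elements of `R^{β-}`. -/

section Slice

variable {n : ℕ} {G : Subgroup (GL (Fin n) ℂ)}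
  {V : Type*} [NormedAddCommGroup V] [InnerProductSpace ℂ V] [FiniteDimensional ℂ V]

local notation "Mat" => Matrix (Fin n) (Fin n) ℂ

/-- A unit vector `w` on which the Lie algebra acts, relative to the grading by `β`, like on an
extremal weight vector. -/
structure IsExtremal (hG : IsConnectedReductive G) (ρ : Representation ℂ G V)
    (D : Matrix (Fin n) (Fin n) ℂ →ₗ[ℂ] (V →L[ℂ] V)) (β : hermPart G) (w : V) : Prop where
  rep : IsStarLieRep (lieSub hG) D
  exp_eq : ∀ g : G, ∀ X ∈ lieSub hG, toMat g = exp X → opHom ρ g = exp (D X)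
  conj_eq : ∀ g : G, ∀ X ∈ lieSub hG, opHom ρ g * D X * opHom ρ g⁻¹ = D (toMat g * X * toMat g⁻¹)
  norm : ‖w‖ = 1
  degree_neg : ∀ X ∈ lieSub hG, ∀ s : ℝ, s < 0 → X ∈ gradedPart (isHermitian_coe β) (· = s) →
    D X w = 0
  degree_zero : ∀ X ∈ lieSub hG, X ∈ gradedPart (isHermitian_coe β) (· = 0) →
    ∃ c : ℂ, D X w = c • w
  degree_pos : ∀ X ∈ lieSub hG, ∀ s : ℝ, 0 < s → X ∈ gradedPart (isHermitian_coe β) (· = s) →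
    D X w = 0 → X = 0

section Grading

variable {β : Matrix (Fin n) (Fin n) ℂ} {hβ : β.IsHermitian}

theorem degComp_of_mem {s : ℝ} {X : Mat} (hX : X ∈ gradedPart hβ (· = s)) : degComp hβ s X = X := by
  apply eigCoord_injective hβ
  ext i j
  rw [eigCoord_degComp]
  split_ifs with h
  · rfl
  · exact (hX i j h).symm

theorem degComp_eq_zero {p : ℝ → Prop} {s : ℝ} (hp : ¬ p s) {X : Mat} (hX : X ∈ gradedPart hβ p) :
    degComp hβ s X = 0 := by
  apply eigCoord_injective hβ
  rw [show eigCoord hβ (0 : Mat) = 0 from map_zero (eigConj hβ).symm]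
  ext i j
  rw [eigCoord_degComp]
  split_ifs with h
  · exact hX i j (h ▸ hp)
  · rfl

theorem degComp_exp_sub_one {s : ℝ} (hs : 0 < s) {X : Mat} (hX : X ∈ gradedPart hβ (· = s)) :
    degComp hβ s (exp X - 1) = X := by
  have h1 := exp_sub_one_sub_mem_gradedPart hs (gradedPart_mono' (q := (s ≤ ·)) (fun t ht => ht.ge) hX)
  have h2 := degComp_eq_zero (s := s) (by linarith) h1
  rw [map_sub, degComp_of_mem hX] at h2
  exact sub_eq_zero.mp h2

theorem lie_mem_gradedPart {p : ℝ → Prop} {X : Mat} (hX : X ∈ gradedPart hβ p) :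
    β * X - X * β ∈ gradedPart hβ p := by
  intro i j h
  rw [eigCoord_lie, hX i j h, mul_zero]

end Grading

namespace IsExtremal

variable {hG : IsConnectedReductive G} {ρ : Representation ℂ G V}
    {D : Matrix (Fin n) (Fin n) ℂ →ₗ[ℂ] (V →L[ℂ] V)} {β : hermPart G} {w : V}

theorem ne_zero (h : IsExtremal hG ρ D β w) : w ≠ 0 := ne_zero_of_norm_eq_one h.norm

theorem inner_self (h : IsExtremal hG ρ D β w) : inner ℂ w w = (1 : ℂ) := by
  rw [inner_self_eq_norm_sq_to_K, h.norm]; simp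

theorem conjTranspose_apply (h : IsExtremal hG ρ D β w) {X : Mat} (hX : X ∈ lieSub hG) {s : ℝ}
    (hs0 : 0 < s) (hs : X ∈ gradedPart (isHermitian_coe β) (· = s)) : D X.conjTranspose w = 0 :=
  h.degree_neg _ (h.rep.star_mem X hX) (-s) (neg_lt_zero.mpr hs0)
    (conjTranspose_mem_gradedPart (fun t ht => by rw [ht]) hs)

theorem inner_apply_of_pos (h : IsExtremal hG ρ D β w) {X : Mat} (hX : X ∈ lieSub hG)
    (hs : X ∈ gradedPart (isHermitian_coe β) (0 < ·)) (v : V) : inner ℂ w (D X v) = (0 : ℂ) := by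
  let P : Submodule ℂ Mat := LinearMap.ker ((innerSL ℂ w).toLinearMap ∘ₗ
    (ContinuousLinearMap.apply ℂ V v).toLinearMap ∘ₗ D)
  have : lieSub hG ⊓ gradedPart (isHermitian_coe β) (0 < ·) ≤ P := by
    refine le_of_homogeneous_mem (hβ := isHermitian_coe β) (fun X hX => ?_) (fun s X hX hs => ?_)
    · exact ⟨h.rep.lie_mem _ (mem_lieSub.mpr β.2.1) X hX.1, lie_mem_gradedPart hX.2⟩
    · change inner ℂ w (D X v) = (0 : ℂ)
      rcases le_or_gt s 0 with h0 | h0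
      · have : X = 0 := by
          rw [← degComp_of_mem hs]
          exact degComp_eq_zero (p := (0 < ·)) (not_lt.mpr h0) hX.2
        simp [this]
      · rw [← h.rep.adjoint' hX.1, h.conjTranspose_apply hX.1 h0 hs, inner_zero_left]
  exact this ⟨hX, hs⟩

theorem inner_exp_apply {T : V →L[ℂ] V} (hT : ∀ v, inner ℂ w (T v) = (0 : ℂ)) {N : ℕ}
    (hN : T ^ (N + 1) = 0) (v : V) : inner ℂ w (exp T v) = (inner ℂ w v : ℂ) := by
  rw [exp_eq_sum_range_of_pow_eq_zero hN, Finset.sum_range_succ']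
  simp only [FunLike.coe_add, Pi.add_apply, FunLike.coe_sum, Finset.sum_apply,
    FunLike.coe_smul, Pi.smul_apply, inner_add_right, inner_sum, inner_smul_right]
  rw [Finset.sum_eq_zero, zero_add]
  · simp
  · intro k _
    rw [pow_succ', mul_apply_eq_comp, hT, mul_zero]

theorem lie_map (h : IsExtremal hG ρ D β w) {X : Mat} (hX : X ∈ lieSub hG) {s : ℝ}
    (hs : X ∈ gradedPart (isHermitian_coe β) (· = s)) :
    D β * D X - D X * D β = -(s : ℂ) • D X := by
  rw [← h.rep.map_lie _ (mem_lieSub.mpr β.2.1) X hX, mem_gradedPart_eq_iff.mp hs, map_smul]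

theorem opHom_expG (h : IsExtremal hG ρ D β w) {X : Mat} (hX : X ∈ lieSub hG) :
    opHom ρ (expG (mem_lieSub.mp hX)) = exp (D X) := h.exp_eq _ X hX rfl

/-- Positive degrees map `V` into the orthogonal complement of `w`, so only the constant term of
`exp X` contributes, and `R^{β-}` is generated by such exponentials. -/
theorem inner_apply_unipotent (h : IsExtremal hG ρ D β w) {r : G} (hr : r ∈ unipotentRadical G β)
    (v : V) : inner ℂ w (ρ r v) = (inner ℂ w v : ℂ) := by
  refine unipotentRadical_induction hG β (p := fun r => ∀ v, inner ℂ w (ρ r v) = (inner ℂ w v : ℂ))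
    (by simp) ?_ hr v
  intro X hX s hs hXs r ih v
  obtain ⟨N, hN⟩ := exists_pow_eq_zero_of_lie (D β) hs
  rw [map_mul, Module.End.mul_apply, ← opHom_apply, h.opHom_expG hX,
    inner_exp_apply (fun v => h.inner_apply_of_pos hX
      (gradedPart_mono' (fun t ht => by rwa [ht]) hXs) v) (hN _ (h.lie_map hX hXs)), ih]

/-- Change of the `-s`-components of a vector under a unipotent element of order `s`. -/
theorem inner_apply_apply (h : IsExtremal hG ρ D β w) {s : ℝ} (hs : 0 < s) {r : G}
    (hr : toMat r - 1 ∈ gradedPart (isHermitian_coe β) (s ≤ ·)) {Y : Mat} (hY : Y ∈ lieSub hG)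
    (hYs : Y ∈ gradedPart (isHermitian_coe β) (· = -s)) (v : V) :
    inner ℂ w (D Y (ρ r v)) = inner ℂ w (D Y v) +
      inner ℂ (D Y.conjTranspose w) (D (degComp (isHermitian_coe β) s (toMat r - 1)) w) *
        inner ℂ w v := by
  set hβ := isHermitian_coe β
  set A := toMat r - 1 with hA
  set X := degComp hβ s A with hX
  have hXm : X ∈ lieSub hG := degComp_mem_lieSub hG β hs hr
  have hXs : X ∈ gradedPart hβ (· = s) := degComp_mem s A
  have hrR : r ∈ unipotentRadical G β :=
    mem_unipotentRadical_iff.mpr (gradedPart_mono' (fun t ht => hs.trans_le ht) hr)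
  have hr'R := inv_mem_unipotentRadical hG hrR
  have hr'0 : toMat r⁻¹ ∈ gradedPart hβ (0 ≤ ·) := by
    have := Submodule.add_mem _ (gradedPart_mono' (q := (0 ≤ ·)) (fun t ht => le_of_lt ht)
      (mem_unipotentRadical_iff.mp hr'R)) (one_mem_gradedPart (hβ := hβ) (p := (0 ≤ ·)) le_rfl)
    simpa using this
  have hinv : toMat r⁻¹ * toMat r = 1 := by rw [← toMat_mul, inv_mul_cancel, toMat_one]
  have hAX : A - X ∈ gradedPart hβ (s < ·) :=
    gradedPart_mono' (fun t ht => lt_of_le_of_ne ht.1 (Ne.symm ht.2)) (sub_degComp_mem (s := s) hr)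
  -- The expansion is `r⁻¹ Y r = Y + [Y, X] + P` with `P` of positive degree. Paired with `w`,
  -- neither `P` nor the outer `r` contributes, and `[Y, X]`, of degree zero, acts as a scalar,
  -- found by evaluating at `w`.
  set Z := Y * X - X * Y with hZ
  have hZm : Z ∈ lieSub hG := h.rep.lie_mem Y hY X hXm
  have hZ0 : Z ∈ gradedPart hβ (· = 0) := Submodule.sub_mem _
    (mul_mem_gradedPart (fun a b ha hb => by rw [ha, hb]; ring) hYs hXs)
    (mul_mem_gradedPart (fun a b ha hb => by rw [ha, hb]; ring) hXs hYs)
  set P := toMat r⁻¹ * Y * toMat r - Y - Z with hP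
  have hconjm : toMat r⁻¹ * Y * toMat r ∈ lieSub hG := by
    have := conj_mem_lieSub (hG := hG) (r⁻¹).2 hY
    rw [InvMemClass.coe_inv, inv_inv] at this
    exact this
  have hPm : P ∈ lieSub hG := (lieSub hG).sub_mem ((lieSub hG).sub_mem hconjm hY) hZm
  have hPs : P ∈ gradedPart hβ (0 < ·) := by
    -- This element is `r P`; the condition on `A - X` and the degrees of `Y`, `A` and `Z` make all
    -- its degrees positive.
    have hE : Y * (A - X) - (A - X) * Y - A * Z ∈ gradedPart hβ (0 < ·) := by
      refine Submodule.sub_mem _ (Submodule.sub_mem _ ?_ ?_) ?_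
      · exact mul_mem_gradedPart (fun a b ha hb => by rw [ha]; linarith) hYs hAX
      · exact mul_mem_gradedPart (fun a b ha hb => by rw [hb]; linarith) hAX hYs
      · exact mul_mem_gradedPart (fun a b ha hb => by rw [hb]; linarith) hr hZ0
    have hPE : P = toMat r⁻¹ * (Y * (A - X) - (A - X) * Y - A * Z) := by
      have h1 : Y * (A - X) - (A - X) * Y - A * Z = Y * toMat r - toMat r * (Y + Z) := by
        rw [hZ, hA]; noncomm_ring
      rw [h1, mul_sub, ← mul_assoc, ← mul_assoc, hinv, one_mul, hP]; abel
    rw [hPE]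
    exact mul_mem_gradedPart (fun a b ha hb => by linarith) hr'0 hE
  have hdec : toMat r⁻¹ * Y * toMat r = Y + Z + P := by rw [hP]; abel
  have h1 : D Y (ρ r v) = ρ r (D (toMat r⁻¹ * Y * toMat r) v) := by
    have h2 := h.conj_eq r⁻¹ Y hY
    rw [inv_inv] at h2
    rw [← h2]
    simp only [mul_apply_eq_comp, opHom_apply]
    rw [← Module.End.mul_apply, ← map_mul, mul_inv_cancel, map_one, Module.End.one_apply]
  obtain ⟨c, hc⟩ := h.degree_zero _ (h.rep.star_mem Z hZm)
    (conjTranspose_mem_gradedPart (fun t ht => by rw [ht, neg_zero]) hZ0)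
  have hZv : ∀ v, inner ℂ w (D Z v) = (starRingEnd ℂ) c * inner ℂ w v := fun v => by
    rw [← h.rep.adjoint' hZm, hc, inner_smul_left]
  have hYw : D Y w = 0 := h.degree_neg Y hY (-s) (neg_lt_zero.mpr hs) hYs
  have hcc : (starRingEnd ℂ) c = inner ℂ (D Y.conjTranspose w) (D X w) := by
    have h2 := hZv w
    rw [h.inner_self, mul_one] at h2
    have h3 := h.rep.map_lie_apply hY hXm w
    rw [hYw, map_zero, zero_add] at h3
    rw [← h2, h.rep.adjoint' hY, h3]
  rw [h1, h.inner_apply_unipotent hrR, hdec, map_add, map_add]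
  simp only [FunLike.coe_add, Pi.add_apply, inner_add_right]
  rw [h.inner_apply_of_pos hPm hPs, add_zero, hZv, hcc]

/-- The slice conditions: the raising operators map `v` into the orthogonal complement of `w`. -/
def SliceCond (hG : IsConnectedReductive G) (D : Matrix (Fin n) (Fin n) ℂ →ₗ[ℂ] (V →L[ℂ] V))
    (β : hermPart G) (w v : V) (t : ℝ) : Prop :=
  ∀ Y ∈ lieSub hG, Y ∈ gradedPart (isHermitian_coe β) (· = -t) → inner ℂ w (D Y v) = (0 : ℂ)

theorem sliceCond_of_notMem (h : IsExtremal hG ρ D β w) {t : ℝ}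
    (ht : t ∉ weights (isHermitian_coe β)) (v : V) : SliceCond hG D β w v t := by
  intro Y hY hYt
  have h1 : Y.conjTranspose ∈ gradedPart (isHermitian_coe β) (· = t) :=
    conjTranspose_mem_gradedPart (fun s hs => by rw [hs, neg_neg]) hYt
  have h2 : Y.conjTranspose = 0 := eq_zero_of_mem_gradedPart (fun x hx hxt => ht ((show x = t from hxt) ▸ hx)) h1
  rw [← h.rep.adjoint' hY, h2]
  simp

/-- Let `X` be the leading term of `r`. Testing with `Y = X*` leaves `‖Xw‖² ⟨w, v⟩ = 0`, so `X = 0`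
by injectivity in positive degree; the order of `r - 1` thus increases until `r = 1`. -/
theorem eq_one_of_slice (h : IsExtremal hG ρ D β w) {v : V} (hv0 : inner ℂ w v ≠ (0 : ℂ))
    (hv : ∀ t, 0 < t → SliceCond hG D β w v t) {r : G} (hr : r ∈ unipotentRadical G β)
    (hrv : ∀ t, 0 < t → SliceCond hG D β w (ρ r v) t) : r = 1 := by
  have key : ∀ a : ℝ, 0 ≤ a → toMat r - 1 ∈ gradedPart (isHermitian_coe β) (a < ·) → r = 1 := by
    refine weight_induction (isHermitian_coe β) (fun a ha _ hra => ?_) (fun a s has hw ih ha hra => ?_)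
    · have := eq_zero_of_mem_gradedPart (fun w hw => not_lt.mpr (ha w hw)) hra
      exact toMat_injective (by rw [toMat_one]; exact sub_eq_zero.mp this)
    · have hs : 0 < s := ha.trans_lt has
      have hrs := gradedPart_ge_of_gt hw hra
      set X := degComp (isHermitian_coe β) s (toMat r - 1) with hX
      have hXm : X ∈ lieSub hG := degComp_mem_lieSub hG β hs hrs
      have hXs : X ∈ gradedPart (isHermitian_coe β) (· = s) := degComp_mem s _
      have hYs : X.conjTranspose ∈ gradedPart (isHermitian_coe β) (· = -s) :=
        conjTranspose_mem_gradedPart (fun t ht => by rw [ht]) hXs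
      have h1 := h.inner_apply_apply hs hrs (h.rep.star_mem X hXm) hYs v
      rw [hv s hs _ (h.rep.star_mem X hXm) hYs, hrv s hs _ (h.rep.star_mem X hXm) hYs, zero_add,
        Matrix.conjTranspose_conjTranspose] at h1
      have h2 := (mul_eq_zero.mp h1.symm).resolve_right hv0
      have h3 : X = 0 := h.degree_pos X hXm s hs hXs (inner_self_eq_zero.mp h2)
      refine ih hs.le ?_
      have h4 := sub_degComp_mem (s := s) hrs
      rw [← hX, h3, sub_zero] at h4
      exact gradedPart_mono' (fun t ht => lt_of_le_of_ne ht.1 (Ne.symm ht.2)) h4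
  exact key 0 le_rfl (mem_unipotentRadical_iff.mp hr)

/-- Linear solution of the leading order slice equation. -/
theorem exists_correction (h : IsExtremal hG ρ D β w) {s : ℝ} (hs : 0 < s) :
    ∃ T : V →ₗ[ℂ] Mat, (∀ v, T v ∈ lieSub hG) ∧
      (∀ v, T v ∈ gradedPart (isHermitian_coe β) (· = s)) ∧
      ∀ v, ∀ Z ∈ lieSub hG, Z ∈ gradedPart (isHermitian_coe β) (· = s) →
        inner ℂ (D Z w) (D (T v) w) = (inner ℂ (D Z w) v : ℂ) := by
  let 𝔫 : Submodule ℂ Mat := lieSub hG ⊓ gradedPart (isHermitian_coe β) (· = s)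
  let F : 𝔫 →ₗ[ℂ] V := (ContinuousLinearMap.apply ℂ V w).toLinearMap ∘ₗ D ∘ₗ 𝔫.subtype
  have hF : LinearMap.ker F = ⊥ := by
    rw [LinearMap.ker_eq_bot']
    rintro ⟨X, hX⟩ hX0
    exact Subtype.ext (h.degree_pos X hX.1 s hs hX.2 hX0)
  obtain ⟨L, hL⟩ := F.exists_leftInverse_of_injective hF
  -- `T v` is the element of degree `s` for which `(T v) w` is the orthogonal projection of `v` onto
  -- the image `𝔤_s w`; it is linear in `v` because `X ↦ Xw` is injective there.
  let p : V →L[ℂ] V := (LinearMap.range F).starProjection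
  refine ⟨𝔫.subtype ∘ₗ L ∘ₗ p.toLinearMap, fun v => (L (p v)).2.1, fun v => (L (p v)).2.2,
    fun v Z hZ hZs => ?_⟩
  have hpv : p v ∈ LinearMap.range F := Submodule.starProjection_apply_mem _ v
  obtain ⟨X, hX⟩ := hpv
  have h1 : D (L (p v) : Mat) w = p v := by
    change F (L (p v)) = p v
    rw [← hX]
    congr 1
    exact LinearMap.congr_fun hL X
  change inner ℂ (D Z w) (D (L (p v) : Mat) w) = _
  rw [h1]
  have h2 : D Z w ∈ LinearMap.range F := ⟨⟨Z, hZ, hZs⟩, rfl⟩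
  have h3 := Submodule.inner_starProjection_left_eq_right (K := LinearMap.range F) (D Z w) v
  rw [← h3, Submodule.starProjection_eq_self_iff.mpr h2]

/-- Slice conditions are imposed by increasing degree: applying `exp(-T v)` achieves the one in
degree `s` and keeps those in smaller degrees. Truncating the exponentials at uniform length keeps
everything polynomial in `v`. The inverse `g'` is carried along because the inverse of the action
map involves `r⁻¹`. -/
theorem exists_section (h : IsExtremal hG ρ D β w) : ∃ g g' : V → Mat, IsPolyMap g ∧ IsPolyMap g' ∧
    ∀ v, inner ℂ w v = (1 : ℂ) → ∃ r ∈ unipotentRadical G β, toMat r = g v ∧ toMat r⁻¹ = g' v ∧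
      ∀ t, 0 < t → SliceCond hG D β w (ρ r v) t := by
  have key : ∀ a : ℝ, 0 ≤ a → ∃ g g' : V → Mat, IsPolyMap g ∧ IsPolyMap g' ∧
      ∀ v, inner ℂ w v = (1 : ℂ) → (∀ t, 0 < t → t ≤ a → SliceCond hG D β w v t) →
        ∃ r ∈ unipotentRadical G β, toMat r = g v ∧ toMat r⁻¹ = g' v ∧
          ∀ t, 0 < t → SliceCond hG D β w (ρ r v) t := by
    refine weight_induction (isHermitian_coe β) (fun a ha _ => ?_) (fun a s has hw ih ha => ?_)
    · refine ⟨fun _ => 1, fun _ => 1, .const 1, .const 1, fun v _ hv =>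
        ⟨1, one_mem_unipotentRadical, toMat_one, by rw [inv_one, toMat_one], fun t ht => ?_⟩⟩
      rw [map_one, Module.End.one_apply]
      by_cases hta : t ≤ a
      · exact hv t ht hta
      · exact h.sliceCond_of_notMem (fun htw => hta (ha t htw)) v
    · have hs : 0 < s := ha.trans_lt has
      obtain ⟨g, g', hg, hg', hgg⟩ := ih hs.le
      obtain ⟨T, hTm, hTs, hT⟩ := h.exists_correction hs
      obtain ⟨N, hN⟩ := exists_pow_eq_zero_of_lie (D β) hs
      obtain ⟨N', hN'⟩ := exists_pow_eq_zero (isHermitian_coe β) hs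
      have hTs' : ∀ v, T v ∈ gradedPart (isHermitian_coe β) (s ≤ ·) := fun v =>
        gradedPart_mono' (fun t ht => ht.ge) (hTs v)
      let v₁ : V → V := fun v => (∑ k ∈ Finset.range (N + 1), ((k.factorial : ℂ)⁻¹) • (-D (T v)) ^ k) v
      have hv₁ : IsPolyMap v₁ := by
        refine IsPolyMap.bilinear (E := V →L[ℂ] V) (F := V) (H := V) (ContinuousLinearMap.coeLM ℂ) ?_ .id
        exact .truncExp (by simpa using IsPolyMap.linear (-(D ∘ₗ T))) _
      refine ⟨fun v => g (v₁ v) * ∑ k ∈ Finset.range N', ((k.factorial : ℂ)⁻¹) • (-T v) ^ k,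
        fun v => (∑ k ∈ Finset.range N', ((k.factorial : ℂ)⁻¹) • (T v) ^ k) * g' (v₁ v),
        (hg.comp hv₁).mul (.truncExp (by simpa using IsPolyMap.linear (-T)) _),
        (IsPolyMap.truncExp (.linear T) _).mul (hg'.comp hv₁), fun v hv1 hv => ?_⟩
      have hnTm := (lieSub hG).neg_mem (hTm v)
      have hnTs := Submodule.neg_mem _ (hTs v)
      set r₁ := expG (mem_lieSub.mp hnTm) with hr₁
      have hr₁R : r₁ ∈ unipotentRadical G β := expG_mem_unipotentRadical hs _ hnTs
      have hr₁s : toMat r₁ - 1 ∈ gradedPart (isHermitian_coe β) (s ≤ ·) :=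
        exp_sub_one_mem_gradedPart hs (gradedPart_mono' (fun t ht => ht.ge) hnTs)
      have hr₁v : ρ r₁ v = v₁ v := by
        have h1 := hN _ (h.lie_map hnTm hnTs)
        rw [← opHom_apply, hr₁, h.opHom_expG hnTm, exp_eq_sum_range_of_pow_eq_zero h1, map_neg]
      have hcond : ∀ t, 0 < t → t ≤ s → SliceCond hG D β w (v₁ v) t := by
        intro t ht hts
        -- No degree lies strictly between `a` and `s`, so for `t > a` only `t = s` matters, where
        -- `T` was chosen to cancel `⟨w, Yv⟩`. For `t ≤ a` the element `r₁` has no component of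
        -- degree `t`.
        by_cases hta : t ≤ a
        swap
        · by_cases hts' : t = s
          · subst hts'
            intro Y hY hYs
            rw [← hr₁v, h.inner_apply_apply hs hr₁s hY hYs, hr₁, toMat_expG,
              degComp_exp_sub_one hs hnTs, hv1, mul_one, map_neg, FunLike.coe_neg, Pi.neg_apply,
              inner_neg_right, hT v _ (h.rep.star_mem Y hY)
                (conjTranspose_mem_gradedPart (fun t ht => by rw [ht, neg_neg]) hYs),
              h.rep.adjoint' hY, add_neg_cancel]
          · refine h.sliceCond_of_notMem (fun htw => ?_) _
            exact hts' (le_antisymm hts (hw t htw (not_le.mp hta)))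
        intro Y hY hYt
        rw [← hr₁v, h.inner_apply_apply ht
          (gradedPart_mono' (fun x hx => hts.trans hx) hr₁s) hY hYt,
          degComp_eq_zero (not_le.mpr (hta.trans_lt has)) hr₁s, hv t ht hta Y hY hYt]
        simp
      obtain ⟨r₂, hr₂R, hr₂, hr₂', hr₂s⟩ := hgg (v₁ v)
        (by rw [← hr₁v, h.inner_apply_unipotent hr₁R, hv1]) hcond
      refine ⟨r₂ * r₁, mul_mem_unipotentRadical hr₂R hr₁R, ?_, ?_, fun t ht => ?_⟩
      · rw [toMat_mul, hr₂, hr₁, toMat_expG, matrix_exp_eq_sum (hN' _ (Submodule.neg_mem _ (hTs' v)))]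
      · have h1 : r₁⁻¹ = expG (mem_lieSub.mp (hTm v)) := by
          apply toMat_injective
          have h2 := expG_mul_expG_neg hG (hTm v)
          rw [eq_inv_of_mul_eq_one_left h2]
        rw [mul_inv_rev, toMat_mul, hr₂', h1, toMat_expG, matrix_exp_eq_sum (hN' _ (hTs' v))]
      · rw [map_mul, Module.End.mul_apply, hr₁v]
        exact hr₂s t ht
  obtain ⟨g, g', hg, hg', hgg⟩ := key 0 le_rfl
  exact ⟨g, g', hg, hg', fun v hv => hgg v hv fun t ht ht0 => absurd ht (not_lt.mpr ht0)⟩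

/-- The representation is polynomial on the unipotent radical. -/
theorem exists_isPolyMap_rep (h : IsExtremal hG ρ D β w) : ∃ F : Mat → (V →L[ℂ] V), IsPolyMap F ∧
    ∀ r ∈ unipotentRadical G β, opHom ρ r = F (toMat r) := by
  have key : ∀ a : ℝ, 0 ≤ a → ∃ F : Mat → (V →L[ℂ] V), IsPolyMap F ∧
      ∀ r : G, toMat r - 1 ∈ gradedPart (isHermitian_coe β) (a < ·) → opHom ρ r = F (toMat r) := by
    refine weight_induction (isHermitian_coe β) (fun a ha _ => ?_) (fun a s has hw ih ha => ?_)
    · refine ⟨fun _ => 1, .const 1, fun r hr => ?_⟩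
      have := eq_zero_of_mem_gradedPart (fun w hw => not_lt.mpr (ha w hw)) hr
      have : r = 1 := toMat_injective (by rw [toMat_one]; exact sub_eq_zero.mp this)
      rw [this, map_one]
    · have hs : 0 < s := ha.trans_lt has
      obtain ⟨F, hF, hFr⟩ := ih hs.le
      obtain ⟨N, hN⟩ := exists_pow_eq_zero_of_lie (D β) hs
      obtain ⟨N', hN'⟩ := exists_pow_eq_zero (isHermitian_coe β) hs
      let X : Mat → Mat := fun A => degComp (isHermitian_coe β) s (A - 1)
      have hX : IsPolyMap X := IsPolyMap.linear_comp _ (by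
        simpa [sub_eq_add_neg] using IsPolyMap.id.add (IsPolyMap.const (-1 : Mat)))
      -- The leading term `X` is affine in the matrix of `r`, and `exp(-X) r` has higher order, so
      -- `ρ r = exp(D X) ρ(exp(-X) r)` with both exponentials truncated.
      refine ⟨fun A => (∑ k ∈ Finset.range (N + 1), ((k.factorial : ℂ)⁻¹) • (D (X A)) ^ k) *
        F ((∑ k ∈ Finset.range N', ((k.factorial : ℂ)⁻¹) • (-X A) ^ k) * A),
        (IsPolyMap.truncExp (hX.linear_comp D) _).mul (hF.comp ((IsPolyMap.truncExp (by
          simpa using hX.linear_comp (-LinearMap.id)) _).mul .id)), fun r hr => ?_⟩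
      have hrs := gradedPart_ge_of_gt hw hr
      obtain ⟨hXm, r₂, hr₂, hr₂m, hr₂s⟩ := exists_eq_exp_mul hG β hs hrs
      have hXs : X (toMat r) ∈ gradedPart (isHermitian_coe β) (· = s) := degComp_mem s _
      have hXs' : X (toMat r) ∈ gradedPart (isHermitian_coe β) (s ≤ ·) :=
        gradedPart_mono' (fun t ht => ht.ge) hXs
      conv_lhs => rw [hr₂]
      rw [map_mul, h.opHom_expG hXm, hFr r₂ hr₂s, hr₂m,
        exp_eq_sum_range_of_pow_eq_zero (hN _ (h.lie_map hXm hXs)),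
        matrix_exp_eq_sum (hN' _ (Submodule.neg_mem _ hXs'))]
  obtain ⟨F, hF, hFr⟩ := key 0 le_rfl
  exact ⟨F, hF, fun r hr => hFr r (mem_unipotentRadical_iff.mp hr)⟩

end IsExtremal

end Slice

/-! ### The action map and its inverse. -/

section Action

variable {n : ℕ} {G : Subgroup (GL (Fin n) ℂ)}
  {V : Type*} [NormedAddCommGroup V] [InnerProductSpace ℂ V] [FiniteDimensional ℂ V]

local notation "Mat" => Matrix (Fin n) (Fin n) ℂ

theorem mk_mem_projSubspace {M : Submodule ℂ V} {v : V} (hv : v ≠ 0) :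
    Projectivization.mk ℂ v hv ∈ projSubspace M ↔ v ∈ M := by
  change (Projectivization.mk ℂ v hv).submodule ≤ _ ↔ _
  rw [Projectivization.submodule_mk, Submodule.span_singleton_le_iff_mem]

theorem gradedPart_congr {β β' : Mat} (hβ : β.IsHermitian) (hβ' : β'.IsHermitian) (h : β = β')
    (p : ℝ → Prop) : gradedPart hβ p = gradedPart hβ' p := by
  subst h; rfl

variable {hG : IsConnectedReductive G} {ρ : Representation ℂ G V}
    {D : Matrix (Fin n) (Fin n) ℂ →ₗ[ℂ] (V →L[ℂ] V)}

theorem IsMomentumSetting.IsNormMax.isExtremal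
    {B : LinearMap.BilinForm ℝ (Matrix (Fin n) (Fin n) ℂ)} {μ : ℙ ℂ V → hermPart G}
    {S : IsMomentumSetting hG ρ D B μ} {W : Subrepresentation ρ} {w : V}
    (h : IsNormMax S W w) {β : hermPart G} (hβ : momentVec μ w = β) : IsExtremal hG ρ D β w where
  rep := S.rep
  exp_eq := S.exp_eq
  conj_eq := S.conj_eq
  norm := h.norm
  degree_neg := fun X hX s hs0 hs => by
    rw [gradedPart_congr (isHermitian_coe β) h.herm.2 hβ.symm] at hs
    exact h.degree_neg hX hs0 hs
  degree_zero := fun X hX hs => by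
    rw [gradedPart_congr (isHermitian_coe β) h.herm.2 hβ.symm] at hs
    exact ⟨_, h.degree_zero hX hs h.mem h.apply_self⟩
  degree_pos := fun X hX s hs0 hs => by
    rw [gradedPart_congr (isHermitian_coe β) h.herm.2 hβ.symm] at hs
    exact h.degree_pos hX hs0 hs

theorem IsMomentumSetting.IsNormMax.eigenspaceIn_eq
    {B : LinearMap.BilinForm ℝ (Matrix (Fin n) (Fin n) ℂ)} {μ : ℙ ℂ V → hermPart G}
    {S : IsMomentumSetting hG ρ D B μ} {W : Subrepresentation ρ} {w : V}
    (h : IsNormMax S W w) (hW : W.toRepresentation.IsIrreducible) {β : hermPart G}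
    (hβ : momentVec μ w = β) {β₀ : ℝ} (hβ₀ : IsLargestEigenvalueIn ρ β W.toSubmodule β₀) :
    eigenspaceIn ρ β W.toSubmodule β₀ = Submodule.span ℂ {w} := by
  have hmem : ∀ (r : ℝ) (v : V), v ∈ eigenspaceIn ρ β W.toSubmodule r ↔
      v ∈ W.toSubmodule ∧ D (momentVec μ w) v = (r : ℂ) • v := by
    intro r v
    rw [eigenspaceIn, Submodule.mem_inf, Module.End.mem_eigenspace_iff, S.dRep_eq, hβ]
    rfl
  set a : ℝ := (inner ℂ (D (momentVec μ w) w) w).re with ha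
  have hw0 := ne_zero_of_norm_eq_one h.norm
  have hβa : β₀ = a := by
    apply le_antisymm
    · obtain ⟨v, hv, hv0⟩ := Submodule.exists_mem_ne_zero_of_ne_bot hβ₀.1
      obtain ⟨hvW, hv1⟩ := (hmem _ _).mp hv
      have h1 := h.rayleigh_le hvW
      rw [hv1, inner_smul_left, Complex.conj_ofReal, Complex.re_ofReal_mul,
        inner_self_eq_norm_sq_to_K] at h1
      have h2 : (((‖v‖ : ℝ) : ℂ) ^ 2).re = ‖v‖ ^ 2 := by norm_cast
      change _ * (((‖v‖ : ℝ) : ℂ) ^ 2).re ≤ _ at h1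
      rw [h2] at h1
      have := norm_pos_iff.mpr hv0
      exact le_of_mul_le_mul_right h1 (by positivity)
    · refine hβ₀.2 (show eigenspaceIn ρ β W.toSubmodule a ≠ ⊥ from fun hbot => hw0 ?_)
      have h1 : w ∈ eigenspaceIn ρ β W.toSubmodule a := (hmem _ _).mpr ⟨h.mem, h.apply_self⟩
      rw [hbot] at h1
      exact (Submodule.mem_bot ℂ).mp h1
  ext v
  rw [hmem, Submodule.mem_span_singleton, hβa]
  constructor
  · rintro ⟨hv, hva⟩
    exact ⟨_, (h.eq_smul hW hv hva).symm⟩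
  · rintro ⟨c, rfl⟩
    exact ⟨W.toSubmodule.smul_mem c h.mem, by rw [map_smul, h.apply_self, smul_comm]⟩

namespace IsExtremal

variable {β : hermPart G} {w : V}

/-- Negative degrees kill `w` and degree zero preserves `ℂw`. Once the component along `w` is
removed, orthogonality to `𝔤w` has to be tested only on `Xw` with `X` of positive degree, where
`⟨Xw, v⟩ = ⟨w, X*v⟩`. -/
theorem mem_slice_iff (h : IsExtremal hG ρ D β w) (hD : ∀ X : lieAlg G, dRep ρ X = D X) {c : ℂ}
    (hc : c ≠ 0) (v : V) : v ∈ Submodule.span ℂ {w} ⊔ (lieOrbit ρ (c • w))ᗮ ↔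
      ∀ t, 0 < t → SliceCond hG D β w v t := by
  have horth : ∀ u, u ∈ (lieOrbit ρ (c • w))ᗮ ↔ ∀ X ∈ lieSub hG, inner ℂ (D X w) u = (0 : ℂ) := by
    intro u
    have h1 : ∀ X : lieAlg G, inner ℂ (dRep ρ X (c • w)) u =
        (starRingEnd ℂ) c * inner ℂ (D X w) u := fun X => by
      rw [hD, map_smul, inner_smul_left]
    have hc' : (starRingEnd ℂ) c ≠ 0 := (map_ne_zero _).mpr hc
    constructor
    · intro hu X hX
      have h2 := (Submodule.mem_orthogonal _ _).mp hu _ (Submodule.subset_span ⟨⟨X, mem_lieSub.mp hX⟩, rfl⟩)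
      rw [h1] at h2
      exact (mul_eq_zero.mp h2).resolve_left hc'
    · intro hu
      have h2 : lieOrbit ρ (c • w) ≤ (Submodule.span ℂ {u})ᗮ := by
        refine Submodule.span_le.mpr ?_
        rintro _ ⟨X, rfl⟩
        refine Submodule.mem_orthogonal_singleton_iff_inner_left.mpr ?_
        rw [h1, hu X (mem_lieSub.mpr X.2), mul_zero]
      refine (Submodule.mem_orthogonal _ _).mpr fun x hx => ?_
      exact Submodule.mem_orthogonal_singleton_iff_inner_left.mp (h2 hx)
  constructor
  · intro hv t ht Y hY hYt
    obtain ⟨x, hx, u, hu, rfl⟩ := Submodule.mem_sup.mp hv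
    obtain ⟨b, rfl⟩ := Submodule.mem_span_singleton.mp hx
    rw [map_add, map_smul, h.degree_neg Y hY (-t) (neg_lt_zero.mpr ht) hYt, smul_zero, zero_add,
      ← h.rep.adjoint' hY]
    exact (horth u).mp hu _ (h.rep.star_mem Y hY)
  · intro hv
    set b : ℂ := inner ℂ w v with hb
    have hvu : v = b • w + (v - b • w) := by abel
    rw [hvu]
    refine Submodule.add_mem_sup (Submodule.smul_mem _ _ (Submodule.mem_span_singleton_self w))
      ((horth _).mpr fun X hX => ?_)
    set u := v - b • w with hu
    have hwu : inner ℂ w u = (0 : ℂ) := by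
      rw [hu, inner_sub_right, inner_smul_right, h.inner_self, mul_one, sub_self]
    let P : Submodule ℂ Mat := LinearMap.ker ((innerSL ℂ u).toLinearMap ∘ₗ
      (ContinuousLinearMap.apply ℂ V w).toLinearMap ∘ₗ D)
    have hP : lieSub hG ≤ P := by
      refine le_of_homogeneous_mem (hβ := isHermitian_coe β)
        (fun X hX => h.rep.lie_mem _ (mem_lieSub.mpr β.2.1) X hX) (fun s X hX hs => ?_)
      change inner ℂ u (D X w) = (0 : ℂ)
      rcases lt_trichotomy s 0 with h0 | rfl | h0
      · rw [h.degree_neg X hX s h0 hs, inner_zero_right]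
      · obtain ⟨d, hd⟩ := h.degree_zero X hX hs
        rw [hd, inner_smul_right, ← inner_conj_symm, hwu, map_zero, mul_zero]
      · have hXs : X.conjTranspose ∈ gradedPart (isHermitian_coe β) (· = -s) :=
          conjTranspose_mem_gradedPart (fun t ht => by rw [ht]) hs
        rw [← inner_conj_symm, h.rep.adjoint X hX, hu, map_sub, map_smul,
          h.conjTranspose_apply hX h0 hs, smul_zero, sub_zero,
          hv s h0 _ (h.rep.star_mem X hX) hXs, map_zero]
    rw [← inner_conj_symm, show inner ℂ u (D X w) = (0 : ℂ) from hP hX, map_zero]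

theorem actionMap_mk (r : G) {v : V} (hv : v ≠ 0) (hrv : ρ r v ≠ 0) :
    actionMap ρ (r, Projectivization.mk ℂ v hv) = Projectivization.mk ℂ (ρ r v) hrv := by
  rw [actionMap, projAct, Projectivization.map_mk]

theorem rep_ne_zero (r : G) {v : V} (hv : v ≠ 0) : ρ r v ≠ 0 := by
  rw [← map_zero (ρ r)]
  exact (ρ.apply_bijective r).1.ne hv

/-- If `rv` and `r'v'` are proportional, then `r'⁻¹r` takes the slice vector `v` to a multiple of
the slice vector `v'`, so it is `1`. -/
theorem injOn_actionMap (h : IsExtremal hG ρ D β w) {L : Submodule ℂ V}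
    (hL : ∀ v, v ∈ L ↔ ∀ t, 0 < t → SliceCond hG D β w v t)
    : Set.InjOn (actionMap ρ) (unipotentRadical G β ×ˢ
    (projSubspace L \ projSubspace (Submodule.span ℂ {w})ᗮ)) := by
  rintro ⟨r, x⟩ ⟨hr, hx⟩ ⟨r', x'⟩ ⟨hr', hx'⟩ heq
  induction x using Projectivization.ind with | h v hv => ?_
  induction x' using Projectivization.ind with | h v' hv' => ?_
  simp only [Set.mem_sdiff, mk_mem_projSubspace,
    Submodule.mem_orthogonal_singleton_iff_inner_right] at hx hx'
  rw [actionMap_mk r hv (rep_ne_zero r hv), actionMap_mk r' hv' (rep_ne_zero r' hv'),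
    Projectivization.mk_eq_mk_iff'] at heq
  obtain ⟨a, ha⟩ := heq
  have h1 : ρ (r'⁻¹ * r) v = a • v' := by
    rw [map_mul, Module.End.mul_apply, ← ha, map_smul, ← Module.End.mul_apply, ← map_mul,
      inv_mul_cancel, map_one, Module.End.one_apply]
  have h2 := h.eq_one_of_slice hx.2 ((hL v).mp hx.1)
    (mul_mem_unipotentRadical (inv_mem_unipotentRadical hG hr') hr)
    (by rw [h1]; exact (hL _).mp (L.smul_mem a hx'.1))
  have h3 : r = r' := (inv_mul_eq_one.mp h2).symm
  subst h3
  rw [h2, map_one, Module.End.one_apply] at h1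
  rw [Prod.mk.injEq]
  exact ⟨rfl, (Projectivization.mk_eq_mk_iff' ℂ _ _ _ _).mpr ⟨a, h1.symm⟩⟩

theorem mapsTo_actionMap (h : IsExtremal hG ρ D β w) {L : Submodule ℂ V} : Set.MapsTo (actionMap ρ) (unipotentRadical G β ×ˢ
    (projSubspace L \ projSubspace (Submodule.span ℂ {w})ᗮ))
    (Set.univ \ projSubspace (Submodule.span ℂ {w})ᗮ) := by
  rintro ⟨r, x⟩ ⟨hr, hx⟩
  induction x using Projectivization.ind with | h v hv => ?_
  rw [actionMap_mk r hv (rep_ne_zero r hv)]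
  simp only [Set.mem_sdiff, mk_mem_projSubspace,
      Submodule.mem_orthogonal_singleton_iff_inner_right, Set.mem_univ, true_and] at hx ⊢
  rw [h.inner_apply_unipotent hr]
  exact hx.2

theorem exists_preimage (h : IsExtremal hG ρ D β w) {L : Submodule ℂ V}
    (hL : ∀ v, v ∈ L ↔ ∀ t, 0 < t → SliceCond hG D β w v t)
    {g g' : V → Mat}
    (hgg : ∀ v, inner ℂ w v = (1 : ℂ) → ∃ r ∈ unipotentRadical G β, toMat r = g v ∧
      toMat r⁻¹ = g' v ∧ ∀ t, 0 < t → SliceCond hG D β w (ρ r v) t) {v : V} (hv : v ≠ 0)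
    (hv0 : inner ℂ w v ≠ (0 : ℂ)) : ∃ r ∈ unipotentRadical G β,
      toMat r = g ((inner ℂ w v : ℂ)⁻¹ • v) ∧ toMat r⁻¹ = g' ((inner ℂ w v : ℂ)⁻¹ • v) ∧
      (r⁻¹, Projectivization.mk ℂ (ρ r v) (rep_ne_zero r hv)) ∈ (unipotentRadical G β ×ˢ
        (projSubspace L \ projSubspace (Submodule.span ℂ {w})ᗮ)) ∧
      actionMap ρ (r⁻¹, Projectivization.mk ℂ (ρ r v) (rep_ne_zero r hv)) =
        Projectivization.mk ℂ v hv := by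
  obtain ⟨r, hr, hr1, hr2, hr3⟩ := hgg ((inner ℂ w v : ℂ)⁻¹ • v)
    (by rw [inner_smul_right, inv_mul_cancel₀ hv0])
  refine ⟨r, hr, hr1, hr2, ⟨inv_mem_unipotentRadical hG hr, ?_⟩, ?_⟩
  · simp only [Set.mem_sdiff, mk_mem_projSubspace,
    Submodule.mem_orthogonal_singleton_iff_inner_right]
    refine ⟨?_, by rwa [h.inner_apply_unipotent hr]⟩
    have h1 := L.smul_mem (inner ℂ w v : ℂ) ((hL _).mpr hr3)
    rwa [map_smul, smul_smul, mul_inv_cancel₀ hv0, one_smul] at h1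
  · rw [actionMap_mk r⁻¹ _ (rep_ne_zero _ (rep_ne_zero r hv))]
    congr 1
    rw [← Module.End.mul_apply, ← map_mul, inv_mul_cancel, map_one, Module.End.one_apply]

/-- The action is polynomial in `(r, v)`. With `u = v / ⟨w, v⟩` and `r` the section at `u`, the
inverse sends `[v]` to `(r⁻¹, [ru])`, which is polynomial in `u`; homogenizing gives a quotient with
denominator `⟨w, v⟩ ^ M`. -/
theorem isBiregular_actionMap (h : IsExtremal hG ρ D β w) {L : Submodule ℂ V}
    (hL : ∀ v, v ∈ L ↔ ∀ t, 0 < t → SliceCond hG D β w v t)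
    :
    IsBiregular groupProjCoords projCoords (unipotentRadical G β ×ˢ
        (projSubspace L \ projSubspace (Submodule.span ℂ {w})ᗮ))
      (Set.univ \ projSubspace (Submodule.span ℂ {w})ᗮ) (actionMap ρ) := by
  obtain ⟨F, hF, hFr⟩ := h.exists_isPolyMap_rep
  obtain ⟨g, g', hg, hg', hgg⟩ := h.exists_section
  have hinj := injOn_actionMap h hL
  have hbij : Set.BijOn (actionMap ρ) (unipotentRadical G β ×ˢ
        (projSubspace L \ projSubspace (Submodule.span ℂ {w})ᗮ))
      (Set.univ \ projSubspace (Submodule.span ℂ {w})ᗮ) := by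
    refine ⟨mapsTo_actionMap h, hinj, ?_⟩
    intro x hx
    induction x using Projectivization.ind with | h v hv => ?_
    simp only [Set.mem_sdiff, mk_mem_projSubspace,
      Submodule.mem_orthogonal_singleton_iff_inner_right, Set.mem_univ, true_and] at hx
    obtain ⟨r, -, -, -, h1, h2⟩ := exists_preimage h hL hgg hv hx
    exact ⟨_, h1, h2⟩
  refine ⟨hbij, ?_, ?_⟩
  · rintro p - c -
    refine ⟨fun c => F c.1 c.2, fun _ => 1, ?_, .const 1, one_ne_zero, ?_⟩
    · exact IsPolyMap.bilinear (E := V →L[ℂ] V) (F := V) (H := V) (ContinuousLinearMap.coeLM ℂ)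
        (hF.comp (.linear (LinearMap.fst ℂ Mat V))) (.linear (LinearMap.snd ℂ Mat V))
    · rintro c' - ⟨r, x⟩ ⟨hr, hx⟩ ⟨hc1, hv, hc2⟩
      change x = _ at hc2
      subst hc2
      refine ⟨?_, ?_⟩
      · beta_reduce
        rw [inv_one, one_smul, ← hc1, ← hFr r hr]
        exact rep_ne_zero r hv
      · rw [actionMap_mk r hv (rep_ne_zero r hv)]
        congr 1
        beta_reduce
        rw [inv_one, one_smul, ← hc1, ← hFr r hr]
        rfl
  · have : Nonempty (G × ℙ ℂ V) := ⟨1, Projectivization.mk ℂ w h.ne_zero⟩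
    have hinv := hbij.invOn_invFunOn
    refine ⟨_, hbij.surjOn.mapsTo_invFunOn, hinv, ?_⟩
    have hQ : IsPolyMap fun u => (g' u, F (g u) u) := hg'.prodMk
      (IsPolyMap.bilinear (E := V →L[ℂ] V) (F := V) (H := V) (ContinuousLinearMap.coeLM ℂ)
        (hF.comp hg) .id)
    obtain ⟨M, P, hP, hPQ⟩ := hQ.exists_homogenization (innerSL ℂ w).toLinearMap
    intro x hx c hc
    refine ⟨P, fun c => (inner ℂ w c : ℂ) ^ M, hP,
      (IsPolynomialFun.linear (innerSL ℂ w).toLinearMap).pow M, ?_, ?_⟩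
    · obtain ⟨hc0, rfl⟩ := hc
      simp only [Set.mem_sdiff, mk_mem_projSubspace,
      Submodule.mem_orthogonal_singleton_iff_inner_right, Set.mem_univ, true_and] at hx
      exact pow_ne_zero M hx
    · rintro c' - x' hx' ⟨hc0, rfl⟩
      simp only [Set.mem_sdiff, mk_mem_projSubspace,
      Submodule.mem_orthogonal_singleton_iff_inner_right, Set.mem_univ, true_and] at hx'
      obtain ⟨r, hr, hr1, hr2, h1, h2⟩ := exists_preimage h hL hgg hc0 hx'
      have h3 := hinv.1 h1
      rw [h2] at h3
      rw [h3]
      have h4 : ((inner ℂ w c' : ℂ) ^ M)⁻¹ • P c' = (toMat r⁻¹, (inner ℂ w c' : ℂ)⁻¹ • ρ r c') := by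
        have h5 := hPQ c' hx'
        change (_, _) = ((inner ℂ w c' : ℂ) ^ M)⁻¹ • P c' at h5
        rw [← h5]
        change (g' ((inner ℂ w c' : ℂ)⁻¹ • c'),
          F (g ((inner ℂ w c' : ℂ)⁻¹ • c')) ((inner ℂ w c' : ℂ)⁻¹ • c')) = _
        rw [← hr1, ← hr2, ← hFr r hr, opHom_apply, map_smul]
      rw [h4]
      refine ⟨rfl, smul_ne_zero (inv_ne_zero hx') (rep_ne_zero r hc0), ?_⟩
      exact ((Projectivization.mk_eq_mk_iff' ℂ _ _ _ _).mpr ⟨_, rfl⟩).symm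

theorem isBiholomorphic_actionMap (h : IsExtremal hG ρ D β w) {L : Submodule ℂ V}
    (hL : ∀ v, v ∈ L ↔ ∀ t, 0 < t → SliceCond hG D β w v t)
    :
    IsBiholomorphic groupProjCoords projCoords (unipotentRadical G β ×ˢ
        (projSubspace L \ projSubspace (Submodule.span ℂ {w})ᗮ))
      (Set.univ \ projSubspace (Submodule.span ℂ {w})ᗮ) (actionMap ρ) := by
  obtain ⟨h1, h2, g, h3, h4, h5⟩ := isBiregular_actionMap h hL
  exact ⟨h1, h2.isHolomorphicOn_matrix_left, g, h3, h4, h5.isHolomorphicOn_matrix_right⟩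

end IsExtremal

end Action

end LocalStructure

theorem mainTheorem6 {n : ℕ} (G : Subgroup (GL (Fin n) ℂ)) (hG : IsConnectedReductive G)
    {V : Type*} [NormedAddCommGroup V] [InnerProductSpace ℂ V] [FiniteDimensional ℂ V]
    (ρ : Representation ℂ G V) (hρ : IsHolomorphicRep ρ) (hK : IsUnitaryRep ρ)
    (B : LinearMap.BilinForm ℝ (Matrix (Fin n) (Fin n) ℂ)) (hB : IsInvariantInner G B)
    (μ : ℙ ℂ V → hermPart G) (hμ : IsMomentumMap ρ B μ)
    (W : Subrepresentation ρ) (hW : W.toRepresentation.IsIrreducible)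
    (β : hermPart G)
    (hβ : (β : Matrix (Fin n) (Fin n) ℂ) ∈ (convexHull ℝ
      ((fun x => (μ x : Matrix (Fin n) (Fin n) ℂ)) '' projSubspace W.toSubmodule)).extremePoints ℝ)
    (β₀ : ℝ) (hβ₀ : IsLargestEigenvalueIn ρ β W.toSubmodule β₀) :
    Module.finrank ℂ (eigenspaceIn ρ β W.toSubmodule β₀) = 1 ∧
    ∀ w₀ ∈ eigenspaceIn ρ β W.toSubmodule β₀, w₀ ≠ 0 →
      IsBiholomorphic groupProjCoords projCoords
        (unipotentRadical G β ×ˢ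
          (projSubspace (eigenspaceIn ρ β W.toSubmodule β₀ ⊔ (lieOrbit ρ w₀)ᗮ) \
            projSubspace (eigenspaceIn ρ β W.toSubmodule β₀)ᗮ))
        (Set.univ \ projSubspace (eigenspaceIn ρ β W.toSubmodule β₀)ᗮ)
        (actionMap ρ) ∧
      IsBiregular groupProjCoords projCoords
        (unipotentRadical G β ×ˢ
          (projSubspace (eigenspaceIn ρ β W.toSubmodule β₀ ⊔ (lieOrbit ρ w₀)ᗮ) \
            projSubspace (eigenspaceIn ρ β W.toSubmodule β₀)ᗮ))
        (Set.univ \ projSubspace (eigenspaceIn ρ β W.toSubmodule β₀)ᗮ)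
        (actionMap ρ) := by
  obtain ⟨D, hrep, hD, hconj, hexp⟩ := exists_isStarLieRep hG ρ hρ hK
  have S : IsMomentumSetting hG ρ D B μ := ⟨hrep, hD, hexp, hconj, hK, hB, hμ⟩
  obtain ⟨w, hw, hwβ⟩ := S.exists_isNormMax hW hβ
  have hw' := hw.isExtremal hwβ
  rw [hw.eigenspaceIn_eq hW hwβ hβ₀]
  refine ⟨finrank_span_singleton hw'.ne_zero, fun w₀ hw₀ hw₀0 => ?_⟩
  obtain ⟨c, rfl⟩ := Submodule.mem_span_singleton.mp hw₀
  have hc : c ≠ 0 := by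
    rintro rfl
    exact hw₀0 (zero_smul ℂ w)
  have hL := hw'.mem_slice_iff hD hc
  exact ⟨hw'.isBiholomorphic_actionMap hL, hw'.isBiregular_actionMap hL⟩
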